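/- For a bounded open set $D\subset\mathbb R^2$ let $\operatorname{curl}u=\partial_{1}u_2-\partial_{2}u_1$ (weakly), let $\|u\|_{H(\operatorname{curl};D)}^2=\|u\|_{L^2(D)}^2+\|\operatorname{curl}u\|_{L^2(D)}^2$, and let $H^1(\operatorname{curl};D)$ be the space of $u\in H^1(D)^2$ with $\operatorname{curl}u\in H^1(D)$, with norm $\|u\|_{H^1(\operatorname{curl};D)}^2=\|u\|_{H^1(D)}^2+\|\operatorname{curl}u\|_{H^1(D)}^2$. (For a closed region, these spaces are understood on its interior.) Let $P$ be the closed region bounded by a simple polygon in the plane, with diameter $h_P$ and convex hull $\mathrm{Conv}(P)$. Assume: (P0) $P$ has a conforming triangulation $\mathcal T_h(P)$ whose vertices are exactly the vertices of $P$ (no additional vertices); (P1) all angles of the triangles in $\mathcal T_h(P)$ are at most $\theta$, where $\theta<\pi$; (P2) $|e|\ge\lambda h_P$ for every edge $e$ of $\mathcal T_h(P)$ that is not an edge of $P$, where $\lambda>0$. Let $V_h(P)$ be the space of all $v\in H(\operatorname{curl};P)$ such that on each triangle of $\mathcal T_h(P)$ the field $v$ has the form $a+b\,(x_2,-x_1)^{\intercal}$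 with $a\in\mathbb R^2$, $b\in\mathbb R$, and such that $\operatorname{curl}v$ is constant on $P$. Then for every $u\in H^1(\operatorname{curl};\mathrm{Conv}(P))$ there is a unique $I_Pu\in V_h(P)$ (the edge interpolation of $u$) such that $$\int_e I_Pu\cdot t\,ds=\int_e u\cdot t\,ds\qquad\text{for every edge } e \text{ of } P,$$ where $t$ is a unit tangent vector of $e$, and $$\|u-I_Pu\|_{H(\operatorname{curl};P)}\le C\,h_P\,\|u\|_{H^1(\operatorname{curl};\mathrm{Conv}(P))},$$ where $C$ depends only on $\theta$ and $\lambda$; in particular, $C$ depends neither on the size of $P$ nor on the anisotropy (aspect ratio) of $P$ and of the triangles in $\mathcal T_h(P)$. -/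

import Mathlib

open MeasureTheory Filter Topology
open scoped ContDiff

namespace EdgeVEM

/-- The Euclidean plane; the coordinates of `x` are `x 0` and `x 1`. -/
abbrev Plane : Type := EuclideanSpace ℝ (Fin 2)

noncomputable section

/-! ### Weak derivatives and Sobolev spaces on an open set `D` of the plane -/

/-- The classical partial derivative of `φ` in the direction of the `i`-th coordinate. -/
def pderiv (i : Fin 2) (φ : Plane → ℝ) (x : Plane) : ℝ :=
  fderiv ℝ φ x (EuclideanSpace.single i (1 : ℝ))

/-- `φ` is a test function on `D`: smooth, with compact support contained in `D`. -/
def IsTestFunction (D : Set Plane) (φ : Plane → ℝ) : Prop :=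
  ContDiff ℝ ∞ φ ∧ HasCompactSupport φ ∧ tsupport φ ⊆ D

/-- `g` is the weak partial derivative `∂ᵢ f` on `D`. -/
def IsWeakPartial (D : Set Plane) (i : Fin 2) (f g : Plane → ℝ) : Prop :=
  LocallyIntegrableOn f D ∧ LocallyIntegrableOn g D ∧
    ∀ φ, IsTestFunction D φ →
      ∫ x in D, f x * pderiv i φ x = -∫ x in D, g x * φ x

open Classical in
/-- The weak partial derivative `∂ᵢ f` on `D` (unique almost everywhere on `D` when it exists;
zero when there is none). -/
def weakPartial (D : Set Plane) (i : Fin 2) (f : Plane → ℝ) : Plane → ℝ :=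
  if h : ∃ g, IsWeakPartial D i f g then h.choose else 0

/-- `c` is the weak scalar curl `∂₁ u₂ - ∂₂ u₁` on `D` of the vector field `u = (u₁, u₂)`. -/
def IsWeakCurl (D : Set Plane) (u : Plane → Plane) (c : Plane → ℝ) : Prop :=
  LocallyIntegrableOn u D ∧ LocallyIntegrableOn c D ∧
    ∀ φ, IsTestFunction D φ →
      ∫ x in D, c x * φ x = ∫ x in D, (u x 0 * pderiv 1 φ x - u x 1 * pderiv 0 φ x)

open Classical in
/-- The weak scalar curl of `u` on `D` (unique almost everywhere on `D` when it exists;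
zero when there is none). -/
def weakCurl (D : Set Plane) (u : Plane → Plane) : Plane → ℝ :=
  if h : ∃ c, IsWeakCurl D u c then h.choose else 0

/-- `f ∈ H¹(D)`, for a scalar function `f`. -/
def MemH1 (D : Set Plane) (f : Plane → ℝ) : Prop :=
  MemLp f 2 (volume.restrict D) ∧
    ∀ i, ∃ g, IsWeakPartial D i f g ∧ MemLp g 2 (volume.restrict D)

/-- The square of the norm of `f` in `H¹(D)`. -/
def h1NormSq (D : Set Plane) (f : Plane → ℝ) : ℝ :=
  ∫ x in D, f x ^ 2 + ∑ i, weakPartial D i f x ^ 2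

/-- `u ∈ H(curl; D)`. -/
def MemHCurl (D : Set Plane) (u : Plane → Plane) : Prop :=
  MemLp u 2 (volume.restrict D) ∧
    ∃ c, IsWeakCurl D u c ∧ MemLp c 2 (volume.restrict D)

/-- The norm of `u` in `H(curl; D)`. -/
def hCurlNorm (D : Set Plane) (u : Plane → Plane) : ℝ :=
  √(∫ x in D, ‖u x‖ ^ 2 + weakCurl D u x ^ 2)

/-- `u ∈ H¹(curl; D)`: both components of `u` and the curl of `u` are in `H¹(D)`. -/
def MemH1Curl (D : Set Plane) (u : Plane → Plane) : Prop :=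
  (∀ j, MemH1 D (fun x => u x j)) ∧ ∃ c, IsWeakCurl D u c ∧ MemH1 D c

/-- The norm of `u` in `H¹(curl; D)`: the square root of `‖u‖²_{H¹(D)} + ‖curl u‖²_{H¹(D)}`. -/
def h1CurlNorm (D : Set Plane) (u : Plane → Plane) : ℝ :=
  √(∑ j, h1NormSq D (fun x => u x j) + h1NormSq D (weakCurl D u))

/-! ### Traces on segments -/

/-- `g` is the trace on the segment `[a, b]` of `w ∈ H¹(D)²`, where `D` is a bounded Lipschitz
domain whose closure contains the segment. The segment is parametrized by
`s ↦ a + s (b - a)`, `0 ≤ s ≤ 1`, and the trace is the `L²` limit on it of smooth vector fields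
that converge to `w` in `H¹(D)²`. -/
def IsTrace (D : Set Plane) (a b : Plane) (w : Plane → Plane) (g : ℝ → Plane) : Prop :=
  (∀ j, MemH1 D (fun x => w x j)) ∧
  MemLp g 2 (volume.restrict (Set.Icc (0 : ℝ) 1)) ∧
  ∃ Φ : ℕ → Plane → Plane, (∀ k, ContDiff ℝ ∞ (Φ k)) ∧
    (∀ j, Tendsto (fun k => h1NormSq D (fun x => Φ k x j - w x j)) atTop (𝓝 0)) ∧
    Tendsto (fun k => ∫ s in Set.Icc (0 : ℝ) 1, ‖Φ k (a + s • (b - a)) - g s‖ ^ 2) atTop (𝓝 0)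

/-- `m = ∫_e w · t ds` for the segment `e = [a, b]` with unit tangent `t = (b - a) / |b - a|`,
where the trace of `w` on `e` is taken from `D`. As `ds = |b - a| dσ`, this is
`∫₀¹ w(a + σ (b - a)) · (b - a) dσ`. -/
def IsTangentialIntegral (D : Set Plane) (a b : Plane) (w : Plane → Plane) (m : ℝ) : Prop :=
  ∃ g, IsTrace D a b w g ∧ m = ∫ σ in Set.Icc (0 : ℝ) 1, inner ℝ (g σ) (b - a)

/-! ### Simple polygons and their triangulations -/

/-- `P` is the closed polygonal region bounded by the simple closed polygon `p`.

The first two fields say that `p` is simple: the vertices are distinct, and two different edges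
meet at most in the vertex that they share. (Three consecutive vertices may be collinear.) By the
Jordan curve theorem the closed region enclosed by `p` is the only compact set
with non-empty interior whose boundary is the curve `p`. -/
structure IsSimplePolygon {n : ℕ} (p : Polygon Plane (n + 3)) (P : Set Plane) : Prop where
  injective : Function.Injective p.vertices
  edge_inter : ∀ i j, i ≠ j → ∀ x ∈ p.edgeSet ℝ i ∩ p.edgeSet ℝ j,
    (j = i + 1 ∧ x = p j) ∨ (i = j + 1 ∧ x = p i)
  isCompact : IsCompact P
  interior_nonempty : (interior P).Nonempty
  frontier_eq : frontier P = p.boundary ℝ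

/-- The closed simplex spanned by the vertices of `p` with index in `t`. -/
def cell {n : ℕ} (p : Polygon Plane (n + 3)) (t : Finset (Fin (n + 3))) : Set Plane :=
  convexHull ℝ (p.vertices '' (t : Set (Fin (n + 3))))

/-- `T` is a (conforming) triangulation of the polygon `P` whose vertices are exactly the
vertices of `p`, so that there are no additional vertices. A triangle is given by the
indices of its three vertices. -/
structure IsTriangulation {n : ℕ} (p : Polygon Plane (n + 3)) (P : Set Plane)
    (T : Finset (Finset (Fin (n + 3)))) : Prop where
  card_eq : ∀ t ∈ T, t.card = 3
  nondegenerate : ∀ t ∈ T, AffineIndependent ℝ (fun i : t => p i)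
  iUnion_eq : ⋃ t ∈ T, cell p t = P
  inter_eq : ∀ s ∈ T, ∀ t ∈ T, cell p s ∩ cell p t = cell p (s ∩ t)
  vertex_mem : ∀ i, ∀ t ∈ T, p i ∈ cell p t → i ∈ t

/-- Maximum angle condition: all angles of the triangles of `T` are at most `θ`. -/
def MaxAngleCondition {n : ℕ} (p : Polygon Plane (n + 3)) (T : Finset (Finset (Fin (n + 3))))
    (θ : ℝ) : Prop :=
  ∀ t ∈ T, ∀ i ∈ t, ∀ j ∈ t, ∀ k ∈ t, i ≠ j → j ≠ k → i ≠ k →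
    EuclideanGeometry.angle (p i) (p j) (p k) ≤ θ

/-- No short interior edges: every edge of the triangulation that is not an edge of the polygon
has length at least `lam` times the diameter of `P`. -/
def NoShortInteriorEdge {n : ℕ} (p : Polygon Plane (n + 3)) (P : Set Plane)
    (T : Finset (Finset (Fin (n + 3)))) (lam : ℝ) : Prop :=
  ∀ t ∈ T, ∀ i ∈ t, ∀ j ∈ t, i ≠ j → j ≠ i + 1 → i ≠ j + 1 →
    lam * Metric.diam P ≤ dist (p i) (p j)

/-! ### The virtual element space and the edge interpolation -/

/-- `v ∈ V_h(P)`: `v ∈ H(curl; P)`, on each triangle of `T` the field `v` has the form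
`a + b (x₂, -x₁)` (lowest order Nédélec element), and `curl v` is constant on `P`. -/
def MemVh {n : ℕ} (p : Polygon Plane (n + 3)) (P : Set Plane) (T : Finset (Finset (Fin (n + 3))))
    (v : Plane → Plane) : Prop :=
  MemHCurl (interior P) v ∧
  (∀ t ∈ T, ∃ a : Plane, ∃ b : ℝ, ∀ᵐ x ∂(volume.restrict (cell p t)),
    v x = a + b • !₂[x 1, -x 0]) ∧
  ∃ κ : ℝ, IsWeakCurl (interior P) v (fun _ => κ)

/-- `v = I_P u`, the edge interpolation of `u` in `V_h(P)`: on every edge `e ⊂ ∂P` the integrals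
`∫_e v · t ds` and `∫_e u · t ds` agree. The traces on `e` are taken from the triangle of `T`
that has `e` as an edge, on which `v` is a polynomial. -/
def IsEdgeInterpolation {n : ℕ} (p : Polygon Plane (n + 3)) (P : Set Plane)
    (T : Finset (Finset (Fin (n + 3)))) (u v : Plane → Plane) : Prop :=
  MemVh p P T v ∧
  ∀ i, ∀ t ∈ T, i ∈ t → i + 1 ∈ t →
    ∃ m, IsTangentialIntegral (interior (cell p t)) (p i) (p (i + 1)) u m ∧
      IsTangentialIntegral (interior (cell p t)) (p i) (p (i + 1)) v m

end

end EdgeVEM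

open EdgeVEM

/-! Write D for the interior of Conv(P), h for the diameter of P, c for curl u and κ for the mean of
c over P. A field a + b (x₂, -x₁) on a triangle has curl -2b and is determined by its circulations
along the three edges. An element of V_h(P) is therefore the same as a cochain: an antisymmetric
function X on the oriented edges whose circulation around every positively oriented triangle t is κ'
|t| with one constant κ'. Tangential continuity says that X does not depend on the triangle from
which an edge is seen; constancy of the curl says that κ' does not depend on t. By Green's formula
the interpolant must have κ' = κ.

Existence. All vertices lie on the boundary. After subtraction of a rotation field with curl κ, the
boundary data sum to zero around the polygon (`sum_circulation`), so they are the differences of a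
function on the vertices (`exists_potential`). Its differences along all edges have no circulation
and belong to a piecewise constant field (`exists_nedDof_eq`); adding the rotation back gives the
interpolant (`exists_interpolant`).

Uniqueness rests on `cochain_eq_zero`: a cochain with zero boundary values and zero circulations
vanishes. The piecewise constant field that it defines, extended by zero, is curl free in the whole
plane. After mollification its line integrals are path independent, so they may be taken along the
boundary polygon, where they tend to zero; along an edge of the triangulation they tend to X. That a
member of V_h(P) has matching tangential components is read off from its weak curl with test
functions concentrated near the midpoint of one edge (`nedDof_eq_of_isWeakCurl`).

Stability. Let U be the tangential integrals of u on all edges of the triangulation and X those of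
the interpolant. The difference d = X - U vanishes on the boundary, and its circulation around t is
the integral of κ - c over t. An interior edge cuts the triangulation in two, and d on that edge is,
up to sign, the sum of the circulations on one side (`abs_le_sum_circulation`). Hence |d| is at most
the integral of |c - κ| over P. Since interior edges are long and |P| ≤ 4h², this gives |d| ≤ (2/λ)
|e| ‖c‖ on an edge e, which is the bound needed for vectors of length |e|.

Error. In the direction of an edge e of t the error consists of u·e - U, of d, and of the rotational
part of the interpolant. The first is bounded by a Poincaré and a trace inequality whose constants
do not see the shape of the triangle (`integral_sub_edge_mean_sq_le`). Every triangle has an angle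
in [π/3, θ], and the errors along the two edges at that vertex control the whole vector
(`exists_good_vertex`, `sq_mul_integral_norm_sq_le`). The curl error c - κ is bounded by the
Poincaré inequality on the convex set D (`exists_integral_sub_sq_le`). Green's formula, traces and
both inequalities are proved for smooth fields and carried over by the density of smooth functions
in H¹ of a convex open set (`exists_contDiff_tendsto`). -/

namespace EdgeVEM

/-! ### Test functions and weak derivatives -/

lemma pderiv_continuous {φ : Plane → ℝ} (h : ContDiff ℝ 1 φ) (i : Fin 2) :
    Continuous (pderiv i φ) :=
  (h.continuous_fderiv one_ne_zero).clm_apply continuous_const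

lemma tsupport_pderiv_subset (φ : Plane → ℝ) (i : Fin 2) : tsupport (pderiv i φ) ⊆ tsupport φ :=
  tsupport_fderiv_apply_subset ℝ _

lemma IsTestFunction.contDiff_one {D : Set Plane} {φ : Plane → ℝ} (h : IsTestFunction D φ) :
    ContDiff ℝ 1 φ := h.1.of_le (by exact_mod_cast le_top)

lemma IsTestFunction.mono {D D' : Set Plane} (hD : D' ⊆ D) {φ : Plane → ℝ}
    (h : IsTestFunction D' φ) : IsTestFunction D φ := ⟨h.1, h.2.1, h.2.2.trans hD⟩

lemma IsTestFunction.hasCompactSupport_pderiv {D : Set Plane} {φ : Plane → ℝ}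
    (h : IsTestFunction D φ) (i : Fin 2) : HasCompactSupport (pderiv i φ) :=
  h.2.1.mono' (subset_closure.trans (tsupport_pderiv_subset φ i))

lemma setIntegral_mul_eq_integral {D : Set Plane} {f ψ : Plane → ℝ} (h : tsupport ψ ⊆ D) :
    ∫ x in D, f x * ψ x = ∫ x, f x * ψ x := by
  apply setIntegral_eq_integral_of_forall_compl_eq_zero
  intro x hx
  rw [image_eq_zero_of_notMem_tsupport fun h' => hx (h h'), mul_zero]

lemma integrable_mul_of_tsupport_subset {D : Set Plane} {f ψ : Plane → ℝ}
    (hf : LocallyIntegrableOn f D) (hψ : Continuous ψ) (hc : HasCompactSupport ψ)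
    (h : tsupport ψ ⊆ D) : Integrable (fun x => f x * ψ x) := by
  have h1 : IntegrableOn (fun x => f x * ψ x) (tsupport ψ) :=
    (hf.integrableOn_compact_subset h hc.isCompact).mul_continuousOn hψ.continuousOn hc.isCompact
  refine (integrableOn_iff_integrable_of_support_subset ?_).1 h1
  exact (Function.support_mul_subset_right _ _).trans (subset_tsupport ψ)

lemma IsTestFunction.integrable_mul {D : Set Plane} {f φ : Plane → ℝ}
    (hf : LocallyIntegrableOn f D) (h : IsTestFunction D φ) :
    Integrable (fun x => f x * φ x) :=
  integrable_mul_of_tsupport_subset hf h.1.continuous h.2.1 h.2.2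

lemma IsTestFunction.integrable_mul_pderiv {D : Set Plane} {f φ : Plane → ℝ}
    (hf : LocallyIntegrableOn f D) (h : IsTestFunction D φ) (i : Fin 2) :
    Integrable (fun x => f x * pderiv i φ x) :=
  integrable_mul_of_tsupport_subset hf (pderiv_continuous h.contDiff_one i)
    (h.hasCompactSupport_pderiv i) ((tsupport_pderiv_subset φ i).trans h.2.2)

/-- The fundamental lemma of the calculus of variations. It makes weak derivatives and curls unique,
so that the chosen representatives `weakPartial` and `weakCurl` may be exchanged for explicit ones.
-/
lemma ae_eq_of_forall_test {D : Set Plane} (hD : IsOpen D) {f g : Plane → ℝ}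
    (hf : LocallyIntegrableOn f D) (hg : LocallyIntegrableOn g D)
    (h : ∀ φ, IsTestFunction D φ → ∫ x in D, f x * φ x = ∫ x in D, g x * φ x) :
    f =ᵐ[volume.restrict D] g := by
  have := hD.ae_eq_zero_of_integral_contDiff_smul_eq_zero (μ := volume) (hf.sub hg) ?_
  · rw [EventuallyEq, ae_restrict_iff' hD.measurableSet]
    filter_upwards [this] with x hx hxD
    have := hx hxD
    simp only [Pi.sub_apply] at this
    linarith
  · intro φ h1 h2 h3
    have ht : IsTestFunction D φ := ⟨h1, h2, h3⟩
    have := h φ ht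
    rw [setIntegral_mul_eq_integral h3, setIntegral_mul_eq_integral h3] at this
    simp only [Pi.sub_apply, smul_eq_mul, mul_comm (φ _), sub_mul]
    rw [integral_sub (ht.integrable_mul hf) (ht.integrable_mul hg), this, sub_self]

lemma IsWeakPartial.ae_eq {D : Set Plane} (hD : IsOpen D) {i : Fin 2} {f f' g g' : Plane → ℝ}
    (hf : f =ᵐ[volume.restrict D] f')
    (h : IsWeakPartial D i f g) (h' : IsWeakPartial D i f' g') :
    g =ᵐ[volume.restrict D] g' := by
  refine ae_eq_of_forall_test hD h.2.1 h'.2.1 fun φ hφ => ?_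
  rw [← neg_eq_iff_eq_neg.2 (h.2.2 φ hφ), ← neg_eq_iff_eq_neg.2 (h'.2.2 φ hφ)]
  congr 1
  refine integral_congr_ae ?_
  filter_upwards [hf] with x hx
  rw [hx]

lemma locallyIntegrableOn_congr {D : Set Plane} {E : Type*}
    [NormedAddCommGroup E] {f f' : Plane → E}
    (hf : f =ᵐ[volume.restrict D] f') (h : LocallyIntegrableOn f D) :
    LocallyIntegrableOn f' D := by
  intro x hx
  obtain ⟨s, hs, hi⟩ := h x hx
  refine ⟨s ∩ D, inter_mem hs self_mem_nhdsWithin, ?_⟩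
  refine (hi.mono_set Set.inter_subset_left).congr_fun_ae ?_
  exact ae_restrict_of_ae_restrict_of_subset Set.inter_subset_right hf

lemma IsWeakPartial.congr {D : Set Plane} {i : Fin 2} {f f' g g' : Plane → ℝ}
    (hf : f =ᵐ[volume.restrict D] f') (hg : g =ᵐ[volume.restrict D] g')
    (h : IsWeakPartial D i f g) : IsWeakPartial D i f' g' := by
  refine ⟨locallyIntegrableOn_congr hf h.1, locallyIntegrableOn_congr hg h.2.1,
    fun φ hφ => ?_⟩
  have := h.2.2 φ hφ
  rw [integral_congr_ae (g := fun x => f' x * pderiv i φ x)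
    (by filter_upwards [hf] with x hx; rw [hx]),
    integral_congr_ae (f := fun x => g x * φ x) (g := fun x => g' x * φ x)
    (by filter_upwards [hg] with x hx; rw [hx])] at this
  exact this

lemma IsWeakPartial.mono {D D' : Set Plane} (hD : D' ⊆ D) {i : Fin 2} {f g : Plane → ℝ}
    (h : IsWeakPartial D i f g) : IsWeakPartial D' i f g := by
  refine ⟨h.1.mono_set hD, h.2.1.mono_set hD, fun φ hφ => ?_⟩
  have := h.2.2 φ (hφ.mono hD)
  have h1 := (tsupport_pderiv_subset φ i).trans hφ.2.2
  rwa [setIntegral_mul_eq_integral (h1.trans hD), setIntegral_mul_eq_integral (hφ.2.2.trans hD),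
    ← setIntegral_mul_eq_integral h1, ← setIntegral_mul_eq_integral hφ.2.2] at this

lemma IsWeakPartial.sub {D : Set Plane} {i : Fin 2} {f f' g g' : Plane → ℝ}
    (h : IsWeakPartial D i f g) (h' : IsWeakPartial D i f' g') :
    IsWeakPartial D i (fun x => f x - f' x) (fun x => g x - g' x) := by
  refine ⟨h.1.sub h'.1, h.2.1.sub h'.2.1, fun φ hφ => ?_⟩
  simp only [sub_mul]
  rw [integral_sub (hφ.integrable_mul_pderiv h.1 i).integrableOn
      (hφ.integrable_mul_pderiv h'.1 i).integrableOn,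
    integral_sub (hφ.integrable_mul h.2.1).integrableOn (hφ.integrable_mul h'.2.1).integrableOn,
    h.2.2 φ hφ, h'.2.2 φ hφ]
  ring

lemma isWeakPartial_of_contDiff {D : Set Plane} {i : Fin 2} {f : Plane → ℝ}
    (hf : ContDiff ℝ 1 f) : IsWeakPartial D i f (pderiv i f) := by
  have hl : LocallyIntegrableOn f D := (hf.continuous.locallyIntegrable).locallyIntegrableOn _
  have hl' : LocallyIntegrableOn (pderiv i f) D :=
    ((pderiv_continuous hf i).locallyIntegrable).locallyIntegrableOn _
  refine ⟨hl, hl', fun φ hφ => ?_⟩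
  have h1 := (tsupport_pderiv_subset φ i).trans hφ.2.2
  rw [setIntegral_mul_eq_integral h1, setIntegral_mul_eq_integral hφ.2.2]
  refine integral_mul_fderiv_eq_neg_fderiv_mul_of_integrable ?_ ?_ ?_ ?_ ?_
  · exact hφ.integrable_mul hl'
  · exact hφ.integrable_mul_pderiv hl i
  · exact hφ.integrable_mul hl
  · exact fun x _ => (hf.differentiable one_ne_zero).differentiableAt
  · exact fun x _ => (hφ.contDiff_one.differentiable one_ne_zero).differentiableAt

lemma weakPartial_spec {D : Set Plane} {i : Fin 2} {f g : Plane → ℝ}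
    (h : IsWeakPartial D i f g) : IsWeakPartial D i f (weakPartial D i f) := by
  have : ∃ g, IsWeakPartial D i f g := ⟨g, h⟩
  rw [weakPartial, dif_pos this]
  exact this.choose_spec

lemma weakPartial_ae_eq {D : Set Plane} (hD : IsOpen D) {i : Fin 2} {f g : Plane → ℝ}
    (h : IsWeakPartial D i f g) : weakPartial D i f =ᵐ[volume.restrict D] g :=
  (weakPartial_spec h).ae_eq hD EventuallyEq.rfl h

/-- The data of a function of `H¹(D)` together with its weak gradient. -/
structure HasH1 (D : Set Plane) (f : Plane → ℝ) (g : Fin 2 → Plane → ℝ) : Prop where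
  memLp : MemLp f 2 (volume.restrict D)
  partial_memLp : ∀ i, MemLp (g i) 2 (volume.restrict D)
  isWeakPartial : ∀ i, IsWeakPartial D i f (g i)

lemma HasH1.memH1 {D : Set Plane} {f : Plane → ℝ} {g : Fin 2 → Plane → ℝ} (h : HasH1 D f g) :
    MemH1 D f := ⟨h.memLp, fun i => ⟨g i, h.isWeakPartial i, h.partial_memLp i⟩⟩

lemma MemH1.hasH1 {D : Set Plane} (hD : IsOpen D) {f : Plane → ℝ} (h : MemH1 D f) :
    HasH1 D f (fun i => weakPartial D i f) := by
  refine ⟨h.1, fun i => ?_, fun i => ?_⟩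
  · obtain ⟨g, hg, hg2⟩ := h.2 i
    exact hg2.ae_eq (weakPartial_ae_eq hD hg).symm
  · obtain ⟨g, hg, hg2⟩ := h.2 i
    exact weakPartial_spec hg

lemma HasH1.h1NormSq_eq {D : Set Plane} (hD : IsOpen D) {f : Plane → ℝ} {g : Fin 2 → Plane → ℝ}
    (h : HasH1 D f g) :
    h1NormSq D f = (∫ x in D, f x ^ 2) + ((∫ x in D, g 0 x ^ 2) + ∫ x in D, g 1 x ^ 2) := by
  have h1 : h1NormSq D f = ∫ x in D, (f x ^ 2 + (g 0 x ^ 2 + g 1 x ^ 2)) := by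
    refine integral_congr_ae ?_
    filter_upwards [weakPartial_ae_eq hD (h.isWeakPartial 0),
      weakPartial_ae_eq hD (h.isWeakPartial 1)] with x h0 h1
    rw [Fin.sum_univ_two, h0, h1]
  rw [h1, integral_add h.memLp.integrable_sq, integral_add (h.partial_memLp 0).integrable_sq
    (h.partial_memLp 1).integrable_sq]
  exact (h.partial_memLp 0).integrable_sq.add (h.partial_memLp 1).integrable_sq

lemma HasH1.mono {D D' : Set Plane} (hD : D' ⊆ D) {f : Plane → ℝ} {g : Fin 2 → Plane → ℝ}
    (h : HasH1 D f g) : HasH1 D' f g :=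
  ⟨h.memLp.mono_measure (Measure.restrict_mono hD le_rfl),
    fun i => (h.partial_memLp i).mono_measure (Measure.restrict_mono hD le_rfl),
    fun i => (h.isWeakPartial i).mono hD⟩

lemma HasH1.sub {D : Set Plane} {f f' : Plane → ℝ} {g g' : Fin 2 → Plane → ℝ}
    (h : HasH1 D f g) (h' : HasH1 D f' g') :
    HasH1 D (fun x => f x - f' x) (fun i x => g i x - g' i x) :=
  ⟨h.memLp.sub h'.memLp, fun i => (h.partial_memLp i).sub (h'.partial_memLp i),
    fun i => (h.isWeakPartial i).sub (h'.isWeakPartial i)⟩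

lemma HasH1.congr {D : Set Plane} {f f' : Plane → ℝ} {g g' : Fin 2 → Plane → ℝ}
    (hf : f =ᵐ[volume.restrict D] f') (hg : ∀ i, g i =ᵐ[volume.restrict D] g' i)
    (h : HasH1 D f g) : HasH1 D f' g' :=
  ⟨h.memLp.ae_eq hf, fun i => (h.partial_memLp i).ae_eq (hg i),
    fun i => (h.isWeakPartial i).congr hf (hg i)⟩

lemma memLp_two_of_continuous {D : Set Plane} (hb : Bornology.IsBounded D) {E : Type*}
    [NormedAddCommGroup E] {f : Plane → E}
    (hf : Continuous f) : MemLp f 2 (volume.restrict D) := by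
  have : MemLp f 2 (volume.restrict (closure D)) := by
    obtain ⟨C, hC⟩ := hb.isCompact_closure.exists_bound_of_continuousOn hf.continuousOn
    have : Fact (volume (closure D) < ⊤) := ⟨hb.isCompact_closure.measure_lt_top⟩
    refine MemLp.of_bound hf.aestronglyMeasurable C ?_
    exact (ae_restrict_iff' isClosed_closure.measurableSet).2 (Eventually.of_forall hC)
  exact this.mono_measure (Measure.restrict_mono subset_closure le_rfl)

lemma hasH1_of_contDiff {D : Set Plane} (hb : Bornology.IsBounded D) {f : Plane → ℝ}
    (hf : ContDiff ℝ 1 f) : HasH1 D f (fun i => pderiv i f) :=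
  ⟨memLp_two_of_continuous hb hf.continuous,
    fun i => memLp_two_of_continuous hb (pderiv_continuous hf i),
    fun _ => isWeakPartial_of_contDiff hf⟩

/-! ### The weak curl -/

lemma IsWeakCurl.ae_eq {D : Set Plane} (hD : IsOpen D) {u u' : Plane → Plane} {c c' : Plane → ℝ}
    (hu : u =ᵐ[volume.restrict D] u') (h : IsWeakCurl D u c) (h' : IsWeakCurl D u' c') :
    c =ᵐ[volume.restrict D] c' := by
  refine ae_eq_of_forall_test hD h.2.1 h'.2.1 fun φ hφ => ?_
  rw [h.2.2 φ hφ, h'.2.2 φ hφ]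
  refine integral_congr_ae ?_
  filter_upwards [hu] with x hx
  rw [hx]

lemma weakCurl_spec {D : Set Plane} {u : Plane → Plane} {c : Plane → ℝ}
    (h : IsWeakCurl D u c) : IsWeakCurl D u (weakCurl D u) := by
  have : ∃ c, IsWeakCurl D u c := ⟨c, h⟩
  rw [weakCurl, dif_pos this]
  exact this.choose_spec

lemma weakCurl_ae_eq {D : Set Plane} (hD : IsOpen D) {u : Plane → Plane} {c : Plane → ℝ}
    (h : IsWeakCurl D u c) : weakCurl D u =ᵐ[volume.restrict D] c :=
  (weakCurl_spec h).ae_eq hD EventuallyEq.rfl h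

lemma locallyIntegrableOn_coord {D : Set Plane} {u : Plane → Plane} (h : LocallyIntegrableOn u D)
    (j : Fin 2) : LocallyIntegrableOn (fun x => u x j) D := by
  intro x hx
  obtain ⟨s, hs, hi⟩ := h x hx
  exact ⟨s, hs, (EuclideanSpace.proj (𝕜 := ℝ) j).integrable_comp hi⟩

lemma memLp_plane {D : Set Plane} {u : Plane → Plane}
    (h : ∀ j, MemLp (fun x => u x j) 2 (volume.restrict D)) : MemLp u 2 (volume.restrict D) := by
  have h0 := (h 0).norm.add (h 1).norm
  refine h0.mono ?_ ?_
  · have : AEStronglyMeasurable (fun x => ((u x).ofLp : Fin 2 → ℝ)) (volume.restrict D) :=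
      (aemeasurable_pi_iff.2 fun j => (h j).1.aemeasurable).aestronglyMeasurable
    exact (PiLp.continuous_toLp 2 (fun _ : Fin 2 => ℝ)).comp_aestronglyMeasurable this
  · refine Eventually.of_forall fun x => ?_
    simp only [Pi.add_apply]
    rw [EuclideanSpace.norm_eq, Fin.sum_univ_two, Real.norm_of_nonneg
      (by positivity : 0 ≤ ‖u x 0‖ + ‖u x 1‖)]
    refine Real.sqrt_le_iff.2 ⟨by positivity, ?_⟩
    nlinarith [norm_nonneg (u x 0), norm_nonneg (u x 1)]

lemma isWeakCurl_of_isWeakPartial {D : Set Plane} {u : Plane → Plane} {g0 g1 : Plane → ℝ}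
    (hu : LocallyIntegrableOn u D)
    (h0 : IsWeakPartial D 1 (fun x => u x 0) g0) (h1 : IsWeakPartial D 0 (fun x => u x 1) g1) :
    IsWeakCurl D u (fun x => g1 x - g0 x) := by
  refine ⟨hu, h1.2.1.sub h0.2.1, fun φ hφ => ?_⟩
  simp only [sub_mul]
  rw [integral_sub (hφ.integrable_mul h1.2.1).integrableOn
    (hφ.integrable_mul h0.2.1).integrableOn,
    integral_sub (hφ.integrable_mul_pderiv h0.1 1).integrableOn
    (hφ.integrable_mul_pderiv h1.1 0).integrableOn, h0.2.2 φ hφ, h1.2.2 φ hφ]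
  ring

lemma IsWeakCurl.sub {D : Set Plane} {u u' : Plane → Plane} {c c' : Plane → ℝ}
    (h : IsWeakCurl D u c) (h' : IsWeakCurl D u' c') :
    IsWeakCurl D (fun x => u x - u' x) (fun x => c x - c' x) := by
  refine ⟨h.1.sub h'.1, h.2.1.sub h'.2.1, fun φ hφ => ?_⟩
  have hu := fun j => locallyIntegrableOn_coord h.1 j
  have hu' := fun j => locallyIntegrableOn_coord h'.1 j
  have e : ∀ x, (u x - u' x) 0 * pderiv 1 φ x - (u x - u' x) 1 * pderiv 0 φ x
      = (u x 0 * pderiv 1 φ x - u x 1 * pderiv 0 φ x)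
        - (u' x 0 * pderiv 1 φ x - u' x 1 * pderiv 0 φ x) := fun x => by
    simp only [PiLp.sub_apply]; ring
  simp only [sub_mul, e]
  rw [integral_sub (hφ.integrable_mul h.2.1).integrableOn
      (hφ.integrable_mul h'.2.1).integrableOn, integral_sub, h.2.2 φ hφ, h'.2.2 φ hφ]
  · exact ((hφ.integrable_mul_pderiv (hu 0) 1).sub
      (hφ.integrable_mul_pderiv (hu 1) 0)).integrableOn
  · exact ((hφ.integrable_mul_pderiv (hu' 0) 1).sub
      (hφ.integrable_mul_pderiv (hu' 1) 0)).integrableOn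

lemma IsWeakCurl.mono {D D' : Set Plane} (hD : D' ⊆ D) {u : Plane → Plane} {c : Plane → ℝ}
    (h : IsWeakCurl D u c) : IsWeakCurl D' u c := by
  refine ⟨h.1.mono_set hD, h.2.1.mono_set hD, fun φ hφ => ?_⟩
  have := h.2.2 φ (hφ.mono hD)
  rw [setIntegral_mul_eq_integral (hφ.2.2.trans hD)] at this
  rw [setIntegral_mul_eq_integral hφ.2.2, this]
  have hz : ∀ x, x ∉ D' → u x 0 * pderiv 1 φ x - u x 1 * pderiv 0 φ x = 0 := fun x hx => by
    have := fun i => image_eq_zero_of_notMem_tsupport (f := pderiv i φ)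
      fun h' => hx (hφ.2.2 (tsupport_pderiv_subset φ i h'))
    simp [this]
  rw [setIntegral_eq_integral_of_forall_compl_eq_zero hz,
    setIntegral_eq_integral_of_forall_compl_eq_zero fun x hx => hz x fun h' => hx (hD h')]

/-! ### Continuity of affine substitutions in `L²` -/

lemma finrank_plane : Module.finrank ℝ Plane = 2 := by simp

lemma map_affine_volume {t : ℝ} (ht : t ≠ 0) (z : Plane) :
    Measure.map (fun x : Plane => t • x + z) volume
      = ENNReal.ofReal ((t ^ 2)⁻¹) • (volume : Measure Plane) := by
  have h1 : (fun x : Plane => t • x + z) = (fun x => x + z) ∘ (fun x => t • x) := rfl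
  rw [h1, ← Measure.map_map (by fun_prop) (by fun_prop), Measure.map_addHaar_smul _ ht,
    Measure.map_smul, map_add_right_eq_self, finrank_plane, abs_of_nonneg (by positivity)]

lemma integral_comp_affine {E : Type*} [NormedAddCommGroup E] [NormedSpace ℝ E] {t : ℝ}
    (z : Plane) (f : Plane → E) :
    ∫ x : Plane, f (t • x + z) = (t ^ 2)⁻¹ • ∫ x, f x := by
  have := Measure.integral_comp_smul (volume : Measure Plane) (fun x => f (x + z)) t
  rw [this, integral_add_right_eq_self (μ := volume) f z, finrank_plane,
    abs_of_nonneg (by positivity)]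

lemma aestronglyMeasurable_comp_affine {F : Plane → ℝ} (hF : AEStronglyMeasurable F volume)
    {t : ℝ} (ht : t ≠ 0) (z : Plane) :
    AEStronglyMeasurable (fun x => F (t • x + z)) volume := by
  have hq : Measure.QuasiMeasurePreserving (fun x : Plane => t • x + z) volume volume := by
    refine ⟨by fun_prop, ?_⟩
    rw [map_affine_volume ht]
    exact Measure.smul_absolutelyContinuous
  exact hF.comp_quasiMeasurePreserving hq

/-- In the plane the substitution multiplies the L² norm by 1/t, which is at most 2. -/
lemma eLpNorm_comp_affine {F : Plane → ℝ} (hF : AEStronglyMeasurable F volume) {t : ℝ}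
    (ht : 1 / 2 ≤ t) (z : Plane) :
    eLpNorm (fun x => F (t • x + z)) 2 volume ≤ 2 * eLpNorm F 2 volume := by
  have ht0 : t ≠ 0 := by positivity
  have h1 : (fun x => F (t • x + z)) = F ∘ (fun x : Plane => t • x + z) := rfl
  rw [h1, ← eLpNorm_map_measure, map_affine_volume ht0,
    eLpNorm_smul_measure_of_ne_top (by simp)]
  · rw [smul_eq_mul]
    gcongr
    rw [ENNReal.toReal_div]
    calc ENNReal.ofReal ((t ^ 2)⁻¹) ^ (ENNReal.toReal 1 / ENNReal.toReal 2)
        ≤ ENNReal.ofReal (2 ^ 2) ^ (ENNReal.toReal 1 / ENNReal.toReal 2) := by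
          gcongr
          rw [← inv_pow]
          gcongr
          exact inv_le_of_inv_le₀ (by norm_num) (by linarith)
      _ = 2 := by
          rw [ENNReal.ofReal_rpow_of_nonneg (by norm_num) (by norm_num), ENNReal.toReal_one,
            ENNReal.toReal_ofNat, ← Real.sqrt_eq_rpow, Real.sqrt_sq (by norm_num)]
          norm_num
  · rw [map_affine_volume ht0]
    exact hF.smul_measure _
  · fun_prop

lemma exists_eLpNorm_comp_affine_sub_le_of_continuous {g : Plane → ℝ} (hg : Continuous g)
    (hc : HasCompactSupport g) {η : ENNReal} (hη : η ≠ 0) :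
    ∃ δ : ℝ, 0 < δ ∧ δ ≤ 1 / 2 ∧ ∀ t z, 1 - δ ≤ t → t ≤ 1 → ‖z‖ ≤ δ →
      eLpNorm (fun x => g (t • x + z) - g x) 2 volume ≤ η := by
  obtain ⟨R, hR0, hR⟩ : ∃ R : ℝ, 0 < R ∧ tsupport g ⊆ Metric.closedBall 0 R :=
    hc.isCompact.isBounded.subset_closedBall_lt 0 0
  set S := Metric.closedBall (0 : Plane) (2 * (R + 1)) with hS
  have hSfin : volume S ≠ ⊤ := (isCompact_closedBall _ _).measure_lt_top.ne
  obtain ⟨c, hc0, hcη⟩ : ∃ c : ℝ, 0 < c ∧ ENNReal.ofReal c * volume S ^ (1 / (2 : ENNReal).toReal)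
      ≤ η := by
    have hV : volume S ^ (1 / (2 : ENNReal).toReal) ≠ ⊤ :=
      ENNReal.rpow_ne_top_of_nonneg (by positivity) hSfin
    have : Tendsto (fun c : ℝ => ENNReal.ofReal c * volume S ^ (1 / (2 : ENNReal).toReal))
        (𝓝[>] 0) (𝓝 (ENNReal.ofReal 0 * volume S ^ (1 / (2 : ENNReal).toReal))) := by
      refine ENNReal.Tendsto.mul_const ?_ (Or.inr hV)
      exact (ENNReal.continuous_ofReal.tendsto 0).mono_left nhdsWithin_le_nhds
    rw [ENNReal.ofReal_zero, zero_mul] at this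
    have h2 := (this.eventually (gt_mem_nhds (pos_iff_ne_zero.2 hη))).and self_mem_nhdsWithin
    obtain ⟨c, h3, h4⟩ := h2.exists
    exact ⟨c, h4, h3.le⟩
  obtain ⟨d, hd0, hd⟩ := Metric.uniformContinuous_iff.1
    (hc.uniformContinuous_of_continuous hg) c hc0
  -- For ‖x‖ ≤ 2(R + 1) the displacement (t - 1)x + z has norm at most δ(2(R + 1) + 1) ≤ d/2.
  -- Outside this ball both functions vanish, because t ≥ 1/2 and ‖z‖ ≤ 1/2.
  refine ⟨min (1 / 2) (d / (2 * (2 * (R + 1) + 1))), by positivity, min_le_left _ _, ?_⟩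
  intro t z ht1 ht2 hz
  have hδ1 := min_le_left (1 / 2) (d / (2 * (2 * (R + 1) + 1)))
  have hδ2 := min_le_right (1 / 2) (d / (2 * (2 * (R + 1) + 1)))
  set δ := min (1 / 2) (d / (2 * (2 * (R + 1) + 1)))
  have hzero : ∀ x, x ∉ S → g x = 0 ∧ g (t • x + z) = 0 := by
    intro x hx
    rw [hS, mem_closedBall_zero_iff, not_le] at hx
    constructor
    · refine image_eq_zero_of_notMem_tsupport fun h' => ?_
      have := mem_closedBall_zero_iff.1 (hR h')
      linarith
    · refine image_eq_zero_of_notMem_tsupport fun h' => ?_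
      have h1 := mem_closedBall_zero_iff.1 (hR h')
      have h2 : ‖t • x‖ ≤ ‖t • x + z‖ + ‖z‖ := by
        simpa using norm_sub_le (t • x + z) z
      rw [norm_smul, Real.norm_of_nonneg (by linarith)] at h2
      nlinarith
  refine le_trans (eLpNorm_sub_le_of_dist_bdd (s := S) (c := c) volume (by simp)
    Metric.isClosed_closedBall.measurableSet hc0.le (f := fun x => g (t • x + z)) (g := g)
    ?_ ?_ ?_) hcη
  · intro x
    by_cases hx : x ∈ S
    · refine (hd ?_).le
      rw [hS, mem_closedBall_zero_iff] at hx
      rw [dist_eq_norm]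
      have e : t • x + z - x = (t - 1) • x + z := by rw [sub_smul, one_smul]; abel
      rw [e]
      refine (norm_add_le _ _).trans_lt ?_
      rw [norm_smul, Real.norm_eq_abs, abs_of_nonpos (by linarith)]
      have h3 : δ * (2 * (2 * (R + 1) + 1)) ≤ d := by
        rwa [le_div_iff₀ (by positivity)] at hδ2
      nlinarith [norm_nonneg x, norm_nonneg z]
    · rw [(hzero x hx).1, (hzero x hx).2, dist_self]; exact hc0.le
  · intro x hx
    by_contra h
    exact hx (hzero x h).2
  · intro x hx
    by_contra h
    exact hx (hzero x h).1

/-- Approximation by a continuous compactly supported function within η/4: this error enters once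
undilated and once dilated, where it at most doubles, and the continuous function itself contributes
the last η/4. -/
lemma exists_eLpNorm_comp_affine_sub_le {F : Plane → ℝ} (hF : MemLp F 2 volume) {η : ENNReal}
    (hη : η ≠ 0) :
    ∃ δ : ℝ, 0 < δ ∧ δ ≤ 1 / 2 ∧ ∀ t z, 1 - δ ≤ t → t ≤ 1 → ‖z‖ ≤ δ →
      eLpNorm (fun x => F (t • x + z) - F x) 2 volume ≤ η := by
  have hη4 : η / 4 ≠ 0 := by simp [hη]
  obtain ⟨g, hgc, hFg, hg, hgL⟩ := hF.exists_hasCompactSupport_eLpNorm_sub_le (by simp) hη4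
  obtain ⟨δ, hδ0, hδ, h⟩ := exists_eLpNorm_comp_affine_sub_le_of_continuous hg hgc hη4
  refine ⟨δ, hδ0, hδ, fun t z h1 h2 h3 => ?_⟩
  have ht : 1 / 2 ≤ t := by linarith
  have e : (fun x => F (t • x + z) - F x) = (fun x => (F - g) (t • x + z))
      + ((fun x => g (t • x + z) - g x) - (F - g)) := by
    ext x; simp only [Pi.add_apply, Pi.sub_apply]; ring
  have m1 := aestronglyMeasurable_comp_affine (hF.1.sub hg.aestronglyMeasurable)
    (show t ≠ 0 by positivity) z
  have m2 : AEStronglyMeasurable (fun x => g (t • x + z) - g x) volume :=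
    Continuous.aestronglyMeasurable (by fun_prop)
  have m3 := hF.1.sub hg.aestronglyMeasurable
  rw [e]
  calc _ ≤ eLpNorm (fun x => (F - g) (t • x + z)) 2 volume
        + eLpNorm ((fun x => g (t • x + z) - g x) - (F - g)) 2 volume :=
        eLpNorm_add_le m1 (m2.sub m3) (by norm_num)
    _ ≤ 2 * (η / 4) + (η / 4 + η / 4) := by
        refine add_le_add ((eLpNorm_comp_affine m3 ht z).trans (by gcongr)) ?_
        exact (eLpNorm_sub_le m2 m3 (by norm_num)).trans (add_le_add (h t z h1 h2 h3) hFg)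
    _ = η := by
        rw [← two_mul, ← add_mul, ← mul_div_assoc]
        norm_num
        rw [mul_comm, ENNReal.mul_div_cancel_right (by norm_num) (by norm_num)]

/-! ### Averages against a probability density -/

/-- Jensen's inequality, from Hölder's inequality with ρ split as ρ^(1/2) ρ^(1/2). With a lower
integral on the right no integrability of `H` has to be assumed. -/
lemma lintegral_enorm_sq_integral_le {ρ : Plane → ℝ} (hρ0 : ∀ y, 0 ≤ ρ y) (hρ : Continuous ρ)
    (hρ1 : ∫ y, ρ y = 1) {H : Plane → ℝ} (hH : AEStronglyMeasurable H volume) :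
    ‖∫ y, ρ y * H y‖ₑ ^ 2 ≤ ∫⁻ y, ENNReal.ofReal (ρ y) * ‖H y‖ₑ ^ 2 := by
  have hρi : Integrable ρ := by
    by_contra h
    rw [integral_undef h] at hρ1
    norm_num at hρ1
  have hone : ∫⁻ y, ENNReal.ofReal (ρ y) = 1 := by
    rw [← ofReal_integral_eq_lintegral_ofReal hρi (Eventually.of_forall hρ0), hρ1,
      ENNReal.ofReal_one]
  have h1 : ‖∫ y, ρ y * H y‖ₑ ≤ ∫⁻ y, ((fun y => ENNReal.ofReal (ρ y) ^ (1 / 2 : ℝ))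
      * (fun y => ENNReal.ofReal (ρ y) ^ (1 / 2 : ℝ) * ‖H y‖ₑ)) y := by
    refine (enorm_integral_le_lintegral_enorm _).trans (lintegral_mono fun y => ?_)
    simp only [Pi.mul_apply]
    rw [← mul_assoc, ← ENNReal.rpow_add_of_nonneg _ _ (by norm_num) (by norm_num), enorm_mul,
      Real.enorm_of_nonneg (hρ0 y)]
    norm_num
  have h2 := ENNReal.lintegral_mul_le_Lp_mul_Lq (volume : Measure Plane)
    (Real.HolderConjugate.two_two) (f := fun y => ENNReal.ofReal (ρ y) ^ (1 / 2 : ℝ))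
    (g := fun y => ENNReal.ofReal (ρ y) ^ (1 / 2 : ℝ) * ‖H y‖ₑ)
    (by fun_prop) ((by fun_prop : AEMeasurable (fun y => ENNReal.ofReal (ρ y) ^ (1 / 2 : ℝ))
      volume).mul hH.enorm)
  have h3 := h1.trans h2
  have e1 : ∀ y, (ENNReal.ofReal (ρ y) ^ (1 / 2 : ℝ)) ^ (2 : ℝ) = ENNReal.ofReal (ρ y) := by
    intro y
    rw [← ENNReal.rpow_mul]; norm_num
  simp only [ENNReal.mul_rpow_of_nonneg _ _ (zero_le_two : (0 : ℝ) ≤ 2), e1, hone,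
    ENNReal.one_rpow, one_mul] at h3
  calc ‖∫ y, ρ y * H y‖ₑ ^ 2 ≤ ((∫⁻ y, ENNReal.ofReal (ρ y) * ‖H y‖ₑ ^ (2 : ℝ)) ^ (1 / 2 : ℝ)) ^ 2 :=
        pow_le_pow_left' h3 2
    _ = _ := by
        rw [← ENNReal.rpow_natCast, ← ENNReal.rpow_mul]
        norm_num

lemma eLpNorm_two_sq {α : Type*} [MeasurableSpace α] {μ : Measure α} (f : α → ℝ) :
    eLpNorm f 2 μ ^ 2 = ∫⁻ x, ‖f x‖ₑ ^ 2 ∂μ := by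
  rw [eLpNorm_eq_lintegral_rpow_enorm_toReal (by norm_num) (by norm_num), ← ENNReal.rpow_natCast,
    ← ENNReal.rpow_mul]
  norm_num

/-- Jensen for each x, then an exchange of the integrals. The bound is needed only for y with ρ y ≠
0, which is where the translations of a mollification are small. -/
lemma eLpNorm_average_le {ρ : Plane → ℝ} (hρ0 : ∀ y, 0 ≤ ρ y) (hρ : Continuous ρ)
    (hρ1 : ∫ y, ρ y = 1) {H : Plane → Plane → ℝ} (hH : Measurable (Function.uncurry H))
    {η : ENNReal} (hη : ∀ y, ρ y ≠ 0 → eLpNorm (fun x => H x y) 2 volume ≤ η) :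
    eLpNorm (fun x => ∫ y, ρ y * H x y) 2 volume ≤ η := by
  have hρi : Integrable ρ := by
    by_contra h
    rw [integral_undef h] at hρ1
    norm_num at hρ1
  have hone : ∫⁻ y, ENNReal.ofReal (ρ y) = 1 := by
    rw [← ofReal_integral_eq_lintegral_ofReal hρi (Eventually.of_forall hρ0), hρ1,
      ENNReal.ofReal_one]
  refine (ENNReal.pow_le_pow_left_iff (two_ne_zero)).1 ?_
  rw [eLpNorm_two_sq]
  have hm : Measurable (Function.uncurry fun x y => ENNReal.ofReal (ρ y) * ‖H x y‖ₑ ^ 2) := by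
    have h1 : Measurable fun z : Plane × Plane => ENNReal.ofReal (ρ z.2) :=
      (ENNReal.measurable_ofReal.comp hρ.measurable).comp measurable_snd
    have h2 : Measurable fun z : Plane × Plane => ‖H z.1 z.2‖ₑ ^ 2 := hH.enorm.pow_const 2
    exact h1.mul h2
  calc ∫⁻ x, ‖∫ y, ρ y * H x y‖ₑ ^ 2
      ≤ ∫⁻ x, ∫⁻ y, ENNReal.ofReal (ρ y) * ‖H x y‖ₑ ^ 2 :=
        lintegral_mono fun x => lintegral_enorm_sq_integral_le hρ0 hρ hρ1
          (hH.comp measurable_prodMk_left).aestronglyMeasurable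
    _ = ∫⁻ y, ∫⁻ x, ENNReal.ofReal (ρ y) * ‖H x y‖ₑ ^ 2 :=
        lintegral_lintegral_swap hm.aemeasurable
    _ ≤ ∫⁻ y, ENNReal.ofReal (ρ y) * η ^ 2 := by
        refine lintegral_mono fun y => ?_
        rw [lintegral_const_mul' _ _ ENNReal.ofReal_ne_top]
        by_cases hy : ρ y = 0
        · simp [hy]
        · gcongr
          rw [← eLpNorm_two_sq]
          exact pow_le_pow_left' (hη y hy) 2
    _ = η ^ 2 := by
        rw [lintegral_mul_const _ hρ.measurable.ennreal_ofReal, hone, one_mul]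

/-! ### Density of smooth functions in `H¹` of a convex domain -/

/-- The mollification of the dilated function `z ↦ F (t • z + w)` with the kernel `ρ`. -/
noncomputable def mollify (t : ℝ) (w : Plane) (ρ F : Plane → ℝ) : Plane → ℝ :=
  convolution (fun z => F (t • z + w)) ρ (ContinuousLinearMap.mul ℝ ℝ) volume

lemma mollify_apply (t : ℝ) (w : Plane) (ρ F : Plane → ℝ) (x : Plane) :
    mollify t w ρ F x = ∫ z, F (t • z + w) * ρ (x - z) := rfl

lemma mollify_apply' (t : ℝ) (w : Plane) (ρ F : Plane → ℝ) (x : Plane) :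
    mollify t w ρ F x = ∫ y, ρ y * F (t • (x - y) + w) := by
  rw [mollify_apply, ← integral_sub_left_eq_self _ volume x]
  simp only [sub_sub_cancel, mul_comm (ρ _)]

lemma locallyIntegrable_comp_affine {F : Plane → ℝ} (hF : MemLp F 2 volume)
    {t : ℝ} (ht : 1 / 2 ≤ t) (w : Plane) : LocallyIntegrable (fun z => F (t • z + w)) := by
  have h : MemLp (fun z => F (t • z + w)) 2 volume := by
    refine ⟨aestronglyMeasurable_comp_affine hF.1 (by positivity) w, ?_⟩
    exact (eLpNorm_comp_affine hF.1 ht w).trans_lt (ENNReal.mul_lt_top (by simp) hF.2)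
  exact h.locallyIntegrable (by norm_num)

lemma contDiff_mollify {F : Plane → ℝ} (hF : MemLp F 2 volume) {t : ℝ} (ht : 1 / 2 ≤ t)
    (w : Plane) {ρ : Plane → ℝ} (hρ : ContDiff ℝ ∞ ρ) (hc : HasCompactSupport ρ) :
    ContDiff ℝ ∞ (mollify t w ρ F) :=
  hc.contDiff_convolution_right _ (locallyIntegrable_comp_affine hF ht w) hρ

lemma pderiv_mollify {F : Plane → ℝ} (hF : MemLp F 2 volume) {t : ℝ} (ht : 1 / 2 ≤ t)
    (w : Plane) {ρ : Plane → ℝ} (hρ : ContDiff ℝ 1 ρ) (hc : HasCompactSupport ρ) (i : Fin 2)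
    (x : Plane) :
    pderiv i (mollify t w ρ F) x = ∫ z, F (t • z + w) * pderiv i ρ (x - z) := by
  have hl := locallyIntegrable_comp_affine hF ht w
  rw [pderiv, mollify, (hc.hasFDerivAt_convolution_right _ hl hρ x).fderiv,
    convolution_precompR_apply _ hl (hc.fderiv ℝ) (hρ.continuous_fderiv one_ne_zero)]
  rfl

lemma eLpNorm_mollify_sub_le {F : Plane → ℝ} (hF : MemLp F 2 volume) (hFm : Measurable F)
    {t : ℝ} (ht : 1 / 2 ≤ t) (w : Plane) {ρ : Plane → ℝ} (hρ : Continuous ρ)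
    (hc : HasCompactSupport ρ) (hρ0 : ∀ y, 0 ≤ ρ y) (hρ1 : ∫ y, ρ y = 1) {η : ENNReal}
    (hη : ∀ y, ρ y ≠ 0 → eLpNorm (fun x => F (t • x + (w - t • y)) - F x) 2 volume ≤ η) :
    eLpNorm (fun x => mollify t w ρ F x - F x) 2 volume ≤ η := by
  have hl := locallyIntegrable_comp_affine hF ht w
  have e : (fun x => mollify t w ρ F x - F x)
      = fun x => ∫ y, ρ y * (F (t • x + (w - t • y)) - F x) := by
    ext x
    have e1 : ∀ y, t • (x - y) + w = t • x + (w - t • y) := fun y => by rw [smul_sub]; abel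
    have hi : Integrable (fun y => ρ y * F (t • x + (w - t • y))) := by
      have h1 : Integrable (fun z => F (t • z + w) * ρ (x - z)) :=
        (hc.convolutionExists_right (ContinuousLinearMap.mul ℝ ℝ) hl hρ x)
      have h2 := h1.comp_sub_left x
      refine h2.congr (Eventually.of_forall fun y => ?_)
      simp only [sub_sub_cancel, e1]
      ring
    simp only [mul_sub]
    rw [integral_sub hi ((hρ.integrable_of_hasCompactSupport hc).mul_const _), integral_mul_const,
      hρ1, one_mul, mollify_apply']
    simp only [e1]
  rw [e]
  refine eLpNorm_average_le hρ0 hρ hρ1 ?_ hη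
  have h1 : Measurable fun z : Plane × Plane => F (t • z.1 + (w - t • z.2)) :=
    hFm.comp (by fun_prop)
  exact h1.sub (hFm.comp measurable_fst)

/-- The kernel, written in the undilated variable, is a test function on D: `hx` says exactly that
its support lies there. The factor t is the chain rule for the dilation. -/
lemma pderiv_mollify_eq {D : Set Plane} {f g : Plane → ℝ} {i : Fin 2}
    (h : IsWeakPartial D i f g) (hf : MemLp (D.indicator f) 2 volume) (hD : MeasurableSet D)
    {t : ℝ} (ht : 1 / 2 ≤ t) (w : Plane) {ρ : Plane → ℝ} (hρ : ContDiff ℝ ∞ ρ)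
    (hc : HasCompactSupport ρ) {x : Plane}
    (hx : ∀ y ∈ tsupport ρ, t • (x - y) + w ∈ D) :
    pderiv i (mollify t w ρ (D.indicator f)) x = t * mollify t w ρ (D.indicator g) x := by
  have ht0 : t ≠ 0 := by positivity
  have hρ1 : ContDiff ℝ 1 ρ := hρ.of_le (by exact_mod_cast le_top)
  set φ : Plane → ℝ := fun v => ρ (x - t⁻¹ • (v - w)) with hφ
  have harg : ∀ z, x - t⁻¹ • (t • z + w - w) = x - z := fun z => by
    rw [add_sub_cancel_right, inv_smul_smul₀ ht0]
  have hcont : Continuous fun v : Plane => x - t⁻¹ • (v - w) := by fun_prop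
  have htest : IsTestFunction D φ := by
    have hsub : tsupport φ ⊆ (fun v : Plane => x - t⁻¹ • (v - w)) ⁻¹' tsupport ρ :=
      tsupport_comp_subset_preimage ρ hcont
    have hpre : (fun v : Plane => x - t⁻¹ • (v - w)) ⁻¹' tsupport ρ
        ⊆ (fun y => t • (x - y) + w) '' tsupport ρ := fun v hv => by
      refine ⟨_, hv, ?_⟩
      simp only [sub_sub_cancel, smul_inv_smul₀ ht0, sub_add_cancel]
    refine ⟨hρ.comp (by fun_prop), ?_, ?_⟩
    · refine HasCompactSupport.of_support_subset_isCompact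
        (K := (fun y => t • (x - y) + w) '' tsupport ρ) ?_ ?_
      · exact hc.isCompact.image (by fun_prop)
      · exact (subset_tsupport _).trans (hsub.trans hpre)
    · refine hsub.trans (hpre.trans ?_)
      rintro _ ⟨y, hy, rfl⟩
      exact hx y hy
  have hder : ∀ z, pderiv i φ (t • z + w) = - t⁻¹ * pderiv i ρ (x - z) := fun z => by
    have h1 : HasFDerivAt (fun v : Plane => x - t⁻¹ • (v - w))
        (-(t⁻¹ • ContinuousLinearMap.id ℝ Plane)) (t • z + w) := by
      have := (((hasFDerivAt_id (𝕜 := ℝ) (t • z + w)).sub_const w).const_smul t⁻¹).const_sub x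
      simpa using! this
    have h2 : HasFDerivAt ρ (fderiv ℝ ρ (x - z)) (x - t⁻¹ • (t • z + w - w)) := by
      rw [harg]
      exact (hρ1.differentiable one_ne_zero (x - z)).hasFDerivAt
    have h3 := h2.comp (t • z + w) h1
    rw [pderiv, pderiv, hφ, show (fun v => ρ (x - t⁻¹ • (v - w)))
      = ρ ∘ (fun v : Plane => x - t⁻¹ • (v - w)) from rfl, h3.fderiv]
    simp
  have key := h.2.2 φ htest
  rw [← integral_indicator hD, ← integral_indicator hD] at key
  have i1 : ∀ (f ψ : Plane → ℝ), D.indicator (fun v => f v * ψ v)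
      = fun v => D.indicator f v * ψ v := fun f ψ => by
    ext v; by_cases hv : v ∈ D <;> simp [hv]
  rw [i1, i1] at key
  have a1 := integral_comp_affine (t := t) w (fun v => D.indicator f v * pderiv i φ v)
  have a2 := integral_comp_affine (t := t) w (fun v => D.indicator g v * φ v)
  rw [key] at a1
  simp only [hder] at a1
  rw [pderiv_mollify hf ht w hρ1 hc, mollify_apply]
  have e2 : ∀ z, φ (t • z + w) = ρ (x - z) := fun z => by simp only [hφ, harg]
  simp only [e2] at a2
  rw [a2]
  have e3 : ∫ z, D.indicator f (t • z + w) * pderiv i ρ (x - z)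
      = - t * ∫ z, D.indicator f (t • z + w) * (- t⁻¹ * pderiv i ρ (x - z)) := by
    rw [← integral_const_mul]
    congr 1; ext z
    field_simp
  rw [e3, a1]
  simp only [smul_eq_mul]
  ring

lemma exists_contDiff_eLpNorm_sub_le {D : Set Plane} (hD : IsOpen D) (hconv : Convex ℝ D)
    (hne : D.Nonempty) {f : Plane → ℝ} {g : Fin 2 → Plane → ℝ} (h : HasH1 D f g) {η : ENNReal}
    (hη : η ≠ 0) :
    ∃ Φ : Plane → ℝ, ContDiff ℝ ∞ Φ ∧ eLpNorm (Φ - f) 2 (volume.restrict D) ≤ η ∧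
      ∀ i, eLpNorm (pderiv i Φ - g i) 2 (volume.restrict D) ≤ η := by
  -- The exchange of integrals in `eLpNorm_average_le` needs joint measurability, so f and its
  -- gradient are replaced by measurable representatives.
  wlog hm : Measurable f ∧ ∀ i, Measurable (g i) generalizing f g
  · have hf := h.memLp.1.aemeasurable
    have hg := fun i => (h.partial_memLp i).1.aemeasurable
    obtain ⟨Φ, h1, h2, h3⟩ := this (h.congr hf.ae_eq_mk fun i => (hg i).ae_eq_mk)
      ⟨hf.measurable_mk, fun i => (hg i).measurable_mk⟩
    refine ⟨Φ, h1, ?_, fun i => ?_⟩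
    · rwa [eLpNorm_congr_ae (EventuallyEq.rfl.sub hf.ae_eq_mk)]
    · rw [eLpNorm_congr_ae (EventuallyEq.rfl.sub (hg i).ae_eq_mk)]
      exact h3 i
  obtain ⟨x₀, hx₀⟩ := hne
  obtain ⟨r, hr0, hr⟩ := Metric.isOpen_iff.1 hD x₀ hx₀
  have hFL : MemLp (D.indicator f) 2 volume := (memLp_indicator_iff_restrict hD.measurableSet).2 h.memLp
  have hGL : ∀ i, MemLp (D.indicator (g i)) 2 volume := fun i =>
    (memLp_indicator_iff_restrict hD.measurableSet).2 (h.partial_memLp i)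
  have hη2 : η / 2 ≠ 0 := by simp [hη]
  obtain ⟨δ, hδ0, hδ, hF⟩ := exists_eLpNorm_comp_affine_sub_le hFL hη2
  choose δ' hδ'0 hδ' hG using fun i => exists_eLpNorm_comp_affine_sub_le (hGL i) hη2
  -- the dilation factor
  obtain ⟨s, hs0, hs1, hs2, hs3⟩ : ∃ s : ℝ, 0 < s ∧ s * (‖x₀‖ + 1) ≤ δ ∧
      (∀ i, s * (‖x₀‖ + 1) ≤ δ' i) ∧
      ∀ i, ENNReal.ofReal s * eLpNorm (D.indicator (g i)) 2 volume ≤ η / 2 := by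
    have t1 : Tendsto (fun s : ℝ => s * (‖x₀‖ + 1)) (𝓝[>] 0) (𝓝 0) := by
      have : Tendsto (fun s : ℝ => s * (‖x₀‖ + 1)) (𝓝 0) (𝓝 (0 * (‖x₀‖ + 1))) :=
        (continuous_id.mul continuous_const).tendsto 0
      rw [zero_mul] at this
      exact this.mono_left nhdsWithin_le_nhds
    have t2 : ∀ i, Tendsto (fun s : ℝ => ENNReal.ofReal s * eLpNorm (D.indicator (g i)) 2 volume)
        (𝓝[>] 0) (𝓝 0) := fun i => by
      have : Tendsto (fun s : ℝ => ENNReal.ofReal s * eLpNorm (D.indicator (g i)) 2 volume)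
        (𝓝[>] 0) (𝓝 (ENNReal.ofReal 0 * eLpNorm (D.indicator (g i)) 2 volume)) :=
        ENNReal.Tendsto.mul_const ((ENNReal.continuous_ofReal.tendsto 0).mono_left
          nhdsWithin_le_nhds) (Or.inr (hGL i).2.ne)
      simpa using this
    have ev := (eventually_mem_nhdsWithin (a := (0 : ℝ)) (s := Set.Ioi 0)).and
      ((t1.eventually (gt_mem_nhds hδ0)).and
      ((eventually_all.2 fun i => t1.eventually (gt_mem_nhds (hδ'0 i))).and
      (eventually_all.2 fun i => (t2 i).eventually (gt_mem_nhds (pos_iff_ne_zero.2 hη2)))))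
    obtain ⟨s, a, b, c, d⟩ := ev.exists
    exact ⟨s, a, b.le, fun i => (c i).le, fun i => (d i).le⟩
  set t := 1 - s with ht
  have hsx : 0 ≤ s * ‖x₀‖ := by positivity
  have hs12 : s ≤ 1 / 2 := by nlinarith
  have ht12 : 1 / 2 ≤ t := by linarith
  set w := s • x₀ with hw
  -- The dilation towards x₀ leaves a margin proportional to s: t(x - y) + s x₀ = t x + s(x₀ - (t/s)
  -- y) is a convex combination of points of D, since ‖(t/s) y‖ ≤ ε/s ≤ r/2 < r.
  set ε := s * min 1 (r / 2) with hε
  have hε0 : 0 < ε := by positivity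
  have hε1 : ε ≤ s := mul_le_of_le_one_right hs0.le (min_le_left _ _)
  have hε2 : ε ≤ s * (r / 2) := mul_le_mul_of_nonneg_left (min_le_right _ _) hs0.le
  let b : ContDiffBump (0 : Plane) := ⟨ε / 2, ε, by positivity, by linarith⟩
  set ρ := b.normed volume with hρ
  have hρc : ContDiff ℝ ∞ ρ := b.contDiff_normed
  have hρs : HasCompactSupport ρ := b.hasCompactSupport_normed
  have hρt : ∀ y ∈ tsupport ρ, ‖y‖ ≤ ε := fun y hy => by
    rw [hρ, b.tsupport_normed_eq] at hy
    simpa using hy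
  have hρ0 : ∀ y, 0 ≤ ρ y := fun y => b.nonneg_normed y
  have hρ1 : ∫ y, ρ y = 1 := b.integral_normed
  have hz : ∀ y, ρ y ≠ 0 → ‖w - t • y‖ ≤ s * (‖x₀‖ + 1) := fun y hy => by
    have h1 := hρt y (subset_tsupport _ hy)
    refine (norm_sub_le _ _).trans ?_
    rw [hw, norm_smul, norm_smul, Real.norm_of_nonneg hs0.le, Real.norm_of_nonneg (by linarith)]
    nlinarith [norm_nonneg y]
  have hmol : ∀ {F : Plane → ℝ}, MemLp F 2 volume → Measurable F →
      (∀ y, ρ y ≠ 0 → eLpNorm (fun x => F (t • x + (w - t • y)) - F x) 2 volume ≤ η / 2) →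
      eLpNorm (fun x => mollify t w ρ F x - F x) 2 volume ≤ η / 2 := fun h1 h2 h3 =>
    eLpNorm_mollify_sub_le h1 h2 ht12 w hρc.continuous hρs hρ0 hρ1 h3
  have hFm : Measurable (D.indicator f) := hm.1.indicator hD.measurableSet
  have hGm : ∀ i, Measurable (D.indicator (g i)) := fun i => (hm.2 i).indicator hD.measurableSet
  have eF := hmol hFL hFm fun y hy => hF t _ (by nlinarith) (by linarith) ((hz y hy).trans hs1)
  have eG := fun i => hmol (hGL i) (hGm i) fun y hy =>
    hG i t _ (by nlinarith [hs2 i]) (by linarith) ((hz y hy).trans (hs2 i))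
  have hmem : ∀ x ∈ D, ∀ y ∈ tsupport ρ, t • (x - y) + w ∈ D := fun x hx y hy => by
    have h1 : x₀ - (t / s) • y ∈ D := hr <| by
      rw [Metric.mem_ball, dist_eq_norm, sub_sub_cancel_left, norm_neg, norm_smul,
        Real.norm_of_nonneg (by positivity), div_mul_eq_mul_div, div_lt_iff₀ hs0]
      nlinarith [hρt y hy, norm_nonneg y]
    have h2 := hconv hx h1 (by linarith : 0 ≤ t) hs0.le (by ring)
    convert h2 using 1
    rw [smul_sub, smul_sub, hw, smul_smul, mul_div_cancel₀ _ hs0.ne']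
    abel
  have hle : η / 2 ≤ η := ENNReal.half_le_self
  refine ⟨mollify t w ρ (D.indicator f), contDiff_mollify hFL ht12 w hρc hρs, ?_, fun i => ?_⟩
  · have e : (mollify t w ρ (D.indicator f) - f) =ᵐ[volume.restrict D]
        fun x => mollify t w ρ (D.indicator f) x - D.indicator f x :=
      (ae_restrict_iff' hD.measurableSet).2 (Eventually.of_forall fun x hx => by simp [hx])
    rw [eLpNorm_congr_ae e]
    exact (eLpNorm_mono_measure _ Measure.restrict_le_self).trans (eF.trans hle)
  -- The gradient of the mollified function is t times the mollified gradient, so the error is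
  -- t(mollified g - g) - s g; the last term was made small by the choice of s.
  · have e : (pderiv i (mollify t w ρ (D.indicator f)) - g i) =ᵐ[volume.restrict D]
        (t • fun x => mollify t w ρ (D.indicator (g i)) x - D.indicator (g i) x)
          - s • D.indicator (g i) :=
      (ae_restrict_iff' hD.measurableSet).2 (Eventually.of_forall fun x hx => by
        simp only [Pi.sub_apply, Pi.smul_apply, smul_eq_mul]
        rw [pderiv_mollify_eq (h.isWeakPartial i) hFL hD.measurableSet ht12 w hρc hρs (hmem x hx),
          Set.indicator_of_mem hx]
        ring)
    have hmm : AEStronglyMeasurable (fun x => mollify t w ρ (D.indicator (g i)) x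
        - D.indicator (g i) x) volume :=
      (contDiff_mollify (hGL i) ht12 w hρc hρs).continuous.aestronglyMeasurable.sub
        (hGm i).aestronglyMeasurable
    rw [eLpNorm_congr_ae e]
    refine (eLpNorm_mono_measure _ Measure.restrict_le_self).trans ?_
    refine (eLpNorm_sub_le (hmm.const_smul t) ((hGm i).aestronglyMeasurable.const_smul s)
      (by norm_num)).trans ?_
    rw [eLpNorm_const_smul, eLpNorm_const_smul, Real.enorm_of_nonneg (by linarith),
      Real.enorm_of_nonneg hs0.le]
    calc _ ≤ 1 * (η / 2) + η / 2 := by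
          refine add_le_add (mul_le_mul' ?_ (eG i)) (hs3 i)
          rw [← ENNReal.ofReal_one]
          exact ENNReal.ofReal_le_ofReal (by linarith)
      _ = η := by rw [one_mul, ENNReal.add_halves]

/-- Smooth functions are dense in `H¹` of a convex open set. -/
lemma exists_contDiff_tendsto {D : Set Plane} (hD : IsOpen D) (hconv : Convex ℝ D)
    (hne : D.Nonempty) {f : Plane → ℝ} {g : Fin 2 → Plane → ℝ} (h : HasH1 D f g) :
    ∃ Φ : ℕ → Plane → ℝ, (∀ k, ContDiff ℝ ∞ (Φ k)) ∧
      Tendsto (fun k => eLpNorm (Φ k - f) 2 (volume.restrict D)) atTop (𝓝 0) ∧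
      ∀ i, Tendsto (fun k => eLpNorm (pderiv i (Φ k) - g i) 2 (volume.restrict D)) atTop
        (𝓝 0) := by
  have hpos : ∀ k : ℕ, ((k : ENNReal))⁻¹ ≠ 0 := fun k => by simp
  choose Φ h1 h2 h3 using fun k : ℕ => exists_contDiff_eLpNorm_sub_le hD hconv hne h (hpos k)
  refine ⟨Φ, h1, ?_, fun i => ?_⟩
  · exact tendsto_of_tendsto_of_tendsto_of_le_of_le tendsto_const_nhds
      ENNReal.tendsto_inv_nat_nhds_zero (fun _ => zero_le) h2
  · exact tendsto_of_tendsto_of_tendsto_of_le_of_le tendsto_const_nhds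
      ENNReal.tendsto_inv_nat_nhds_zero (fun _ => zero_le) fun k => h3 k i

/-! ### The Poincaré inequality on convex sets -/

/-- The squared length of the classical gradient. -/
noncomputable def gradSq (f : Plane → ℝ) (x : Plane) : ℝ := pderiv 0 f x ^ 2 + pderiv 1 f x ^ 2

lemma gradSq_nonneg (f : Plane → ℝ) (x : Plane) : 0 ≤ gradSq f x := by
  unfold gradSq; positivity

lemma gradSq_continuous {f : Plane → ℝ} (hf : ContDiff ℝ 1 f) : Continuous (gradSq f) :=
  ((pderiv_continuous hf 0).pow 2).add ((pderiv_continuous hf 1).pow 2)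

lemma plane_eq_sum (v : Plane) : v = v 0 • EuclideanSpace.single 0 (1 : ℝ)
    + v 1 • EuclideanSpace.single 1 (1 : ℝ) := by
  ext i; fin_cases i <;> simp

lemma fderiv_apply_eq (f : Plane → ℝ) (x v : Plane) :
    fderiv ℝ f x v = v 0 * pderiv 0 f x + v 1 * pderiv 1 f x := by
  conv_lhs => rw [plane_eq_sum v]
  simp [pderiv]

lemma norm_sq_plane (v : Plane) : ‖v‖ ^ 2 = v 0 ^ 2 + v 1 ^ 2 := by
  rw [EuclideanSpace.norm_sq_eq, Fin.sum_univ_two]; simp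

lemma fderiv_apply_sq_le (f : Plane → ℝ) (x v : Plane) :
    (fderiv ℝ f x v) ^ 2 ≤ ‖v‖ ^ 2 * gradSq f x := by
  rw [fderiv_apply_eq, norm_sq_plane, gradSq]
  nlinarith [sq_nonneg (v 0 * pderiv 1 f x - v 1 * pderiv 0 f x)]

lemma sq_intervalIntegral_le {φ : ℝ → ℝ} (hφ : Continuous φ) :
    (∫ s in (0 : ℝ)..1, φ s) ^ 2 ≤ ∫ s in (0 : ℝ)..1, φ s ^ 2 := by
  set m := ∫ s in (0 : ℝ)..1, φ s with hm
  have h0 : 0 ≤ ∫ s in (0 : ℝ)..1, (φ s - m) ^ 2 :=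
    intervalIntegral.integral_nonneg zero_le_one fun s _ => sq_nonneg _
  have h1 : ∫ s in (0 : ℝ)..1, (φ s - m) ^ 2
      = (∫ s in (0 : ℝ)..1, φ s ^ 2) - 2 * m * (∫ s in (0 : ℝ)..1, φ s) + m ^ 2 := by
    have e : ∀ s, (φ s - m) ^ 2 = φ s ^ 2 - 2 * m * φ s + m ^ 2 := fun s => by ring
    simp only [e]
    rw [intervalIntegral.integral_add, intervalIntegral.integral_sub,
      intervalIntegral.integral_const_mul, intervalIntegral.integral_const]
    · simp
    all_goals exact Continuous.intervalIntegrable (by fun_prop) _ _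
  rw [h1, ← hm] at h0
  linarith

lemma sub_sq_le_integral_gradSq {f : Plane → ℝ} (hf : ContDiff ℝ 1 f) (x y : Plane) :
    (f x - f y) ^ 2 ≤ ‖x - y‖ ^ 2 * ∫ s in (0 : ℝ)..1, gradSq f (s • x + (1 - s) • y) := by
  have hder : ∀ s : ℝ, HasDerivAt (fun s : ℝ => f (s • x + (1 - s) • y))
      (fderiv ℝ f (s • x + (1 - s) • y) (x - y)) s := fun s => by
    have h1 : HasDerivAt (fun s : ℝ => s • x + (1 - s) • y) (x - y) s := by
      have := ((hasDerivAt_id s).smul_const x).add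
        (((hasDerivAt_id s).const_sub 1).smul_const y)
      simpa [sub_eq_add_neg] using! this
    exact ((hf.differentiable one_ne_zero _).hasFDerivAt).comp_hasDerivAt s h1
  have hc : Continuous fun s : ℝ => fderiv ℝ f (s • x + (1 - s) • y) (x - y) :=
    ((hf.continuous_fderiv one_ne_zero).comp (by fun_prop)).clm_apply continuous_const
  have hftc := intervalIntegral.integral_eq_sub_of_hasDerivAt (fun s _ => hder s)
    (hc.intervalIntegrable 0 1)
  simp only [one_smul, sub_self, zero_smul, add_zero, sub_zero, zero_add] at hftc
  rw [← hftc, ← intervalIntegral.integral_const_mul]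
  refine (sq_intervalIntegral_le hc).trans ?_
  refine intervalIntegral.integral_mono_on zero_le_one ?_ ?_ fun s _ => fderiv_apply_sq_le _ _ _
  · exact (hc.pow 2).intervalIntegrable _ _
  · exact Continuous.intervalIntegrable
      (continuous_const.mul ((gradSq_continuous hf).comp (by fun_prop))) _ _

lemma setLIntegral_comp_affine_le {D : Set Plane} (hD : MeasurableSet D) {Γ : Plane → ENNReal}
    (hΓ : Measurable Γ) {t : ℝ} (ht : 1 / 2 ≤ t) {z : Plane} (hz : ∀ x ∈ D, t • x + z ∈ D) :
    ∫⁻ x in D, Γ (t • x + z) ≤ 4 * ∫⁻ x in D, Γ x := by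
  have ht0 : t ≠ 0 := by positivity
  calc ∫⁻ x in D, Γ (t • x + z) ≤ ∫⁻ x, D.indicator Γ (t • x + z) := by
        rw [← lintegral_indicator hD]
        refine lintegral_mono fun x => ?_
        by_cases hx : x ∈ D
        · simp [hx, hz x hx]
        · simp [hx]
    _ = ENNReal.ofReal ((t ^ 2)⁻¹) * ∫⁻ x in D, Γ x := by
        rw [← lintegral_indicator hD,
          ← lintegral_map (f := D.indicator Γ) (g := fun x : Plane => t • x + z)
          (hΓ.indicator hD) (by fun_prop), map_affine_volume ht0,
          lintegral_smul_measure, smul_eq_mul]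
    _ ≤ 4 * ∫⁻ x in D, Γ x := by
        gcongr
        rw [← ENNReal.ofReal_ofNat]
        refine ENNReal.ofReal_le_ofReal ?_
        refine inv_le_of_inv_le₀ (by norm_num) ?_
        nlinarith

lemma integrableOn_of_continuous {D : Set Plane} (hb : Bornology.IsBounded D) {f : Plane → ℝ}
    (hf : Continuous f) : IntegrableOn f D :=
  (hf.continuousOn.integrableOn_compact hb.isCompact_closure).mono_set subset_closure

/-- The Poincaré inequality for smooth functions on a convex set. -/
lemma exists_integral_sub_sq_le {D : Set Plane} (hconv : Convex ℝ D) (hm : MeasurableSet D)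
    (hb : Bornology.IsBounded D) (h0 : volume D ≠ 0) {h : ℝ}
    (hh : ∀ x ∈ D, ∀ y ∈ D, ‖x - y‖ ≤ h) {f : Plane → ℝ} (hf : ContDiff ℝ 1 f) :
    ∃ a : ℝ, ∫ x in D, (f x - a) ^ 2 ≤ 4 * h ^ 2 * ∫ x in D, gradSq f x := by
  have hfin : volume D ≠ ⊤ := hb.measure_lt_top.ne
  set Γ : Plane → ENNReal := fun x => ENNReal.ofReal (gradSq f x) with hΓ
  have hgc := gradSq_continuous hf
  have hΓm : Measurable Γ := hgc.measurable.ennreal_ofReal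
  have hcont := hf.continuous
  have pt : ∀ x ∈ D, ∀ y ∈ D, ENNReal.ofReal ((f x - f y) ^ 2)
      ≤ ENNReal.ofReal (h ^ 2) * ∫⁻ s in Set.Ioc (0 : ℝ) 1, Γ (s • x + (1 - s) • y) := by
    intro x hx y hy
    have hc : Continuous fun s : ℝ => gradSq f (s • x + (1 - s) • y) := hgc.comp (by fun_prop)
    have h1 := sub_sq_le_integral_gradSq hf x y
    have h2 : 0 ≤ ∫ s in (0 : ℝ)..1, gradSq f (s • x + (1 - s) • y) :=
      intervalIntegral.integral_nonneg zero_le_one fun s _ => gradSq_nonneg _ _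
    have h3 : ‖x - y‖ ^ 2 ≤ h ^ 2 := by
      have := hh x hx y hy
      gcongr
    rw [hΓ, ← ofReal_integral_eq_lintegral_ofReal, ← ENNReal.ofReal_mul (by positivity),
      ← intervalIntegral.integral_of_le zero_le_one]
    · exact ENNReal.ofReal_le_ofReal (h1.trans (mul_le_mul_of_nonneg_right h3 h2))
    · exact (hc.intervalIntegrable 0 1).1
    · exact Eventually.of_forall fun s => gradSq_nonneg _ _
  have hmeas : Measurable fun q : Plane × Plane × ℝ => Γ (q.2.2 • q.2.1 + (1 - q.2.2) • q.1) :=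
    hΓm.comp (by fun_prop)
  have total : ∫⁻ y in D, ∫⁻ x in D, ENNReal.ofReal ((f x - f y) ^ 2)
      ≤ ENNReal.ofReal (h ^ 2) * (4 * (∫⁻ x in D, Γ x) * volume D) := by
    calc ∫⁻ y in D, ∫⁻ x in D, ENNReal.ofReal ((f x - f y) ^ 2)
        ≤ ∫⁻ y in D, ∫⁻ x in D, ENNReal.ofReal (h ^ 2) *
            ∫⁻ s in Set.Ioc (0 : ℝ) 1, Γ (s • x + (1 - s) • y) := by
          refine setLIntegral_mono' hm fun y hy => setLIntegral_mono' hm fun x hx => pt x hx y hy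
      _ = ENNReal.ofReal (h ^ 2) * ∫⁻ y in D, ∫⁻ x in D,
            ∫⁻ s in Set.Ioc (0 : ℝ) 1, Γ (s • x + (1 - s) • y) := by
          rw [← lintegral_const_mul' _ _ ENNReal.ofReal_ne_top]
          refine lintegral_congr fun y => ?_
          rw [lintegral_const_mul' _ _ ENNReal.ofReal_ne_top]
      _ = ENNReal.ofReal (h ^ 2) * ∫⁻ s in Set.Ioc (0 : ℝ) 1, ∫⁻ y in D, ∫⁻ x in D,
            Γ (s • x + (1 - s) • y) := by
          congr 1
          have e1 : ∀ y : Plane, ∫⁻ x in D, ∫⁻ s in Set.Ioc (0 : ℝ) 1, Γ (s • x + (1 - s) • y)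
              = ∫⁻ s in Set.Ioc (0 : ℝ) 1, ∫⁻ x in D, Γ (s • x + (1 - s) • y) := fun y =>
            lintegral_lintegral_swap
              (hΓm.comp (by fun_prop : Measurable fun q : Plane × ℝ =>
                q.2 • q.1 + (1 - q.2) • y)).aemeasurable
          simp only [e1]
          refine lintegral_lintegral_swap (Measurable.aemeasurable ?_)
          exact Measurable.lintegral_prod_right' (f := fun (q : (Plane × ℝ) × Plane) =>
            Γ (q.1.2 • q.2 + (1 - q.1.2) • q.1.1)) (hΓm.comp (by fun_prop))
      _ ≤ ENNReal.ofReal (h ^ 2) * ∫⁻ s in Set.Ioc (0 : ℝ) 1, 4 * (∫⁻ x in D, Γ x) * volume D := by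
          gcongr 1
          refine setLIntegral_mono' measurableSet_Ioc fun s hs => ?_
          -- The point s x + (1 - s) y is an affine function of x with factor s and of y with factor
          -- 1 - s. One of the factors is at least 1/2, and the substitution in that variable costs
          -- at most 4.
          rcases le_total (1 / 2) s with h12 | h12
          · calc _ ≤ ∫⁻ y in D, 4 * (∫⁻ x in D, Γ x) := by
                  refine setLIntegral_mono' hm fun y hy => ?_
                  exact setLIntegral_comp_affine_le hm hΓm h12 fun x hx =>
                    hconv hx hy hs.1.le (by linarith [hs.2]) (by ring)
              _ = _ := setLIntegral_const _ _
          · have hsw : ∫⁻ y in D, ∫⁻ x in D, Γ (s • x + (1 - s) • y)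
                = ∫⁻ x in D, ∫⁻ y in D, Γ (s • x + (1 - s) • y) :=
              lintegral_lintegral_swap (hΓm.comp (by fun_prop : Measurable fun q : Plane × Plane =>
                s • q.2 + (1 - s) • q.1)).aemeasurable
            rw [hsw]
            calc _ ≤ ∫⁻ x in D, 4 * (∫⁻ x in D, Γ x) := by
                  refine setLIntegral_mono' hm fun x hx => ?_
                  simp only [add_comm (s • x)]
                  exact setLIntegral_comp_affine_le hm hΓm (by linarith) fun y hy =>
                    hconv hy hx (by linarith) hs.1.le (by ring)
              _ = _ := setLIntegral_const _ _
      _ = _ := by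
          rw [setLIntegral_const]
          simp
  -- The constant is f(y) for a point y at which the inner integral does not exceed its average over
  -- D.
  obtain ⟨y, hy, hle⟩ := exists_le_setLAverage (μ := volume) (s := D) h0 hfin
    (f := fun y => ∫⁻ x in D, ENNReal.ofReal ((f x - f y) ^ 2)) (by
      refine Measurable.aemeasurable ?_
      exact Measurable.lintegral_prod_right' (f := fun (q : Plane × Plane) =>
            ENNReal.ofReal ((f q.2 - f q.1) ^ 2))
            (Continuous.measurable (by fun_prop : Continuous fun q : Plane × Plane =>
              (f q.2 - f q.1) ^ 2)).ennreal_ofReal)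
  refine ⟨f y, ?_⟩
  rw [setLAverage_eq] at hle
  have h2 : ∫⁻ x in D, ENNReal.ofReal ((f x - f y) ^ 2)
      ≤ ENNReal.ofReal (h ^ 2) * (4 * (∫⁻ x in D, Γ x)) := by
    refine hle.trans (ENNReal.div_le_of_le_mul ?_)
    rw [mul_assoc]
    exact total
  have i1 : Integrable (fun x => (f x - f y) ^ 2) (volume.restrict D) :=
    integrableOn_of_continuous hb (by fun_prop)
  rw [hΓ, ← ofReal_integral_eq_lintegral_ofReal i1 (Eventually.of_forall fun x => sq_nonneg _),
    ← ofReal_integral_eq_lintegral_ofReal (integrableOn_of_continuous hb hgc)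
      (Eventually.of_forall fun x => gradSq_nonneg _ _),
    show (4 : ENNReal) = ENNReal.ofReal 4 by simp, ← ENNReal.ofReal_mul (by norm_num),
    ← ENNReal.ofReal_mul (by positivity), ENNReal.ofReal_le_ofReal_iff] at h2
  · linarith
  · have : 0 ≤ ∫ x in D, gradSq f x := integral_nonneg fun x => gradSq_nonneg _ _
    positivity

/-! ### Triangles: Green's formula and the trace inequality -/

/-- The reference triangle. -/
def refTriangle : Set Plane := {x | 0 ≤ x 0 ∧ 0 ≤ x 1 ∧ x 0 + x 1 ≤ 1}

lemma isClosed_refTriangle : IsClosed refTriangle := by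
  have h : ∀ i : Fin 2, Continuous fun x : Plane => x i := fun i => by fun_prop
  exact (isClosed_le continuous_const (h 0)).inter ((isClosed_le continuous_const (h 1)).inter
    (isClosed_le ((h 0).add (h 1)) continuous_const))

lemma isBounded_refTriangle : Bornology.IsBounded refTriangle := by
  refine (Metric.isBounded_closedBall (x := (0 : Plane)) (r := 2)).subset fun x hx => ?_
  rw [mem_closedBall_zero_iff]
  obtain ⟨h0, h1, h2⟩ := hx
  refine abs_le_of_sq_le_sq' ?_ (by norm_num) |>.2
  rw [norm_sq_plane]
  nlinarith

lemma isCompact_refTriangle : IsCompact refTriangle :=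
  Metric.isCompact_of_isClosed_isBounded isClosed_refTriangle isBounded_refTriangle

/-- The measure preserving identification of `ℝ × ℝ` with the plane. -/
noncomputable def planeEquiv : Plane ≃ᵐ ℝ × ℝ :=
  (MeasurableEquiv.toLp 2 (Fin 2 → ℝ)).symm.trans MeasurableEquiv.finTwoArrow

lemma measurePreserving_planeEquiv_symm : MeasurePreserving planeEquiv.symm := by
  refine MeasurePreserving.symm planeEquiv ?_
  exact (volume_preserving_finTwoArrow ℝ).comp
    (EuclideanSpace.volume_preserving_symm_measurableEquiv_toLp (Fin 2))

lemma integral_refTriangle (H : Plane → ℝ) :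
    ∫ x in refTriangle, H x = ∫ z : ℝ × ℝ, refTriangle.indicator H !₂[z.1, z.2] := by
  rw [← integral_indicator isClosed_refTriangle.measurableSet,
    ← measurePreserving_planeEquiv_symm.integral_comp planeEquiv.symm.measurableEmbedding]
  rfl

lemma integrable_refTriangle {H : Plane → ℝ} (hH : Continuous H) :
    Integrable fun z : ℝ × ℝ => refTriangle.indicator H !₂[z.1, z.2] := by
  have h1 : Integrable (refTriangle.indicator H) :=
    (integrable_indicator_iff isClosed_refTriangle.measurableSet).2
      (integrableOn_of_continuous isBounded_refTriangle hH)
  exact (measurePreserving_planeEquiv_symm.integrable_comp_emb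
    planeEquiv.symm.measurableEmbedding).2 h1

lemma integral_slice {φ ψ : ℝ → ℝ} {c : ℝ} (hc : c ∈ Set.Icc (0 : ℝ) 1)
    (h : ∀ x, φ x = (Set.Icc 0 (1 - c)).indicator ψ x) :
    ∫ x, φ x = ∫ x in (0 : ℝ)..(1 - c), ψ x := by
  rw [intervalIntegral.integral_of_le (by linarith [hc.2]), ← integral_Icc_eq_integral_Ioc,
    ← integral_indicator measurableSet_Icc]
  exact integral_congr_ae (Eventually.of_forall h)

lemma integral_refTriangle_eq_y {H : Plane → ℝ} (hH : Continuous H) :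
    ∫ x in refTriangle, H x = ∫ y in (0 : ℝ)..1, ∫ x in (0 : ℝ)..(1 - y), H !₂[x, y] := by
  rw [integral_refTriangle, Measure.volume_eq_prod, integral_prod_symm _ (integrable_refTriangle hH),
    intervalIntegral.integral_of_le zero_le_one, ← integral_Icc_eq_integral_Ioc,
    ← integral_indicator measurableSet_Icc]
  congr 1; ext y
  by_cases hy : y ∈ Set.Icc (0 : ℝ) 1
  · rw [Set.indicator_of_mem hy]
    refine integral_slice hy fun x => ?_
    by_cases hx : x ∈ Set.Icc 0 (1 - y)
    · rw [Set.indicator_of_mem hx, Set.indicator_of_mem]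
      refine ⟨hx.1, hy.1, ?_⟩
      have := hx.2
      simp; linarith
    · rw [Set.indicator_of_notMem hx, Set.indicator_of_notMem]
      rintro ⟨h1, h2, h3⟩
      simp at h1 h2 h3
      exact hx ⟨h1, by linarith⟩
  · rw [Set.indicator_of_notMem hy]
    refine integral_eq_zero_of_ae (Eventually.of_forall fun x => ?_)
    refine Set.indicator_of_notMem ?_ _
    rintro ⟨h1, h2, h3⟩
    simp at h1 h2 h3
    exact hy ⟨h2, by linarith⟩

lemma integral_refTriangle_eq_x {H : Plane → ℝ} (hH : Continuous H) :
    ∫ x in refTriangle, H x = ∫ x in (0 : ℝ)..1, ∫ y in (0 : ℝ)..(1 - x), H !₂[x, y] := by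
  rw [integral_refTriangle, Measure.volume_eq_prod, integral_prod _ (integrable_refTriangle hH),
    intervalIntegral.integral_of_le zero_le_one, ← integral_Icc_eq_integral_Ioc,
    ← integral_indicator measurableSet_Icc]
  congr 1; ext x
  by_cases hx : x ∈ Set.Icc (0 : ℝ) 1
  · rw [Set.indicator_of_mem hx]
    refine integral_slice hx fun y => ?_
    by_cases hy : y ∈ Set.Icc 0 (1 - x)
    · rw [Set.indicator_of_mem hy, Set.indicator_of_mem]
      refine ⟨hx.1, hy.1, ?_⟩
      have := hy.2
      simp; linarith
    · rw [Set.indicator_of_notMem hy, Set.indicator_of_notMem]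
      rintro ⟨h1, h2, h3⟩
      simp at h1 h2 h3
      exact hy ⟨h2, by linarith⟩
  · rw [Set.indicator_of_notMem hx]
    refine integral_eq_zero_of_ae (Eventually.of_forall fun y => ?_)
    refine Set.indicator_of_notMem ?_ _
    rintro ⟨h1, h2, h3⟩
    simp at h1 h2 h3
    exact hx ⟨h1, by linarith⟩

lemma hasDerivAt_vec_fst (x y : ℝ) :
    HasDerivAt (fun x : ℝ => (!₂[x, y] : Plane)) (EuclideanSpace.single 0 1) x := by
  have h : (fun x : ℝ => (!₂[x, y] : Plane))
      = fun x => x • EuclideanSpace.single 0 (1 : ℝ) + !₂[0, y] := by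
    ext x i; fin_cases i <;> simp
  rw [h]
  simpa using! ((hasDerivAt_id x).smul_const (EuclideanSpace.single (0 : Fin 2) (1 : ℝ))).add_const
    (!₂[0, y] : Plane)

lemma hasDerivAt_vec_snd (x y : ℝ) :
    HasDerivAt (fun y : ℝ => (!₂[x, y] : Plane)) (EuclideanSpace.single 1 1) y := by
  have h : (fun y : ℝ => (!₂[x, y] : Plane))
      = fun y => y • EuclideanSpace.single 1 (1 : ℝ) + !₂[x, 0] := by
    ext x i; fin_cases i <;> simp
  rw [h]
  simpa using! ((hasDerivAt_id y).smul_const (EuclideanSpace.single (1 : Fin 2) (1 : ℝ))).add_const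
    (!₂[x, 0] : Plane)

lemma continuous_vec_fst (y : ℝ) : Continuous fun x : ℝ => (!₂[x, y] : Plane) :=
  continuous_iff_continuousAt.2 fun x => (hasDerivAt_vec_fst x y).continuousAt

lemma continuous_vec_snd (x : ℝ) : Continuous fun y : ℝ => (!₂[x, y] : Plane) :=
  continuous_iff_continuousAt.2 fun y => (hasDerivAt_vec_snd x y).continuousAt

lemma integral_refTriangle_pderiv_zero {F : Plane → ℝ} (hF : ContDiff ℝ 1 F) :
    ∫ x in refTriangle, pderiv 0 F x
      = ∫ y in (0 : ℝ)..1, (F !₂[1 - y, y] - F !₂[0, y]) := by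
  rw [integral_refTriangle_eq_y (pderiv_continuous hF 0)]
  congr 1; ext y
  refine intervalIntegral.integral_eq_sub_of_hasDerivAt (f := fun x => F !₂[x, y])
    (fun x _ => ?_) ?_
  · exact (hF.differentiable one_ne_zero _).hasFDerivAt.comp_hasDerivAt x (hasDerivAt_vec_fst x y)
  · exact ((pderiv_continuous hF 0).comp (continuous_vec_fst y)).intervalIntegrable _ _

lemma integral_refTriangle_pderiv_one {F : Plane → ℝ} (hF : ContDiff ℝ 1 F) :
    ∫ x in refTriangle, pderiv 1 F x
      = ∫ x in (0 : ℝ)..1, (F !₂[x, 1 - x] - F !₂[x, 0]) := by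
  rw [integral_refTriangle_eq_x (pderiv_continuous hF 1)]
  congr 1; ext x
  refine intervalIntegral.integral_eq_sub_of_hasDerivAt (f := fun y => F !₂[x, y])
    (fun y _ => ?_) ?_
  · exact (hF.differentiable one_ne_zero _).hasFDerivAt.comp_hasDerivAt y (hasDerivAt_vec_snd x y)
  · exact ((pderiv_continuous hF 1).comp (continuous_vec_snd x)).intervalIntegrable _ _

/-- Twice the signed area of the triangle `a b c`. -/
def orient (a b c : Plane) : ℝ :=
  (b 0 - a 0) * (c 1 - a 1) - (b 1 - a 1) * (c 0 - a 0)

/-- The affine map from the reference triangle to the triangle `a b c`. -/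
noncomputable def triMap (a b c : Plane) (x : Plane) : Plane := a + (x 0 • (b - a) + x 1 • (c - a))

/-- The linear part of `triMap`. -/
noncomputable def triLin (a b c : Plane) : Plane →L[ℝ] Plane :=
  (EuclideanSpace.proj (𝕜 := ℝ) (0 : Fin 2)).smulRight (b - a)
    + (EuclideanSpace.proj (𝕜 := ℝ) (1 : Fin 2)).smulRight (c - a)

lemma hasFDerivAt_triMap (a b c x : Plane) :
    HasFDerivAt (triMap a b c) (triLin a b c) x :=
  (triLin a b c).hasFDerivAt.const_add a

lemma contDiff_triMap (a b c : Plane) : ContDiff ℝ ∞ (triMap a b c) :=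
  contDiff_const.add (triLin a b c).contDiff

lemma det_triLin (a b c : Plane) : (triLin a b c).det = orient a b c := by
  rw [ContinuousLinearMap.det, ← LinearMap.det_toMatrix
    (EuclideanSpace.basisFun (Fin 2) ℝ).toBasis, Matrix.det_fin_two]
  simp [LinearMap.toMatrix_apply, triLin, orient]
  ring

lemma injective_triMap {a b c : Plane} (h : orient a b c ≠ 0) :
    Function.Injective (triMap a b c) := by
  intro x y hxy
  have h0 := congrArg (fun v : Plane => v 0) hxy
  have h1 := congrArg (fun v : Plane => v 1) hxy
  simp [triMap] at h0 h1
  have e0 : (x 0 - y 0) * orient a b c = 0 := by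
    unfold orient
    linear_combination (c 1 - a 1) * h0 - (c 0 - a 0) * h1
  have e1 : (x 1 - y 1) * orient a b c = 0 := by
    unfold orient
    linear_combination (b 0 - a 0) * h1 - (b 1 - a 1) * h0
  ext i
  fin_cases i
  · exact sub_eq_zero.1 ((mul_eq_zero.1 e0).resolve_right h)
  · exact sub_eq_zero.1 ((mul_eq_zero.1 e1).resolve_right h)

lemma convex_refTriangle : Convex ℝ refTriangle := by
  rintro x ⟨h1, h2, h3⟩ y ⟨h4, h5, h6⟩ s t hs ht hst
  refine ⟨?_, ?_, ?_⟩ <;> simp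
  · positivity
  · positivity
  · nlinarith

lemma image_triMap (a b c : Plane) : triMap a b c '' refTriangle = convexHull ℝ {a, b, c} := by
  refine Set.Subset.antisymm ?_ ?_
  · rintro _ ⟨x, ⟨h0, h1, h2⟩, rfl⟩
    have ha : a ∈ convexHull ℝ {a, b, c} := subset_convexHull ℝ _ (by simp)
    have hb : b ∈ convexHull ℝ {a, b, c} := subset_convexHull ℝ _ (by simp)
    have hc : c ∈ convexHull ℝ {a, b, c} := subset_convexHull ℝ _ (by simp)
    have hconv := convex_convexHull ℝ {a, b, c}
    have := hconv.sum_mem (t := Finset.univ) (w := ![1 - x 0 - x 1, x 0, x 1]) (z := ![a, b, c])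
      (by intro i _; fin_cases i <;> simp <;> linarith) (by simp [Fin.sum_univ_three]; ring)
      (by intro i _; fin_cases i <;> simpa)
    rw [Fin.sum_univ_three] at this
    convert this using 1
    simp [triMap]
    module
  · refine convexHull_min ?_ ?_
    · rintro x (rfl | rfl | rfl)
      · exact ⟨!₂[0, 0], by simp [refTriangle], by simp [triMap]⟩
      · exact ⟨!₂[1, 0], by simp [refTriangle], by simp [triMap]⟩
      · exact ⟨!₂[0, 1], by simp [refTriangle], by simp [triMap]⟩
    · have : triMap a b c '' refTriangle
          = (fun x => a + x) '' ((triLin a b c) '' refTriangle) := by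
        rw [Set.image_image]; rfl
      rw [this]
      exact (convex_refTriangle.linear_image (triLin a b c).toLinearMap).translate a

lemma integral_triangle {a b c : Plane} (h : orient a b c ≠ 0) (g : Plane → ℝ) :
    ∫ x in convexHull ℝ {a, b, c}, g x
      = |orient a b c| * ∫ x in refTriangle, g (triMap a b c x) := by
  rw [← image_triMap, integral_image_eq_integral_abs_det_fderiv_smul volume
    isClosed_refTriangle.measurableSet
    (fun x _ => (hasFDerivAt_triMap a b c x).hasFDerivWithinAt) (injective_triMap h).injOn,
    det_triLin, ← integral_const_mul]
  rfl

/-- The circulation of the vector field `(f₀, f₁)` along the oriented segment from `a` to `b`. -/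
noncomputable def lineInt (f₀ f₁ : Plane → ℝ) (a b : Plane) : ℝ :=
  ∫ s in (0 : ℝ)..1, (f₀ (a + s • (b - a)) * (b 0 - a 0) + f₁ (a + s • (b - a)) * (b 1 - a 1))

lemma lineInt_swap (f₀ f₁ : Plane → ℝ) (a b : Plane) :
    lineInt f₀ f₁ b a = - lineInt f₀ f₁ a b := by
  unfold lineInt
  have key := intervalIntegral.integral_comp_sub_left (a := 0) (b := 1)
    (f := fun s : ℝ => f₀ (b + s • (a - b)) * (a 0 - b 0) + f₁ (b + s • (a - b)) * (a 1 - b 1)) 1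
  simp only [sub_self, sub_zero] at key
  rw [← key, ← intervalIntegral.integral_neg]
  congr 1; ext s
  have : b + (1 - s) • (a - b) = a + s • (b - a) := by module
  rw [this]; ring

/-- Green's formula, pulled back to the reference triangle. -/
lemma orient_mul_integral_curl {f₀ f₁ : Plane → ℝ} (h₀ : ContDiff ℝ 1 f₀) (h₁ : ContDiff ℝ 1 f₁)
    (a b c : Plane) :
    orient a b c * ∫ x in refTriangle,
        (pderiv 0 f₁ (triMap a b c x) - pderiv 1 f₀ (triMap a b c x))
      = lineInt f₀ f₁ a b + lineInt f₀ f₁ b c + lineInt f₀ f₁ c a := by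
  have hM : ContDiff ℝ 1 (triMap a b c) := (contDiff_triMap a b c).of_le (by exact_mod_cast le_top)
  -- The pulled back 1-form has the coefficients F (b - a) and F (c - a), and its curl is the curl
  -- of (f₀, f₁) times the determinant `orient a b c`. Green's formula on the reference triangle
  -- then needs no nondegeneracy of a, b, c.
  set F : Plane → Plane → ℝ := fun v x =>
    f₀ (triMap a b c x) * v 0 + f₁ (triMap a b c x) * v 1 with hF
  have hFc : ∀ v, ContDiff ℝ 1 (F v) := fun v =>
    ((h₀.comp hM).mul contDiff_const).add ((h₁.comp hM).mul contDiff_const)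
  have hFd : ∀ v x w, fderiv ℝ (F v) x w
      = fderiv ℝ f₀ (triMap a b c x) (triLin a b c w) * v 0
        + fderiv ℝ f₁ (triMap a b c x) (triLin a b c w) * v 1 := by
    intro v x w
    have d0 := ((h₀.differentiable one_ne_zero (triMap a b c x)).hasFDerivAt.comp x
      (hasFDerivAt_triMap a b c x)).mul_const (v 0)
    have d1 := ((h₁.differentiable one_ne_zero (triMap a b c x)).hasFDerivAt.comp x
      (hasFDerivAt_triMap a b c x)).mul_const (v 1)
    have d2 : HasFDerivAt (F v) _ x := d0.add d1
    rw [d2.fderiv]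
    simp [mul_comm]
  have l0 : triLin a b c (EuclideanSpace.single 0 1) = b - a := by simp [triLin]
  have l1 : triLin a b c (EuclideanSpace.single 1 1) = c - a := by simp [triLin]
  have hcurl : ∀ x, orient a b c *
      (pderiv 0 f₁ (triMap a b c x) - pderiv 1 f₀ (triMap a b c x))
      = pderiv 0 (F (c - a)) x - pderiv 1 (F (b - a)) x := by
    intro x
    have hp : ∀ v i, pderiv i (F v) x = fderiv ℝ (F v) x (EuclideanSpace.single i 1) :=
      fun _ _ => rfl
    rw [hp, hp, hFd, hFd, l0, l1]
    simp only [fderiv_apply_eq, orient, PiLp.sub_apply]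
    ring
  rw [← integral_const_mul]
  simp only [hcurl]
  have hi : ∀ v i, IntegrableOn (pderiv i (F v)) refTriangle := fun v i =>
    integrableOn_of_continuous isBounded_refTriangle (pderiv_continuous (hFc v) i)
  rw [integral_sub (hi _ 0) (hi _ 1), integral_refTriangle_pderiv_zero (hFc _),
    integral_refTriangle_pderiv_one (hFc _), lineInt_swap f₀ f₁ a c]
  have c0 : ∀ v : Plane, Continuous fun y : ℝ => F v !₂[0, y] := fun v =>
    (hFc v).continuous.comp (continuous_vec_snd 0)
  have c1 : ∀ v : Plane, Continuous fun x : ℝ => F v !₂[x, 0] := fun v =>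
    (hFc v).continuous.comp (continuous_vec_fst 0)
  have cv : Continuous fun y : ℝ => (!₂[1 - y, y] : Plane) := by
    have : (fun y : ℝ => (!₂[1 - y, y] : Plane)) = fun y => !₂[1, 0] + y • !₂[-1, 1] := by
      ext y i; fin_cases i <;> simp; ring
    rw [this]; fun_prop
  have c2 : ∀ v : Plane, Continuous fun y : ℝ => F v !₂[1 - y, y] := fun v =>
    (hFc v).continuous.comp cv
  have e1 : ∫ x in (0 : ℝ)..1, F (b - a) !₂[x, 1 - x] = ∫ y in (0 : ℝ)..1, F (b - a) !₂[1 - y, y] := by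
    have := intervalIntegral.integral_comp_sub_left (a := 0) (b := 1)
      (f := fun x : ℝ => F (b - a) !₂[x, 1 - x]) 1
    simp only [sub_sub_cancel, sub_self, sub_zero] at this
    exact this.symm
  have c3 : Continuous fun y : ℝ => F (b - a) !₂[y, 1 - y] := by
    have := (c2 (b - a)).comp (continuous_const.sub continuous_id : Continuous fun y : ℝ => 1 - y)
    simpa [Function.comp_def] using this
  rw [intervalIntegral.integral_sub ((c2 _).intervalIntegrable _ _)
    ((c0 _).intervalIntegrable _ _), intervalIntegral.integral_sub (c3.intervalIntegrable _ _)
    ((c1 _).intervalIntegrable _ _), e1]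
  have q0 : ∫ y in (0 : ℝ)..1, F (c - a) !₂[0, y] = lineInt f₀ f₁ a c := by
    unfold lineInt; congr 1; ext y; simp [hF, triMap]
  have q1 : ∫ x in (0 : ℝ)..1, F (b - a) !₂[x, 0] = lineInt f₀ f₁ a b := by
    unfold lineInt; congr 1; ext y; simp [hF, triMap]
  have q2 : (∫ y in (0 : ℝ)..1, F (c - a) !₂[1 - y, y]) - ∫ y in (0 : ℝ)..1, F (b - a) !₂[1 - y, y]
      = lineInt f₀ f₁ b c := by
    rw [← intervalIntegral.integral_sub ((c2 _).intervalIntegrable _ _)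
      ((c2 _).intervalIntegrable _ _)]
    unfold lineInt; congr 1; ext y
    have : triMap a b c !₂[1 - y, y] = b + y • (c - b) := by
      simp only [triMap]
      simp
      module
    simp only [hF, this, PiLp.sub_apply]
    ring
  rw [q0, q1]
  linarith

/-- Path independence for a smooth curl-free field in the whole plane; the three points may be
collinear. -/
lemma lineInt_cocycle {f₀ f₁ : Plane → ℝ} (h₀ : ContDiff ℝ 1 f₀) (h₁ : ContDiff ℝ 1 f₁)
    (hcurl : ∀ x, pderiv 0 f₁ x - pderiv 1 f₀ x = 0) (a b c : Plane) :
    lineInt f₀ f₁ a b + lineInt f₀ f₁ b c + lineInt f₀ f₁ c a = 0 := by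
  rw [← orient_mul_integral_curl h₀ h₁]
  simp [hcurl]

/-- Green's formula on a triangle. -/
lemma integral_curl_triangle {f₀ f₁ : Plane → ℝ} (h₀ : ContDiff ℝ 1 f₀) (h₁ : ContDiff ℝ 1 f₁)
    {a b c : Plane} (h : orient a b c ≠ 0) :
    ∫ x in convexHull ℝ {a, b, c}, (pderiv 0 f₁ x - pderiv 1 f₀ x)
      = Real.sign (orient a b c) * (lineInt f₀ f₁ a b + lineInt f₀ f₁ b c + lineInt f₀ f₁ c a) := by
  rw [← orient_mul_integral_curl h₀ h₁, integral_triangle h, ← mul_assoc]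
  congr 1
  rcases h.lt_or_gt with h' | h'
  · rw [Real.sign_of_neg h', abs_of_neg h']; ring
  · rw [Real.sign_of_pos h', abs_of_pos h']; ring

lemma integral_refTriangle_one : ∫ _ in refTriangle, (1 : ℝ) = 1 / 2 := by
  rw [integral_refTriangle_eq_y (H := fun _ => 1) continuous_const]
  simp only [intervalIntegral.integral_const, sub_zero, smul_eq_mul, mul_one]
  rw [intervalIntegral.integral_sub (by simp) (by simp)]
  norm_num

lemma volume_real_triangle {a b c : Plane} (h : orient a b c ≠ 0) :
    volume.real (convexHull ℝ {a, b, c}) = |orient a b c| / 2 := by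
  have := integral_triangle h (fun _ => 1)
  rw [integral_refTriangle_one] at this
  simp at this
  rw [this]; ring

lemma pderiv_mul {f g : Plane → ℝ} (hf : ContDiff ℝ 1 f) (hg : ContDiff ℝ 1 g) (i : Fin 2)
    (x : Plane) :
    pderiv i (fun x => f x * g x) x = f x * pderiv i g x + g x * pderiv i f x := by
  have := (hf.differentiable one_ne_zero x).hasFDerivAt.mul
    (hg.differentiable one_ne_zero x).hasFDerivAt
  have h2 : HasFDerivAt (fun x => f x * g x) _ x := this
  rw [pderiv, h2.fderiv]
  simp [pderiv]

lemma pderiv_affine (i j : Fin 2) (r c : ℝ) (x : Plane) :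
    pderiv i (fun x : Plane => r * x j + c) x = if i = j then r else 0 := by
  have := (((EuclideanSpace.proj j : Plane →L[ℝ] ℝ).hasFDerivAt
    (x := x)).const_mul r).add_const c
  have h2 : HasFDerivAt (fun x : Plane => r * x j + c) _ x := this
  rw [pderiv, h2.fderiv]
  by_cases h : i = j <;> simp [h, eq_comm]

lemma contDiff_affine {n : WithTop ℕ∞} (j : Fin 2) (r c : ℝ) :
    ContDiff ℝ n fun x : Plane => r * x j + c :=
  (contDiff_const.mul (EuclideanSpace.proj j : Plane →L[ℝ] ℝ).contDiff).add
    contDiff_const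

lemma isBounded_triangle (a b c : Plane) : Bornology.IsBounded (convexHull ℝ {a, b, c}) :=
  isBounded_convexHull.2 (Set.toFinite _).isBounded

lemma measurableSet_triangle (a b c : Plane) : MeasurableSet (convexHull ℝ {a, b, c}) := by
  rw [← image_triMap]
  exact (isCompact_refTriangle.image (contDiff_triMap a b c).continuous).isClosed.measurableSet

/-- The trace inequality on a triangle. -/
lemma orient_mul_integral_edge_le {g : Plane → ℝ} (hg : ContDiff ℝ 1 g) {a b c : Plane}
    (ho : orient a b c ≠ 0) {h : ℝ} (hh : ∀ x ∈ convexHull ℝ {a, b, c}, ‖x - c‖ ≤ h) :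
    |orient a b c| * ∫ s in (0 : ℝ)..1, g (a + s • (b - a)) ^ 2
      ≤ ∫ x in convexHull ℝ {a, b, c}, (3 * g x ^ 2 + h ^ 2 * gradSq g x) := by
  -- The field is g² times x - c turned by a right angle. Its tangential component vanishes on the
  -- two edges through c, and on ab it contributes the constant `orient a b c` times g². Its curl is
  -- 2g² + 2g ∇g·(x - c) ≤ 3g² + ‖x - c‖² |∇g|².
  set f₀ : Plane → ℝ := fun x => (g x * g x) * (-1 * x 1 + c 1) with hf₀
  set f₁ : Plane → ℝ := fun x => (g x * g x) * (1 * x 0 + -c 0) with hf₁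
  have hgg : ContDiff ℝ 1 fun x => g x * g x := hg.mul hg
  have h₀ : ContDiff ℝ 1 f₀ := hgg.mul (contDiff_affine _ _ _)
  have h₁ : ContDiff ℝ 1 f₁ := hgg.mul (contDiff_affine _ _ _)
  have hcurl : ∀ x, pderiv 0 f₁ x - pderiv 1 f₀ x
      = 2 * g x ^ 2 + 2 * g x * fderiv ℝ g x (x - c) := fun x => by
    rw [hf₀, hf₁, pderiv_mul hgg (contDiff_affine _ _ _), pderiv_mul hgg (contDiff_affine _ _ _),
      pderiv_mul hg hg, pderiv_mul hg hg, pderiv_affine, pderiv_affine, fderiv_apply_eq]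
    simp
    ring
  have key := integral_curl_triangle h₀ h₁ ho
  have e1 : lineInt f₀ f₁ b c = 0 := by
    unfold lineInt
    refine intervalIntegral.integral_zero_ae (Eventually.of_forall fun s _ => ?_)
    simp [hf₀, hf₁]; ring
  have e2 : lineInt f₀ f₁ c a = 0 := by
    unfold lineInt
    refine intervalIntegral.integral_zero_ae (Eventually.of_forall fun s _ => ?_)
    simp [hf₀, hf₁]; ring
  have e3 : lineInt f₀ f₁ a b
      = orient a b c * ∫ s in (0 : ℝ)..1, g (a + s • (b - a)) ^ 2 := by
    unfold lineInt
    rw [← intervalIntegral.integral_const_mul]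
    congr 1; ext s
    simp [hf₀, hf₁, orient]; ring
  have e4 : Real.sign (orient a b c) * orient a b c = |orient a b c| := by
    rcases ho.lt_or_gt with h' | h'
    · rw [Real.sign_of_neg h', abs_of_neg h']; ring
    · rw [Real.sign_of_pos h', abs_of_pos h']; ring
  rw [e1, e2, e3, add_zero, add_zero, ← mul_assoc, e4] at key
  rw [← key]
  have hb := isBounded_triangle a b c
  refine setIntegral_mono_on ?_ ?_ (measurableSet_triangle a b c) fun x hx => ?_
  · exact integrableOn_of_continuous hb ((pderiv_continuous h₁ 0).sub (pderiv_continuous h₀ 1))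
  · exact integrableOn_of_continuous hb
      ((continuous_const.mul (hg.continuous.pow 2)).add
        (continuous_const.mul (gradSq_continuous hg)))
  · rw [hcurl]
    have h3 := fderiv_apply_sq_le g x (x - c)
    have h4 : ‖x - c‖ ^ 2 * gradSq g x ≤ h ^ 2 * gradSq g x := by
      have := gradSq_nonneg g x
      have := hh x hx
      gcongr
    nlinarith [sq_nonneg (g x - fderiv ℝ g x (x - c))]

lemma gradSq_sub_const (g : Plane → ℝ) (m x) : gradSq (fun x => g x - m) x = gradSq g x := by
  simp [gradSq, pderiv, fderiv_sub_const]

/-- On a triangle, a function is close to its mean value on an edge. -/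
lemma integral_sub_edge_mean_sq_le {g : Plane → ℝ} (hg : ContDiff ℝ 1 g) {a b c : Plane}
    (ho : orient a b c ≠ 0) {h : ℝ}
    (hh : ∀ x ∈ convexHull ℝ {a, b, c}, ∀ y ∈ convexHull ℝ {a, b, c}, ‖x - y‖ ≤ h) :
    ∫ x in convexHull ℝ {a, b, c}, (g x - ∫ s in (0 : ℝ)..1, g (a + s • (b - a))) ^ 2
      ≤ 21 * h ^ 2 * ∫ x in convexHull ℝ {a, b, c}, gradSq g x := by
  set K := convexHull ℝ {a, b, c} with hK
  set m := ∫ s in (0 : ℝ)..1, g (a + s • (b - a)) with hm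
  have hb : Bornology.IsBounded K := isBounded_triangle a b c
  have hvol : volume.real K = |orient a b c| / 2 := volume_real_triangle ho
  have hpos : 0 < |orient a b c| := abs_pos.2 ho
  have hv0 : volume K ≠ 0 := fun h0 => by
    rw [Measure.real, h0] at hvol
    simp at hvol
    linarith
  obtain ⟨α, hα⟩ := exists_integral_sub_sq_le (convex_convexHull ℝ _)
    (measurableSet_triangle a b c) hb hv0 hh hg
  have htr := orient_mul_integral_edge_le (hg.sub contDiff_const : ContDiff ℝ 1 fun x => g x - α) ho
    (fun x hx => hh x hx c (subset_convexHull ℝ _ (by simp)))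
  simp only [gradSq_sub_const] at htr
  have hgc := hg.continuous
  have i1 : IntegrableOn (fun x => (g x - α) ^ 2) K := integrableOn_of_continuous hb (by fun_prop)
  have i2 : IntegrableOn (gradSq g) K := integrableOn_of_continuous hb (gradSq_continuous hg)
  rw [integral_add (i1.const_mul 3) (i2.const_mul _), integral_const_mul, integral_const_mul] at htr
  have hma : m - α = ∫ s in (0 : ℝ)..1, (g (a + s • (b - a)) - α) := by
    rw [intervalIntegral.integral_sub]
    · simp [hm]
    all_goals exact Continuous.intervalIntegrable (by fun_prop) _ _
  have hj := sq_intervalIntegral_le (φ := fun s => g (a + s • (b - a)) - α) (by fun_prop)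
  rw [← hma] at hj
  have hmul := mul_le_mul_of_nonneg_left hj hpos.le
  -- The area is |orient a b c|/2, so the term 2(m - α)² integrates to |orient a b c| (m - α)². The
  -- trace inequality bounds it by 3∫(g - α)² + h²∫|∇g|². With the Poincaré constant 4h² the total
  -- is 5·4h² + h² = 21h².
  have hsplit : ∫ x in K, (g x - m) ^ 2 ≤ ∫ x in K, (2 * (g x - α) ^ 2 + 2 * (m - α) ^ 2) := by
    refine integral_mono ?_ ?_ fun x => ?_
    · exact integrableOn_of_continuous hb (by fun_prop)
    · exact integrableOn_of_continuous hb (by fun_prop)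
    · simp only
      nlinarith [sq_nonneg ((g x - α) + (m - α))]
  have hcst : ∫ x in K, 2 * (m - α) ^ 2 = |orient a b c| * (m - α) ^ 2 := by
    rw [setIntegral_const, hvol, smul_eq_mul]; ring
  have hcb : IntegrableOn (fun _ : Plane => 2 * (m - α) ^ 2) K :=
    integrableOn_of_continuous hb continuous_const
  rw [integral_add (i1.const_mul 2) hcb, integral_const_mul, hcst] at hsplit
  linarith

/-! ### Barycentric coordinates -/

lemma orient_rotate (a b c : Plane) : orient b c a = orient a b c := by unfold orient; ring

lemma orient_swap (a b c : Plane) : orient b a c = - orient a b c := by unfold orient; ring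

lemma orient_swap_right (a b c : Plane) : orient a c b = - orient a b c := by unfold orient; ring

@[simp] lemma orient_self_left (a b : Plane) : orient a a b = 0 := by unfold orient; ring
@[simp] lemma orient_self_right (a b : Plane) : orient a b b = 0 := by unfold orient; ring
@[simp] lemma orient_self_outer (a b : Plane) : orient a b a = 0 := by unfold orient; ring

lemma orient_lineMap (a b x y : Plane) (r : ℝ) :
    orient a b (x + r • (y - x)) = (1 - r) * orient a b x + r * orient a b y := by
  simp [orient]; ring

lemma continuous_orient (a b : Plane) : Continuous fun x => orient a b x := by
  unfold orient; fun_prop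

/-- The signed areas of x with respect to the edges are `orient a b c` times its barycentric
coordinates. Multiplication by `orient a b c` makes the signs independent of the orientation of the
triangle. -/
lemma mem_triangle_iff {a b c : Plane} (ho : orient a b c ≠ 0) (x : Plane) :
    x ∈ convexHull ℝ {a, b, c} ↔ 0 ≤ orient a b c * orient b c x ∧
      0 ≤ orient a b c * orient c a x ∧ 0 ≤ orient a b c * orient a b x := by
  rw [← image_triMap]
  constructor
  · rintro ⟨z, ⟨h0, h1, h2⟩, rfl⟩
    have e1 : orient b c (triMap a b c z) = (1 - z 0 - z 1) * orient a b c := by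
      simp [orient, triMap]; ring
    have e2 : orient c a (triMap a b c z) = z 0 * orient a b c := by
      simp [orient, triMap]; ring
    have e3 : orient a b (triMap a b c z) = z 1 * orient a b c := by
      simp [orient, triMap]; ring
    rw [e1, e2, e3]
    have hs := mul_self_nonneg (orient a b c)
    refine ⟨?_, ?_, ?_⟩
    · nlinarith [mul_nonneg hs (by linarith : 0 ≤ 1 - z 0 - z 1)]
    · nlinarith [mul_nonneg hs h0]
    · nlinarith [mul_nonneg hs h1]
  · rintro ⟨h1, h2, h3⟩
    set o := orient a b c with hod
    have hpos : 0 < o * o := mul_self_pos.2 ho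
    have hsum : orient b c x + orient c a x + orient a b x = o := by
      rw [hod]; unfold orient; ring
    refine ⟨!₂[orient c a x / o, orient a b x / o], ⟨?_, ?_, ?_⟩, ?_⟩
    · simp only [Matrix.cons_val_zero]
      rw [← mul_div_mul_left _ _ ho]; positivity
    · simp only [Matrix.cons_val_one, Matrix.cons_val_zero]
      rw [← mul_div_mul_left _ _ ho]; positivity
    · simp only [Matrix.cons_val_one, Matrix.cons_val_zero]
      rw [← add_div, ← mul_div_mul_left _ _ ho, div_le_one hpos,
        show orient c a x + orient a b x = o - orient b c x by linarith, mul_sub]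
      linarith
    · ext i
      fin_cases i
      · simp [triMap]
        field_simp
        rw [hod]; unfold orient; ring
      · simp [triMap]
        field_simp
        rw [hod]; unfold orient; ring

lemma mem_interior_triangle {a b c : Plane} (ho : orient a b c ≠ 0) {x : Plane}
    (h1 : 0 < orient a b c * orient b c x) (h2 : 0 < orient a b c * orient c a x)
    (h3 : 0 < orient a b c * orient a b x) : x ∈ interior (convexHull ℝ {a, b, c}) := by
  rw [mem_interior]
  refine ⟨{y | 0 < orient a b c * orient b c y} ∩ ({y | 0 < orient a b c * orient c a y} ∩
    {y | 0 < orient a b c * orient a b y}), ?_, ?_, h1, h2, h3⟩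
  · rintro y ⟨g1, g2, g3⟩
    exact (mem_triangle_iff ho y).2 ⟨le_of_lt g1, le_of_lt g2, le_of_lt g3⟩
  · have hc : ∀ a' b' : Plane, IsOpen {y | 0 < orient a b c * orient a' b' y} := fun a' b' =>
      isOpen_lt continuous_const (continuous_const.mul (continuous_orient a' b'))
    exact (hc _ _).inter ((hc _ _).inter (hc _ _))

lemma exists_lineMap_of_orient_eq_zero {a b c x : Plane} (ho : orient a b c ≠ 0)
    (hx : x ∈ convexHull ℝ {a, b, c}) (h : orient a b x = 0) :
    ∃ r ∈ Set.Icc (0 : ℝ) 1, x = a + r • (b - a) := by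
  rw [← image_triMap] at hx
  obtain ⟨z, ⟨h0, h1, h2⟩, rfl⟩ := hx
  have e3 : orient a b (triMap a b c z) = z 1 * orient a b c := by
    simp [orient, triMap]; ring
  have hz : z 1 = 0 := by
    rw [e3] at h
    exact (mul_eq_zero.1 h).resolve_right ho
  exact ⟨z 0, ⟨h0, by linarith⟩, by simp [triMap, hz]⟩

/-- Near an inner point of ab two of the three barycentric conditions hold strictly for both
triangles, and the sign of `orient a b y` decides which of them contains y. -/
lemma union_mem_nhds_of_opposite {a b c d : Plane} (h : orient a b c * orient a b d < 0) {r : ℝ}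
    (hr0 : 0 < r) (hr1 : r < 1) :
    convexHull ℝ {a, b, c} ∪ convexHull ℝ {a, b, d} ∈ 𝓝 (a + r • (b - a)) := by
  have hc : orient a b c ≠ 0 := fun h0 => by rw [h0] at h; simp at h
  have hd : orient a b d ≠ 0 := fun h0 => by rw [h0] at h; simp at h
  have hpos : ∀ e, orient a b e ≠ 0 → ∀ᶠ y in 𝓝 (a + r • (b - a)),
      0 < orient a b e * orient b e y ∧ 0 < orient a b e * orient e a y := by
    intro e he
    have hs : 0 < orient a b e * orient a b e := mul_self_pos.2 he
    have e1 : orient b e (a + r • (b - a)) = (1 - r) * orient a b e := by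
      simp [orient]; ring
    have e2 : orient e a (a + r • (b - a)) = r * orient a b e := by
      simp [orient]; ring
    have c1 := ((continuous_const (y := orient a b e)).mul
      (continuous_orient b e)).tendsto (a + r • (b - a))
    have c2 := ((continuous_const (y := orient a b e)).mul
      (continuous_orient e a)).tendsto (a + r • (b - a))
    refine (c1.eventually (lt_mem_nhds ?_)).and (c2.eventually (lt_mem_nhds ?_))
    · show 0 < orient a b e * orient b e _
      rw [e1]; nlinarith [mul_pos hs (by linarith : 0 < 1 - r)]
    · show 0 < orient a b e * orient e a _
      rw [e2]; nlinarith [mul_pos hs hr0]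
  filter_upwards [hpos c hc, hpos d hd] with y hy hy'
  rcases le_total 0 (orient a b c * orient a b y) with h0 | h0
  · exact Or.inl ((mem_triangle_iff hc y).2 ⟨hy.1.le, hy.2.le, h0⟩)
  · refine Or.inr ((mem_triangle_iff hd y).2 ⟨hy'.1.le, hy'.2.le, ?_⟩)
    by_contra hneg
    push Not at hneg
    nlinarith [mul_pos_of_neg_of_neg h hneg, mul_nonneg (neg_nonneg.2 h0)
      (mul_self_nonneg (orient a b d))]

/-! ### Edges of a triangulation of a polygon -/

variable {n : ℕ} {p : Polygon Plane (n + 3)} {P : Set Plane} {T : Finset (Finset (Fin (n + 3)))}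

lemma cell_triple (p : Polygon Plane (n + 3)) (i j k : Fin (n + 3)) :
    cell p {i, j, k} = convexHull ℝ {p i, p j, p k} := by
  simp [cell, Set.image_insert_eq]

lemma vertex_mem_cell {t : Finset (Fin (n + 3))} {i : Fin (n + 3)} (hi : i ∈ t) : p i ∈ cell p t :=
  subset_convexHull ℝ _ ⟨i, hi, rfl⟩

lemma isCompact_cell (t : Finset (Fin (n + 3))) : IsCompact (cell p t) :=
  (t.finite_toSet.image _).isCompact_convexHull ℝ

lemma exists_third {t : Finset (Fin (n + 3))} (ht : t.card = 3) {i j : Fin (n + 3)} (hi : i ∈ t)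
    (hj : j ∈ t) (hij : i ≠ j) : ∃ k, k ≠ i ∧ k ≠ j ∧ t = {i, j, k} := by
  have hsub : {i, j} ⊆ t := by
    intro x hx; simp at hx; rcases hx with rfl | rfl <;> assumption
  have hcard : (t \ {i, j}).card = 1 := by
    rw [Finset.card_sdiff_of_subset hsub, ht, Finset.card_pair hij]
  obtain ⟨k, hk⟩ := Finset.card_eq_one.1 hcard
  have hk' : k ∈ t \ {i, j} := by rw [hk]; simp
  simp at hk'
  refine ⟨k, hk'.2.1, hk'.2.2, ?_⟩
  rw [← Finset.union_sdiff_of_subset hsub, hk]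
  ext x; simp

lemma orient_ne_zero_of_affineIndependent {a b c : Plane}
    (h : AffineIndependent ℝ ![a, b, c]) : orient a b c ≠ 0 := by
  intro h0
  have key : ∀ w : Fin 3 → ℝ, w 0 + w 1 + w 2 = 0 → w 0 • a + w 1 • b + w 2 • c = 0 →
      w 1 = 0 ∧ w 2 = 0 := by
    intro w h1 h2
    have := (affineIndependent_iff.1 h) Finset.univ w
      (by simpa [Fin.sum_univ_three] using h1) (by simpa [Fin.sum_univ_three] using h2)
    exact ⟨this 1 (Finset.mem_univ _), this 2 (Finset.mem_univ _)⟩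
  unfold orient at h0
  obtain ⟨g1, g2⟩ := key ![(b 0 - a 0) - (c 0 - a 0), c 0 - a 0, -(b 0 - a 0)] (by simp) (by
    ext i; fin_cases i
    · simp; ring
    · simp; linear_combination -h0)
  obtain ⟨g3, g4⟩ := key ![(b 1 - a 1) - (c 1 - a 1), c 1 - a 1, -(b 1 - a 1)] (by simp) (by
    ext i; fin_cases i
    · simp; linear_combination h0
    · simp; ring)
  simp at g1 g2 g3 g4
  have : a = b := by
    ext i; fin_cases i
    · simp; linarith
    · simp; linarith
  have h01 : (0 : Fin 3) = 1 := h.injective (by simpa using this)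
  exact absurd h01 (by decide)

namespace IsTriangulation

lemma orient_ne_zero (hT : IsTriangulation p P T) {t} (ht : t ∈ T) {i j k : Fin (n + 3)}
    (hi : i ∈ t) (hj : j ∈ t) (hk : k ∈ t) (hij : i ≠ j) (hik : i ≠ k) (hjk : j ≠ k) :
    orient (p i) (p j) (p k) ≠ 0 := by
  have hinj : Function.Injective (![⟨i, hi⟩, ⟨j, hj⟩, ⟨k, hk⟩] : Fin 3 → t) := by
    intro a b hab
    fin_cases a <;> fin_cases b <;> simp_all [eq_comm]
  have h1 := (hT.nondegenerate t ht).comp_embedding ⟨_, hinj⟩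
  refine orient_ne_zero_of_affineIndependent ?_
  convert h1 using 1
  ext a; fin_cases a <;> rfl

lemma cell_subset (hT : IsTriangulation p P T) {t} (ht : t ∈ T) : cell p t ⊆ P := by
  rw [← hT.iUnion_eq]
  exact Set.subset_biUnion_of_mem (u := fun t => cell p t) ht

/-- If a point of the triangle `t` has a positive `i`-th barycentric coordinate and lies in
another triangle `s`, then `i` is a vertex of `s`. -/
lemma mem_of_orient_ne_zero (hT : IsTriangulation p P T) {s t} (hs : s ∈ T) (ht : t ∈ T)
    {i j k : Fin (n + 3)} (htt : t = {i, j, k}) {x : Plane} (hxs : x ∈ cell p s)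
    (hxt : x ∈ cell p t) (ho : orient (p j) (p k) x ≠ 0) : i ∈ s := by
  by_contra hi
  -- By conformity x lies in the common face. If i is not a vertex of s, this face is contained in
  -- the opposite edge of t, where the i-th barycentric coordinate vanishes.
  have hx : x ∈ cell p (s ∩ t) := by rw [← hT.inter_eq s hs t ht]; exact ⟨hxs, hxt⟩
  have hsub : cell p (s ∩ t) ⊆ segment ℝ (p j) (p k) := by
    rw [← convexHull_pair]
    refine convexHull_mono ?_
    rintro _ ⟨l, hl, rfl⟩
    simp [htt] at hl
    rcases hl.2 with rfl | rfl | rfl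
    · exact absurd hl.1 hi
    · simp
    · simp
  have hx2 := hsub hx
  rw [segment_eq_image'] at hx2
  obtain ⟨r, -, rfl⟩ := hx2
  apply ho
  rw [orient_lineMap]
  simp

lemma lineMap_mem_cell {t : Finset (Fin (n + 3))} {i j : Fin (n + 3)} (hi : i ∈ t) (hj : j ∈ t)
    {r : ℝ} (hr : r ∈ Set.Icc (0 : ℝ) 1) : p i + r • (p j - p i) ∈ cell p t := by
  refine (convex_convexHull ℝ _).segment_subset (vertex_mem_cell hi) (vertex_mem_cell hj) ?_
  rw [segment_eq_image']
  exact ⟨r, hr, rfl⟩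

/-- A triangle that contains an inner point of an edge of the triangulation has this edge. -/
lemma edge_mem (hT : IsTriangulation p P T) {s t} (hs : s ∈ T) (ht : t ∈ T)
    {i j : Fin (n + 3)} (hi : i ∈ t) (hj : j ∈ t) (hij : i ≠ j) {r : ℝ} (hr0 : 0 < r)
    (hr1 : r < 1) (hx : p i + r • (p j - p i) ∈ cell p s) : i ∈ s ∧ j ∈ s := by
  obtain ⟨k, hki, hkj, htt⟩ := exists_third (hT.card_eq t ht) hi hj hij
  have hk : k ∈ t := by rw [htt]; simp
  have ho := hT.orient_ne_zero ht hi hj hk hij hki.symm hkj.symm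
  have hxt := lineMap_mem_cell (p := p) hi hj ⟨hr0.le, hr1.le⟩
  constructor
  · refine hT.mem_of_orient_ne_zero hs ht htt hx hxt ?_
    rw [orient_lineMap, orient_self_outer, orient_rotate, mul_zero, add_zero]
    exact mul_ne_zero (by linarith) ho
  · refine hT.mem_of_orient_ne_zero hs ht (i := j) (j := i) (k := k) ?_ hx hxt ?_
    · rw [htt]; ext x; simp; tauto
    · rw [orient_lineMap, orient_self_outer, orient_swap_right, mul_zero, zero_add]
      exact mul_ne_zero hr0.ne' (neg_ne_zero.2 ho)

/-- Two triangles with a common edge that lie on the same side of it are equal. -/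
lemma eq_of_same_side (hT : IsTriangulation p P T) {s t} (hs : s ∈ T) (ht : t ∈ T)
    {i j k l : Fin (n + 3)} (hss : s = {i, j, k}) (htt : t = {i, j, l})
    (h : 0 < orient (p i) (p j) (p k) * orient (p i) (p j) (p l)) : s = t := by
  set a := p i
  set b := p j
  set c := p k
  set e := p l
  have hc : orient a b c ≠ 0 := fun h0 => by rw [h0] at h; simp at h
  have he : orient a b e ≠ 0 := fun h0 => by rw [h0] at h; simp at h
  set m : Plane := a + (1 / 2 : ℝ) • (b - a) with hm
  -- A short walk from the midpoint of the common edge towards p k stays in s and, since l lies on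
  -- the same side, also in t. The k-th barycentric coordinate is positive there, so k is a vertex
  -- of t.
  have hx : ∀ δ : ℝ, 0 < δ → δ < 1 → m + δ • (c - m) ∈ cell p s := by
    intro δ h0 h1
    have hcm : c ∈ cell p s := vertex_mem_cell (by simp [hss])
    have hmm : m ∈ cell p s := lineMap_mem_cell (by simp [hss]) (by simp [hss]) (by norm_num)
    refine (convex_convexHull ℝ _).segment_subset hmm hcm ?_
    rw [segment_eq_image']
    exact ⟨δ, ⟨h0.le, h1.le⟩, rfl⟩
  have o1 : orient b e m = 1 / 2 * orient a b e := by
    rw [hm, orient_lineMap, orient_self_outer, orient_rotate]; ring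
  have o2 : orient e a m = 1 / 2 * orient a b e := by
    rw [hm, orient_lineMap, orient_self_right, orient_rotate, orient_rotate]; ring
  have o3 : ∀ δ : ℝ, orient a b (m + δ • (c - m)) = δ * orient a b c := fun δ => by
    rw [orient_lineMap, hm, orient_lineMap]; simp
  have hpos : 0 < orient a b e * orient a b e := mul_self_pos.2 he
  have hcont : Continuous fun δ : ℝ => m + δ • (c - m) := by fun_prop
  have lim : Tendsto (fun δ : ℝ => m + δ • (c - m)) (𝓝[>] 0) (𝓝 m) := by
    have := hcont.tendsto 0
    simp only [zero_smul, add_zero] at this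
    exact this.mono_left nhdsWithin_le_nhds
  have c1 := (((continuous_const (y := orient a b e)).mul (continuous_orient b e)).tendsto m).comp
    lim
  have c2 := (((continuous_const (y := orient a b e)).mul (continuous_orient e a)).tendsto m).comp
    lim
  have ev1 := c1.eventually (lt_mem_nhds (a := 0) (by
    show 0 < orient a b e * orient b e m
    rw [o1]; nlinarith))
  have ev2 := c2.eventually (lt_mem_nhds (a := 0) (by
    show 0 < orient a b e * orient e a m
    rw [o2]; nlinarith))
  have ev3 : ∀ᶠ δ : ℝ in 𝓝[>] 0, δ ∈ Set.Ioo (0 : ℝ) 1 := Ioo_mem_nhdsGT one_pos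
  obtain ⟨δ, ⟨g1, g2⟩, g3⟩ := ((ev1.and ev2).and ev3).exists
  have hxt : m + δ • (c - m) ∈ cell p t := by
    rw [htt, cell_triple]
    refine (mem_triangle_iff he _).2 ⟨le_of_lt g1, le_of_lt g2, ?_⟩
    rw [o3]
    nlinarith [mul_pos g3.1 h]
  have hk : k ∈ t := by
    refine hT.mem_of_orient_ne_zero ht hs (i := k) (j := i) (k := j) ?_ hxt (hx δ g3.1 g3.2) ?_
    · rw [hss]; ext x; simp; tauto
    · rw [o3]; exact mul_ne_zero g3.1.ne' hc
  refine Finset.eq_of_subset_of_card_le ?_ ?_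
  · rw [hss]
    intro x hxm
    simp at hxm
    rcases hxm with rfl | rfl | rfl
    · simp [htt]
    · simp [htt]
    · exact hk
  · rw [hT.card_eq s hs, hT.card_eq t ht]

end IsTriangulation

lemma mem_edgeSet_iff (p : Polygon Plane (n + 3)) (i : Fin (n + 3)) (x : Plane) :
    x ∈ p.edgeSet ℝ i ↔ ∃ r ∈ Set.Icc (0 : ℝ) 1, x = p i + r • (p (i + 1) - p i) := by
  rw [Polygon.edgeSet, affineSegment, finRotate_apply]
  constructor
  · rintro ⟨r, hr, rfl⟩
    exact ⟨r, hr, by rw [AffineMap.lineMap_apply]; simp [add_comm]⟩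
  · rintro ⟨r, hr, rfl⟩
    exact ⟨r, hr, by rw [AffineMap.lineMap_apply]; simp [add_comm]⟩

lemma fin_succ_ne (i : Fin (n + 3)) : i + 1 ≠ i := by
  intro h
  simp at h

lemma fin_succ_succ_ne (i : Fin (n + 3)) : i + 1 + 1 ≠ i := by
  intro h
  rw [add_assoc] at h
  have h1 : (1 + 1 : Fin (n + 3)) = 0 := by simpa using h
  rw [Fin.ext_iff, Fin.val_add, Fin.val_one, Fin.val_zero,
    Nat.mod_eq_of_lt (show 1 + 1 < n + 3 by omega)] at h1
  omega

namespace IsSimplePolygon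

lemma ne_succ (hP : IsSimplePolygon p P) (i : Fin (n + 3)) : p i ≠ p (i + 1) := fun h =>
  fin_succ_ne i (hP.injective h).symm

lemma edge_subset_frontier (hP : IsSimplePolygon p P) (i : Fin (n + 3)) {r : ℝ}
    (hr : r ∈ Set.Icc (0 : ℝ) 1) : p i + r • (p (i + 1) - p i) ∈ frontier P := by
  rw [hP.frontier_eq, Polygon.boundary]
  exact Set.mem_iUnion.2 ⟨i, (mem_edgeSet_iff p i _).2 ⟨r, hr, rfl⟩⟩

lemma frontier_subset (hP : IsSimplePolygon p P) : frontier P ⊆ P :=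
  hP.isCompact.isClosed.frontier_subset

end IsSimplePolygon

namespace IsTriangulation

lemma exists_mem_cell (hT : IsTriangulation p P T) {x : Plane} (hx : x ∈ P) :
    ∃ t ∈ T, x ∈ cell p t := by
  rw [← hT.iUnion_eq] at hx
  simpa using hx

/-- A point of a triangle that is not an interior point of it lies on one of the edges. -/
lemma exists_edge_of_notMem_interior (hT : IsTriangulation p P T) {t} (ht : t ∈ T) {x : Plane}
    (hx : x ∈ cell p t) (hxi : x ∉ interior (cell p t)) :
    ∃ a ∈ t, ∃ b ∈ t, a ≠ b ∧ ∃ r ∈ Set.Icc (0 : ℝ) 1, x = p a + r • (p b - p a) := by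
  obtain ⟨i, j, k, hij, hik, hjk, htt⟩ := Finset.card_eq_three.1 (hT.card_eq t ht)
  have hi : i ∈ t := by simp [htt]
  have hj : j ∈ t := by simp [htt]
  have hk : k ∈ t := by simp [htt]
  have ho := hT.orient_ne_zero ht hi hj hk hij hik hjk
  have ho1 : orient (p j) (p k) (p i) ≠ 0 := by rwa [orient_rotate]
  have ho2 : orient (p k) (p i) (p j) ≠ 0 := by rwa [orient_rotate, orient_rotate]
  rw [htt, cell_triple] at hx hxi
  have e1 : ({p i, p j, p k} : Set Plane) = {p j, p k, p i} := by ext; simp; tauto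
  have e2 : ({p i, p j, p k} : Set Plane) = {p k, p i, p j} := by ext; simp; tauto
  by_cases h3 : orient (p i) (p j) x = 0
  · obtain ⟨r, hr, hxr⟩ := exists_lineMap_of_orient_eq_zero ho hx h3
    exact ⟨i, hi, j, hj, hij, r, hr, hxr⟩
  by_cases h1 : orient (p j) (p k) x = 0
  · rw [e1] at hx
    obtain ⟨r, hr, hxr⟩ := exists_lineMap_of_orient_eq_zero ho1 hx h1
    exact ⟨j, hj, k, hk, hjk, r, hr, hxr⟩
  by_cases h2 : orient (p k) (p i) x = 0
  · rw [e2] at hx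
    obtain ⟨r, hr, hxr⟩ := exists_lineMap_of_orient_eq_zero ho2 hx h2
    exact ⟨k, hk, i, hi, hik.symm, r, hr, hxr⟩
  exfalso
  obtain ⟨g1, g2, g3⟩ := (mem_triangle_iff ho x).1 hx
  exact hxi (mem_interior_triangle ho (lt_of_le_of_ne g1 (mul_ne_zero ho h1).symm)
    (lt_of_le_of_ne g2 (mul_ne_zero ho h2).symm) (lt_of_le_of_ne g3 (mul_ne_zero ho h3).symm))

/-- Every edge of the polygon is an edge of a triangle. -/
lemma exists_boundary_triangle (hP : IsSimplePolygon p P) (hT : IsTriangulation p P T)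
    (i : Fin (n + 3)) : ∃ t ∈ T, i ∈ t ∧ i + 1 ∈ t := by
  set x : ℝ → Plane := fun r => p i + r • (p (i + 1) - p i) with hx
  have hxc : Continuous x := by fun_prop
  have hd : p (i + 1) - p i ≠ 0 := sub_ne_zero.2 (hP.ne_succ i).symm
  -- A point of the boundary of P is not an interior point of a triangle, hence it lies on an edge
  -- of every triangle that contains it.
  have hcov : ∀ r ∈ Set.Ioo (0 : ℝ) 1, ∃ q : (Finset (Fin (n + 3))) × Fin (n + 3) × Fin (n + 3),
      q.1 ∈ T ∧ q.2.1 ∈ q.1 ∧ q.2.2 ∈ q.1 ∧ q.2.1 ≠ q.2.2 ∧ x r ∈ segment ℝ (p q.2.1) (p q.2.2) := by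
    intro r hr
    have hf := hP.edge_subset_frontier i ⟨hr.1.le, hr.2.le⟩
    obtain ⟨t, ht, hxt⟩ := hT.exists_mem_cell (hP.frontier_subset hf)
    have hni : x r ∉ interior (cell p t) := fun h =>
      hf.2 (interior_mono (hT.cell_subset ht) h)
    obtain ⟨a, ha, b, hb, hab, s, hs, hxs⟩ := hT.exists_edge_of_notMem_interior ht hxt hni
    refine ⟨(t, a, b), ht, ha, hb, hab, ?_⟩
    rw [segment_eq_image']
    exact ⟨s, hs, hxs.symm⟩
  -- There are finitely many edges, so one and the same edge contains points of the polygon edge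
  -- arbitrarily close to p i. Being closed, it contains p i as well.
  obtain ⟨q, hq⟩ : ∃ q : (Finset (Fin (n + 3))) × Fin (n + 3) × Fin (n + 3),
      ∃ᶠ r in 𝓝[>] (0 : ℝ), r ∈ Set.Ioo (0 : ℝ) 1 ∧
        q.1 ∈ T ∧ q.2.1 ∈ q.1 ∧ q.2.2 ∈ q.1 ∧ q.2.1 ≠ q.2.2 ∧
        x r ∈ segment ℝ (p q.2.1) (p q.2.2) := by
    by_contra hcon
    push Not at hcon
    have h1 := eventually_all.2 hcon
    have h2 : ∀ᶠ r : ℝ in 𝓝[>] 0, r ∈ Set.Ioo (0 : ℝ) 1 := Ioo_mem_nhdsGT one_pos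
    obtain ⟨r, g1, g2⟩ := (h1.and h2).exists
    obtain ⟨q, hq1, hq2, hq3, hq4, hq5⟩ := hcov r g2
    exact g1 q g2 hq1 hq2 hq3 hq4 hq5
  obtain ⟨t, a, b⟩ := q
  obtain ⟨r, hr, ht, ha, hb, hab, hseg⟩ := hq.exists
  have hlim : Tendsto x (𝓝[>] 0) (𝓝 (p i)) := by
    have := hxc.tendsto 0
    simp only [hx, zero_smul, add_zero] at this
    exact this.mono_left nhdsWithin_le_nhds
  have hclosed : IsClosed (segment ℝ (p a) (p b)) := by
    rw [← convexHull_pair]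
    exact ((Set.toFinite _).isCompact_convexHull ℝ).isClosed
  have hi0 : p i ∈ segment ℝ (p a) (p b) :=
    hclosed.mem_of_frequently_of_tendsto (hq.mono fun r hr => hr.2.2.2.2.2) hlim
  have hsegcell : segment ℝ (p a) (p b) ⊆ cell p t :=
    (convex_convexHull ℝ _).segment_subset (vertex_mem_cell ha) (vertex_mem_cell hb)
  have hit : i ∈ t := hT.vertex_mem i t ht (hsegcell hi0)
  have hcol : ∀ c ∈ t, ∀ a ∈ t, ∀ b ∈ t, a ≠ b → orient (p a) (p b) (p c) = 0 → c = a ∨ c = b := by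
    intro c hc a ha b hb hab h0
    by_contra hcon
    push Not at hcon
    exact hT.orient_ne_zero ht ha hb hc hab hcon.1.symm hcon.2.symm h0
  have main : ∀ b ∈ t, b ≠ i → x r ∈ segment ℝ (p i) (p b) → i + 1 ∈ t := by
    intro b hb hbi hsg
    rw [segment_eq_image'] at hsg
    obtain ⟨s, hs, hsx⟩ := hsg
    simp only [hx] at hsx
    have hsv : s • (p b - p i) = r • (p (i + 1) - p i) := add_left_cancel hsx
    have hs0 : s ≠ 0 := by
      rintro rfl
      rw [zero_smul] at hsv
      exact (smul_ne_zero hr.1.ne' hd) hsv.symm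
    have hspos : 0 < s := lt_of_le_of_ne hs.1 hs0.symm
    -- The points p b and p (i + 1) lie on the same ray from p i. If p b is the nearer one, it lies
    -- on the polygon edge, and simplicity forces b = i + 1. Otherwise p (i + 1) lies in the
    -- triangle, and the absence of additional incidences makes it a vertex of t.
    rcases le_total r s with hle | hle
    · have hpb : p b = p i + (r / s) • (p (i + 1) - p i) := by
        rw [div_eq_inv_mul, mul_smul, ← hsv, inv_smul_smul₀ hs0]; abel
      have h1 : p b ∈ p.edgeSet ℝ i := (mem_edgeSet_iff p i _).2
        ⟨r / s, ⟨div_nonneg hr.1.le hspos.le, div_le_one_of_le₀ hle hspos.le⟩, hpb⟩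
      have h2 : p b ∈ p.edgeSet ℝ b := (mem_edgeSet_iff p b _).2 ⟨0, by simp, by simp⟩
      rcases hP.edge_inter i b hbi.symm (p b) ⟨h1, h2⟩ with ⟨h3, -⟩ | ⟨-, h3⟩
      · rwa [← h3]
      · exact absurd (hP.injective h3) hbi
    · have hpi : p (i + 1) = p i + (s / r) • (p b - p i) := by
        rw [div_eq_inv_mul, mul_smul, hsv, inv_smul_smul₀ hr.1.ne']; abel
      refine hT.vertex_mem _ t ht ?_
      rw [hpi]
      exact lineMap_mem_cell hit hb ⟨div_nonneg hspos.le hr.1.le, div_le_one_of_le₀ hle hr.1.le⟩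
  have hor : orient (p a) (p b) (p i) = 0 := by
    rw [segment_eq_image'] at hi0
    obtain ⟨s, -, hs⟩ := hi0
    rw [← hs]
    simp [orient_lineMap]
  refine ⟨t, ht, hit, ?_⟩
  rcases hcol i hit a ha b hb hab hor with rfl | rfl
  · exact main b hb hab.symm hseg
  · exact main a ha hab (by rwa [segment_symm])

/-- Two triangles on opposite sides of a boundary edge would make its midpoint an interior point of
P; on the same side they coincide. -/
lemma eq_of_boundary_edge (hP : IsSimplePolygon p P) (hT : IsTriangulation p P T)
    {i : Fin (n + 3)} {s t} (hs : s ∈ T) (ht : t ∈ T) (his : i ∈ s) (his' : i + 1 ∈ s) (hit : i ∈ t)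
    (hit' : i + 1 ∈ t) : s = t := by
  have hne := (fin_succ_ne i).symm
  obtain ⟨k, hki, hkj, hss⟩ := exists_third (hT.card_eq s hs) his his' hne
  obtain ⟨l, hli, hlj, htt⟩ := exists_third (hT.card_eq t ht) hit hit' hne
  have hk : k ∈ s := by simp [hss]
  have hl : l ∈ t := by simp [htt]
  have h1 := hT.orient_ne_zero hs his his' hk hne hki.symm hkj.symm
  have h2 := hT.orient_ne_zero ht hit hit' hl hne hli.symm hlj.symm
  rcases lt_or_gt_of_ne (mul_ne_zero h1 h2) with h | h
  · exfalso
    have hn := union_mem_nhds_of_opposite h (r := 1 / 2) (by norm_num) (by norm_num)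
    have hsub : convexHull ℝ {p i, p (i + 1), p k} ∪ convexHull ℝ {p i, p (i + 1), p l} ⊆ P := by
      rw [← cell_triple, ← cell_triple, ← hss, ← htt]
      exact Set.union_subset (hT.cell_subset hs) (hT.cell_subset ht)
    have hf := hP.edge_subset_frontier i (r := 1 / 2) (by norm_num)
    exact hf.2 (mem_interior_iff_mem_nhds.2 (mem_of_superset hn hsub))
  · exact hT.eq_of_same_side hs ht hss htt h

/-- The inner points of an edge that is not an edge of the polygon are interior points. -/
lemma interior_edge_subset (hP : IsSimplePolygon p P) (hT : IsTriangulation p P T) {t} (ht : t ∈ T)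
    {i j : Fin (n + 3)} (hi : i ∈ t) (hj : j ∈ t) (hij : i ≠ j) (h1 : j ≠ i + 1) (h2 : i ≠ j + 1)
    {r : ℝ} (hr0 : 0 < r) (hr1 : r < 1) : p i + r • (p j - p i) ∈ interior P := by
  set x : Plane := p i + r • (p j - p i) with hx
  have hxt : x ∈ cell p t := lineMap_mem_cell hi hj ⟨hr0.le, hr1.le⟩
  have hxP := hT.cell_subset ht hxt
  by_contra hni
  have hf : x ∈ frontier P := ⟨subset_closure hxP, hni⟩
  rw [hP.frontier_eq, Polygon.boundary] at hf
  obtain ⟨k, hk⟩ := Set.mem_iUnion.1 hf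
  obtain ⟨s, hs, hxs⟩ := (mem_edgeSet_iff p k x).1 hk
  have hpij : p i ≠ p j := fun h => hij (hP.injective h)
  have hvert : ∀ l, x ≠ p l := by
    intro l hl
    have hlt : l ∈ t := hT.vertex_mem l t ht (hl ▸ hxt)
    have hz : orient (p i) (p j) (p l) = 0 := by rw [← hl, hx, orient_lineMap]; simp
    rcases eq_or_ne l i with rfl | hli
    · have : r • (p j - p l) = 0 := by simpa [hx] using hl
      rcases smul_eq_zero.1 this with h | h
      · exact hr0.ne' h
      · exact hpij (sub_eq_zero.1 h).symm
    rcases eq_or_ne l j with rfl | hlj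
    · have : (1 - r) • (p l - p i) = 0 := by
        have h3 : p l - x = 0 := by rw [hl, sub_self]
        rw [← h3, hx]; module
      rcases smul_eq_zero.1 this with h | h
      · linarith
      · exact hpij (sub_eq_zero.1 h).symm
    exact hT.orient_ne_zero ht hi hj hlt hij hli.symm hlj.symm hz
  have hs0 : 0 < s := lt_of_le_of_ne hs.1 fun h => hvert k (by rw [hxs, ← h]; simp)
  have hs1 : s < 1 := lt_of_le_of_ne hs.2 fun h => hvert (k + 1) (by rw [hxs, h]; simp)
  -- Suppose that x lies inside the polygon edge from p k. The triangle q at this edge contains x,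
  -- hence has i and j as vertices. On the line through p k and p (k + 1) the coordinate of the
  -- third vertex of q vanishes, so neither i nor j is that vertex, and (i, j) is the polygon edge.
  obtain ⟨q, hq, hkq, hkq'⟩ := hT.exists_boundary_triangle hP k
  have hkne := (fin_succ_ne k).symm
  have hxq : x ∈ cell p q := by rw [hxs]; exact lineMap_mem_cell hkq hkq' hs
  obtain ⟨hiq, hjq⟩ := hT.edge_mem hq ht hi hj hij hr0 hr1 hxq
  have hz : orient (p k) (p (k + 1)) x = 0 := by rw [hxs, orient_lineMap]; simp
  have hik : i = k ∨ i = k + 1 := by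
    by_contra hcon
    push Not at hcon
    have := hT.orient_ne_zero hq hkq hkq' hiq hkne hcon.1.symm hcon.2.symm
    rcases eq_or_ne j k with rfl | hjk
    · rw [hx, orient_lineMap, orient_self_outer, mul_zero, add_zero] at hz
      exact (mul_ne_zero (by linarith) this) hz
    rcases eq_or_ne j (k + 1) with rfl | hjk'
    · rw [hx, orient_lineMap, orient_self_right, mul_zero, add_zero] at hz
      exact (mul_ne_zero (by linarith) this) hz
    obtain ⟨l, -, -, hql⟩ := exists_third (hT.card_eq q hq) hkq hkq' hkne
    rw [hql] at hiq hjq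
    simp at hiq hjq
    exact hij ((hiq.resolve_left hcon.1).resolve_left hcon.2 |>.trans
      ((hjq.resolve_left hjk).resolve_left hjk').symm)
  have hjk : j = k ∨ j = k + 1 := by
    by_contra hcon
    push Not at hcon
    have := hT.orient_ne_zero hq hkq hkq' hjq hkne hcon.1.symm hcon.2.symm
    rcases hik with rfl | rfl
    · rw [hx, orient_lineMap, orient_self_outer, mul_zero, zero_add] at hz
      exact (mul_ne_zero hr0.ne' this) hz
    · rw [hx, orient_lineMap, orient_self_right, mul_zero, zero_add] at hz
      exact (mul_ne_zero hr0.ne' this) hz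
  rcases hik with rfl | rfl <;> rcases hjk with rfl | rfl
  · exact hij rfl
  · exact h1 rfl
  · exact h2 rfl
  · exact hij rfl

/-- Across an edge that is not an edge of the polygon there is a triangle on the other side. -/
lemma exists_opposite (hP : IsSimplePolygon p P) (hT : IsTriangulation p P T) {t} (ht : t ∈ T)
    {i j k : Fin (n + 3)} (htt : t = {i, j, k}) (hij : i ≠ j) (hik : i ≠ k) (hjk : j ≠ k)
    (h1 : j ≠ i + 1) (h2 : i ≠ j + 1) :
    ∃ s ∈ T, ∃ l, l ≠ i ∧ l ≠ j ∧ s = {i, j, l} ∧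
      orient (p i) (p j) (p k) * orient (p i) (p j) (p l) < 0 := by
  have hi : i ∈ t := by simp [htt]
  have hj : j ∈ t := by simp [htt]
  have hk : k ∈ t := by simp [htt]
  have ho := hT.orient_ne_zero ht hi hj hk hij hik hjk
  set m : Plane := p i + (1 / 2 : ℝ) • (p j - p i) with hm
  have hmi : m ∈ interior P :=
    hT.interior_edge_subset hP ht hi hj hij h1 h2 (by norm_num) (by norm_num)
  -- The line from p k through the midpoint m is followed beyond m. Since m is interior to P, the
  -- points close behind m lie in P, and one triangle contains such points arbitrarily close to m;
  -- by closedness it contains m, hence the edge.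
  set y : ℝ → Plane := fun δ => m + δ • (m - p k) with hy
  have hyc : Continuous y := by fun_prop
  have hlim : Tendsto y (𝓝[>] 0) (𝓝 m) := by
    have := hyc.tendsto 0
    simp only [hy, zero_smul, add_zero] at this
    exact this.mono_left nhdsWithin_le_nhds
  have hev : ∀ᶠ δ in 𝓝[>] 0, y δ ∈ P := hlim.eventually (mem_interior_iff_mem_nhds.1 hmi)
  obtain ⟨s, hs⟩ : ∃ s, ∃ᶠ δ in 𝓝[>] (0 : ℝ), 0 < δ ∧ s ∈ T ∧ y δ ∈ cell p s := by
    by_contra hcon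
    push Not at hcon
    have h3 := eventually_all.2 hcon
    have h4 : ∀ᶠ δ : ℝ in 𝓝[>] 0, δ ∈ Set.Ioi (0 : ℝ) := eventually_mem_nhdsWithin
    obtain ⟨δ, g1, g2, g3⟩ := (h3.and (hev.and h4)).exists
    obtain ⟨s, hs, hys⟩ := hT.exists_mem_cell g2
    exact g1 s g3 hs hys
  obtain ⟨δ, hδ, hsT, hys⟩ := hs.exists
  have hms : m ∈ cell p s := (isCompact_cell s).isClosed.mem_of_frequently_of_tendsto
    (hs.mono fun δ h => h.2.2) hlim
  obtain ⟨his, hjs⟩ := hT.edge_mem hsT ht hi hj hij (by norm_num) (by norm_num) hms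
  obtain ⟨l, hli, hlj, hss⟩ := exists_third (hT.card_eq s hsT) his hjs hij
  have hl : l ∈ s := by simp [hss]
  have hol := hT.orient_ne_zero hsT his hjs hl hij hli.symm hlj.symm
  refine ⟨s, hsT, l, hli, hlj, hss, ?_⟩
  rw [hss, cell_triple, mem_triangle_iff hol] at hys
  have h3 := hys.2.2
  have e : orient (p i) (p j) (y δ) = -δ * orient (p i) (p j) (p k) := by
    simp [hy, hm, orient]; ring
  rw [e] at h3
  refine lt_of_le_of_ne ?_ (mul_ne_zero ho hol)
  by_contra hcon
  push Not at hcon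
  nlinarith [mul_pos hδ hcon]

end IsTriangulation

/-! ### Incidence signs and the boundary of a triangulation -/

/-- The incidence number of the positively oriented triangle `t` and its oriented edge `(i, j)`. -/
noncomputable def edgeSign (p : Polygon Plane (n + 3)) (t : Finset (Fin (n + 3)))
    (i j : Fin (n + 3)) : ℝ :=
  if i ∈ t ∧ j ∈ t then Real.sign (∑ k ∈ t, orient (p i) (p j) (p k)) else 0

/-- The circulation of the cochain `X` around the positively oriented triangle `t`. -/
noncomputable def circulation (p : Polygon Plane (n + 3)) (t : Finset (Fin (n + 3)))
    (X : Fin (n + 3) → Fin (n + 3) → ℝ) : ℝ :=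
  1 / 2 * ∑ i, ∑ j, edgeSign p t i j * X i j

lemma edgeSign_of_notMem_left {t : Finset (Fin (n + 3))} {i j : Fin (n + 3)} (h : i ∉ t) :
    edgeSign p t i j = 0 := if_neg fun h' => h h'.1

lemma edgeSign_of_notMem_right {t : Finset (Fin (n + 3))} {i j : Fin (n + 3)} (h : j ∉ t) :
    edgeSign p t i j = 0 := if_neg fun h' => h h'.2

lemma edgeSign_self (t : Finset (Fin (n + 3))) (i : Fin (n + 3)) : edgeSign p t i i = 0 := by
  simp [edgeSign]

lemma edgeSign_swap (t : Finset (Fin (n + 3))) (i j : Fin (n + 3)) :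
    edgeSign p t j i = - edgeSign p t i j := by
  unfold edgeSign
  by_cases h : i ∈ t ∧ j ∈ t
  · rw [if_pos h, if_pos h.symm, ← Real.sign_neg, ← Finset.sum_neg_distrib]
    congr 1
    exact Finset.sum_congr rfl fun k _ => orient_swap _ _ _
  · rw [if_neg h, if_neg fun h' => h h'.symm, neg_zero]

/-- The summands of the definition with index i and j vanish; the sum only serves to avoid a choice
of the third vertex. -/
lemma edgeSign_eq {t : Finset (Fin (n + 3))} {i j k : Fin (n + 3)} (htt : t = {i, j, k})
    (hij : i ≠ j) (hik : i ≠ k) (hjk : j ≠ k) :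
    edgeSign p t i j = Real.sign (orient (p i) (p j) (p k)) := by
  rw [edgeSign, if_pos (by simp [htt]), htt, Finset.sum_insert (by simp [hij, hik]),
    Finset.sum_pair hjk]
  simp

lemma sum_sum_edgeSign_mul {t : Finset (Fin (n + 3))} {i j k : Fin (n + 3)} (htt : t = {i, j, k})
    (hij : i ≠ j) (hik : i ≠ k) (hjk : j ≠ k) (X : Fin (n + 3) → Fin (n + 3) → ℝ) :
    ∑ a, ∑ b, edgeSign p t a b * X a b = Real.sign (orient (p i) (p j) (p k)) *
      (X i j - X j i + (X j k - X k j) + (X k i - X i k)) := by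
  have h1 : ∑ a, ∑ b, edgeSign p t a b * X a b = ∑ a ∈ t, ∑ b ∈ t, edgeSign p t a b * X a b := by
    rw [← Finset.sum_subset (Finset.subset_univ t)]
    · refine Finset.sum_congr rfl fun a _ => ?_
      refine (Finset.sum_subset (Finset.subset_univ t) fun b _ hb => ?_).symm
      rw [edgeSign_of_notMem_right hb, zero_mul]
    · intro a _ ha
      exact Finset.sum_eq_zero fun b _ => by rw [edgeSign_of_notMem_left ha, zero_mul]
  have e1 := edgeSign_eq (p := p) htt hij hik hjk
  have e2 := edgeSign_eq (p := p) (t := t) (i := j) (j := k) (k := i)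
    (by rw [htt]; ext; simp; tauto) hjk hij.symm hik.symm
  have e3 := edgeSign_eq (p := p) (t := t) (i := k) (j := i) (k := j)
    (by rw [htt]; ext; simp; tauto) hik.symm hjk.symm hij
  rw [orient_rotate] at e2
  rw [orient_rotate, orient_rotate] at e3
  have e4 := edgeSign_swap (p := p) t i j
  have e5 := edgeSign_swap (p := p) t j k
  have e6 := edgeSign_swap (p := p) t k i
  rw [h1]
  nth_rewrite 1 [htt]
  have h2 : ∀ f : Fin (n + 3) → ℝ, ∑ b ∈ t, f b = f i + (f j + f k) := fun f => by
    rw [htt, Finset.sum_insert (by simp [hij, hik]), Finset.sum_pair hjk]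
  simp only [← htt, h2, edgeSign_self, e4, e5, e6, e1, e2, e3]
  ring

/-- The double sum meets every edge in both orientations, with equal contributions for an
antisymmetric cochain. The factor 1/2 in the definition compensates for this. -/
lemma circulation_eq {t : Finset (Fin (n + 3))} {i j k : Fin (n + 3)} (htt : t = {i, j, k})
    (hij : i ≠ j) (hik : i ≠ k) (hjk : j ≠ k) {X : Fin (n + 3) → Fin (n + 3) → ℝ}
    (hX : ∀ a b, X b a = - X a b) :
    circulation p t X = Real.sign (orient (p i) (p j) (p k)) * (X i j + X j k + X k i) := by
  rw [circulation, sum_sum_edgeSign_mul htt hij hik hjk, hX i j, hX j k, hX k i]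
  ring

/-- This is ∂∂ = 0 at the vertex i: of the two edges of t at i, one arrives and one leaves. -/
lemma sum_edgeSign_eq_zero {t : Finset (Fin (n + 3))} (ht : t.card = 3) (i : Fin (n + 3)) :
    ∑ j, edgeSign p t i j = 0 := by
  by_cases hi : i ∈ t
  · obtain ⟨j, hj, hji⟩ : ∃ j ∈ t, j ≠ i := by
      by_contra hcon
      push Not at hcon
      have : t ⊆ {i} := fun x hx => by simpa using hcon x hx
      have := Finset.card_le_card this
      simp [ht] at this
    obtain ⟨k, hki, hkj, htt⟩ := exists_third ht hi hj hji.symm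
    rw [← Finset.sum_subset (Finset.subset_univ t) fun b _ hb => edgeSign_of_notMem_right hb]
    have h2 : ∀ f : Fin (n + 3) → ℝ, ∑ b ∈ t, f b = f i + (f j + f k) := fun f => by
      rw [htt, Finset.sum_insert (by simp [hji.symm, hki.symm]), Finset.sum_pair hkj.symm]
    rw [h2, edgeSign_self, edgeSign_eq htt hji.symm hki.symm hkj.symm,
      edgeSign_eq (k := j) (by rw [htt]; ext; simp; tauto) hki.symm hji.symm hkj,
      orient_swap_right, Real.sign_neg]
    ring
  · exact Finset.sum_eq_zero fun j _ => edgeSign_of_notMem_left hi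

namespace IsTriangulation

lemma edgeSign_mul_self (hT : IsTriangulation p P T) {t} (ht : t ∈ T) {i j : Fin (n + 3)}
    (hi : i ∈ t) (hj : j ∈ t) (hij : i ≠ j) : edgeSign p t i j * edgeSign p t i j = 1 := by
  obtain ⟨k, hki, hkj, htt⟩ := exists_third (hT.card_eq t ht) hi hj hij
  have hk : k ∈ t := by simp [htt]
  have ho := hT.orient_ne_zero ht hi hj hk hij hki.symm hkj.symm
  rw [edgeSign_eq htt hij hki.symm hkj.symm]
  rcases ho.lt_or_gt with h | h
  · rw [Real.sign_of_neg h]; norm_num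
  · rw [Real.sign_of_pos h]; norm_num

/-- An edge that is not an edge of the polygon belongs to exactly two triangles, which induce
opposite orientations on it. -/
lemma exists_neighbor (hP : IsSimplePolygon p P) (hT : IsTriangulation p P T) {t} (ht : t ∈ T)
    {i j : Fin (n + 3)} (hi : i ∈ t) (hj : j ∈ t) (hij : i ≠ j) (h1 : j ≠ i + 1) (h2 : i ≠ j + 1) :
    ∃ s ∈ T, s ≠ t ∧ i ∈ s ∧ j ∈ s ∧ edgeSign p s i j = - edgeSign p t i j ∧
      ∀ q ∈ T, i ∈ q → j ∈ q → q = t ∨ q = s := by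
  obtain ⟨k, hki, hkj, htt⟩ := exists_third (hT.card_eq t ht) hi hj hij
  obtain ⟨s, hs, l, hli, hlj, hss, hneg⟩ :=
    hT.exists_opposite hP ht htt hij hki.symm hkj.symm h1 h2
  have e1 := edgeSign_eq (p := p) htt hij hki.symm hkj.symm
  have e2 := edgeSign_eq (p := p) hss hij hli.symm hlj.symm
  have e3 : edgeSign p s i j = - edgeSign p t i j := by
    rw [e1, e2]
    rcases mul_neg_iff.1 hneg with ⟨g1, g2⟩ | ⟨g1, g2⟩
    · rw [Real.sign_of_pos g1, Real.sign_of_neg g2]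
    · rw [Real.sign_of_neg g1, Real.sign_of_pos g2, neg_neg]
  refine ⟨s, hs, ?_, by simp [hss], by simp [hss], e3, ?_⟩
  · rintro rfl
    have := hT.edgeSign_mul_self ht hi hj hij
    nlinarith
  · intro q hq hiq hjq
    obtain ⟨m, hmi, hmj, hqq⟩ := exists_third (hT.card_eq q hq) hiq hjq hij
    have hm : m ∈ q := by simp [hqq]
    have ho := hT.orient_ne_zero hq hiq hjq hm hij hmi.symm hmj.symm
    rcases ho.lt_or_gt with h | h
    · rcases mul_neg_iff.1 hneg with ⟨g1, g2⟩ | ⟨g1, g2⟩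
      · exact Or.inr (hT.eq_of_same_side hq hs hqq hss (mul_pos_of_neg_of_neg h g2))
      · exact Or.inl (hT.eq_of_same_side hq ht hqq htt (mul_pos_of_neg_of_neg h g1))
    · rcases mul_neg_iff.1 hneg with ⟨g1, g2⟩ | ⟨g1, g2⟩
      · exact Or.inl (hT.eq_of_same_side hq ht hqq htt (mul_pos h g1))
      · exact Or.inr (hT.eq_of_same_side hq hs hqq hss (mul_pos h g2))

lemma sum_edgeSign_interior (hP : IsSimplePolygon p P) (hT : IsTriangulation p P T)
    {i j : Fin (n + 3)} (h1 : j ≠ i + 1) (h2 : i ≠ j + 1) : ∑ t ∈ T, edgeSign p t i j = 0 := by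
  rcases eq_or_ne i j with rfl | hij
  · exact Finset.sum_eq_zero fun t _ => edgeSign_self t i
  by_cases hex : ∃ t ∈ T, i ∈ t ∧ j ∈ t
  · obtain ⟨t, ht, hi, hj⟩ := hex
    obtain ⟨s, hs, hst, -, -, hsgn, huniq⟩ := hT.exists_neighbor hP ht hi hj hij h1 h2
    rw [Finset.sum_eq_add t s hst.symm]
    · rw [hsgn]; ring
    · rintro q hq ⟨hqt, hqs⟩
      by_contra h
      have : i ∈ q ∧ j ∈ q := by
        by_contra h'
        exact h (if_neg h')
      rcases huniq q hq this.1 this.2 with h3 | h3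
      · exact hqt h3
      · exact hqs h3
    · exact fun h => absurd ht h
    · exact fun h => absurd hs h
  · push Not at hex
    refine Finset.sum_eq_zero fun t ht => if_neg ?_
    rintro ⟨h3, h4⟩
    exact hex t ht h3 h4

lemma sum_edgeSign_boundary (hP : IsSimplePolygon p P) (hT : IsTriangulation p P T)
    {i : Fin (n + 3)} {t} (ht : t ∈ T) (hi : i ∈ t) (hj : i + 1 ∈ t) :
    ∑ s ∈ T, edgeSign p s i (i + 1) = edgeSign p t i (i + 1) := by
  refine Finset.sum_eq_single_of_mem t ht fun s hs hst => ?_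
  by_contra h
  have : i ∈ s ∧ i + 1 ∈ s := by
    by_contra h'
    exact h (if_neg h')
  exact hst (hT.eq_of_boundary_edge hP hs ht this.1 this.2 hi hj)

/-- The boundary edges are consistently oriented. -/
lemma sum_edgeSign_boundary_eq (hP : IsSimplePolygon p P) (hT : IsTriangulation p P T)
    (i : Fin (n + 3)) :
    ∑ t ∈ T, edgeSign p t i (i + 1) = ∑ t ∈ T, edgeSign p t 0 (0 + 1) := by
  have step : ∀ i : Fin (n + 3), ∑ t ∈ T, edgeSign p t (i + 1) (i + 1 + 1)
      = ∑ t ∈ T, edgeSign p t i (i + 1) := by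
    intro i
    -- In the sum over all edges at the vertex i + 1 and all triangles, interior edges cancel. Only
    -- the two boundary edges at this vertex remain, so their signs agree.
    have h0 : ∑ j, ∑ t ∈ T, edgeSign p t (i + 1) j = 0 := by
      rw [Finset.sum_comm]
      exact Finset.sum_eq_zero fun t ht => sum_edgeSign_eq_zero (hT.card_eq t ht) _
    rw [Fintype.sum_eq_add (i + 1 + 1) i (fin_succ_succ_ne i)] at h0
    · have h1 : ∑ t ∈ T, edgeSign p t (i + 1) i = - ∑ t ∈ T, edgeSign p t i (i + 1) := by
        rw [← Finset.sum_neg_distrib]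
        exact Finset.sum_congr rfl fun t _ => edgeSign_swap t i (i + 1)
      rw [h1] at h0
      linarith
    · rintro j ⟨hj1, hj2⟩
      exact hT.sum_edgeSign_interior hP hj1 fun h => hj2 (add_right_cancel h).symm
  induction i using Fin.induction with
  | zero => rfl
  | succ i ih => rw [← Fin.coeSucc_eq_succ, step, ih]

/-- The number ε = ±1 records whether the vertices run counterclockwise (ε = 1) or clockwise around
P. -/
lemma exists_orientation (hP : IsSimplePolygon p P) (hT : IsTriangulation p P T) : ∃ ε : ℝ, ε * ε = 1 ∧
    ∀ i, ∑ t ∈ T, edgeSign p t i (i + 1) = ε := by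
  obtain ⟨t, ht, hi, hj⟩ := hT.exists_boundary_triangle hP 0
  refine ⟨edgeSign p t 0 (0 + 1), hT.edgeSign_mul_self ht hi hj (fin_succ_ne 0).symm, fun i => ?_⟩
  rw [hT.sum_edgeSign_boundary_eq hP, hT.sum_edgeSign_boundary hP ht hi hj]

/-- Summation over all oriented edges of all triangles leaves only the boundary edges. -/
lemma sum_circulation (hP : IsSimplePolygon p P) (hT : IsTriangulation p P T) {ε : ℝ}
    (hε : ∀ i, ∑ t ∈ T, edgeSign p t i (i + 1) = ε) (X : Fin (n + 3) → Fin (n + 3) → ℝ) :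
    ∑ t ∈ T, circulation p t X = ε / 2 * ∑ i, (X i (i + 1) - X (i + 1) i) := by
  have h1 : ∑ t ∈ T, circulation p t X
      = 1 / 2 * ∑ i, ∑ j, (∑ t ∈ T, edgeSign p t i j) * X i j := by
    simp only [circulation]
    rw [← Finset.mul_sum, Finset.sum_comm]
    congr 1
    refine Finset.sum_congr rfl fun i _ => ?_
    rw [Finset.sum_comm]
    exact Finset.sum_congr rfl fun j _ => (Finset.sum_mul _ _ _).symm
  have h2 : ∀ i : Fin (n + 3), ∑ j, (∑ t ∈ T, edgeSign p t i j) * X i j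
      = ε * X i (i + 1) - ε * X i (i - 1) := by
    intro i
    have hne : i + 1 ≠ i - 1 := fun h => fin_succ_succ_ne (i - 1) (by
      rw [sub_add_cancel, h])
    rw [Fintype.sum_eq_add (i + 1) (i - 1) hne, hε]
    · have h3 : ∑ t ∈ T, edgeSign p t i (i - 1) = - ε := by
        rw [← hε (i - 1), ← Finset.sum_neg_distrib, sub_add_cancel]
        exact Finset.sum_congr rfl fun t _ => edgeSign_swap t (i - 1) i
      rw [h3]; ring
    · rintro j ⟨hj1, hj2⟩
      rw [hT.sum_edgeSign_interior hP hj1 fun h => hj2 (eq_sub_of_add_eq h.symm), zero_mul]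
  rw [h1]
  simp only [h2]
  rw [Finset.sum_sub_distrib, Finset.sum_sub_distrib, ← Finset.mul_sum, ← Finset.mul_sum]
  have h4 : ∑ i : Fin (n + 3), X i (i - 1) = ∑ i : Fin (n + 3), X (i + 1) i := by
    rw [← Equiv.sum_comp (Equiv.addRight (1 : Fin (n + 3)))]
    simp
  rw [h4]
  ring

/-! ### A bound for relative cochains -/

/-- The elementary cochain of the oriented edge `(k, l)`. -/
def unitCochain (k l a b : Fin (n + 3)) : ℝ :=
  (if a = k ∧ b = l then 1 else 0) - (if a = l ∧ b = k then 1 else 0)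

lemma unitCochain_swap (k l a b : Fin (n + 3)) : unitCochain k l b a = - unitCochain k l a b := by
  unfold unitCochain
  simp only [and_comm (a := b = k), and_comm (a := b = l)]; ring

lemma circulation_unitCochain (t : Finset (Fin (n + 3))) (k l : Fin (n + 3)) :
    circulation p t (unitCochain k l) = edgeSign p t k l := by
  have h1 : ∀ k l : Fin (n + 3), ∑ a, ∑ b, edgeSign p t a b * (if a = k ∧ b = l then 1 else 0)
      = edgeSign p t k l := by
    intro k l
    rw [Fintype.sum_eq_single k, Fintype.sum_eq_single l]
    · simp
    · intro b hb; simp [hb]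
    · intro a ha; simp [ha]
  simp only [circulation, unitCochain, mul_sub, Finset.sum_sub_distrib, h1, edgeSign_swap t k l]
  ring

lemma circulation_add_smul (t : Finset (Fin (n + 3))) (X Y : Fin (n + 3) → Fin (n + 3) → ℝ)
    (r : ℝ) : circulation p t (fun a b => X a b + r * Y a b)
      = circulation p t X + r * circulation p t Y := by
  simp only [circulation, mul_add, Finset.sum_add_distrib]
  have : ∑ i, ∑ j, edgeSign p t i j * (r * Y i j) = r * ∑ i, ∑ j, edgeSign p t i j * Y i j := by
    rw [Finset.mul_sum]
    refine Finset.sum_congr rfl fun i _ => ?_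
    rw [Finset.mul_sum]
    exact Finset.sum_congr rfl fun j _ => by ring
  rw [this]; ring

open Classical in
/-- If a cochain that vanishes on the boundary is determined by its circulations, then it is
bounded by the sum of their absolute values. -/
lemma abs_le_sum_circulation (hP : IsSimplePolygon p P) (hT : IsTriangulation p P T)
    (huniq : ∀ X : Fin (n + 3) → Fin (n + 3) → ℝ, (∀ a b, X b a = - X a b) →
      (∀ a, X a (a + 1) = 0) → (∀ t ∈ T, circulation p t X = 0) →
      ∀ t ∈ T, ∀ i ∈ t, ∀ j ∈ t, X i j = 0)
    {d : Fin (n + 3) → Fin (n + 3) → ℝ} (hd : ∀ a b, d b a = - d a b)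
    (hd0 : ∀ a, d a (a + 1) = 0) {t} (ht : t ∈ T) {i j : Fin (n + 3)} (hi : i ∈ t) (hj : j ∈ t) :
    |d i j| ≤ ∑ q ∈ T, |circulation p q d| := by
  have hnn : 0 ≤ ∑ q ∈ T, |circulation p q d| := Finset.sum_nonneg fun q _ => abs_nonneg _
  rcases eq_or_ne i j with rfl | hij
  · have : d i i = 0 := by linarith [hd i i]
    rwa [this, abs_zero]
  rcases eq_or_ne j (i + 1) with rfl | h1
  · rwa [hd0, abs_zero]
  rcases eq_or_ne i (j + 1) with rfl | h2
  · rwa [hd, hd0, neg_zero, abs_zero]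
  obtain ⟨s, hs, hst, his, hjs, hsgn, hts⟩ := hT.exists_neighbor hP ht hi hj hij h1 h2
  set σ := edgeSign p t i j with hσ
  have hσ1 : σ * σ = 1 := hT.edgeSign_mul_self ht hi hj hij
  have hsign : ∀ q ∈ T, ∀ {a b t s : _}, (∀ q ∈ T, a ∈ q → b ∈ q → q = t ∨ q = s) → s ≠ t →
      edgeSign p s a b = - edgeSign p t a b →
      edgeSign p q a b = edgeSign p t a b * ((if q = t then 1 else 0) - (if q = s then 1 else 0)) := by
    intro q hq a b t s h hst hsg
    by_cases hqt : q = t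
    · subst hqt; simp [hst.symm]
    by_cases hqs : q = s
    · subst hqs; simp [hst, hsg]
    · rw [if_neg hqt, if_neg hqs, edgeSign, if_neg]
      · ring
      · rintro ⟨ha, hb⟩
        rcases h q hq ha hb with h' | h'
        · exact hqt h'
        · exact hqs h'
  -- The good triangles form the side of t after the triangulation is cut along the edge (i, j).
  -- Instead of a path of triangles from t to t', the definition asks for its algebraic trace: a
  -- cochain, zero on the boundary and on (i, j), that moves one unit of circulation from t to t'.
  let good : Finset (Fin (n + 3)) → Prop := fun t' =>
    ∃ X : Fin (n + 3) → Fin (n + 3) → ℝ, (∀ a b, X b a = - X a b) ∧ (∀ a, X a (a + 1) = 0) ∧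
      X i j = 0 ∧ ∀ q ∈ T, circulation p q X
        = (if q = t' then 1 else 0) - (if q = t then 1 else 0)
  have good_t : good t := ⟨fun _ _ => 0, by simp, by simp, rfl, fun q _ => by simp [circulation]⟩
  -- If the neighbour s across (i, j) were good, a unit cochain on (i, j) could carry the
  -- circulation back. The result would have no circulation at all but the value σ = ±1 on (i, j),
  -- against `huniq`.
  have not_good_s : ¬ good s := by
    rintro ⟨X, hX1, hX2, hX3, hX4⟩
    have h := huniq (fun a b => X a b + σ * unitCochain i j a b) ?_ ?_ ?_ t ht i hi j hj
    · simp only [hX3, unitCochain, and_self, if_true, hij, false_and, if_false] at h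
      have : σ = 0 := by linarith
      rw [this] at hσ1; simp at hσ1
    · intro a b
      rw [hX1, unitCochain_swap]; ring
    · intro a
      have e1 : ¬ (a = i ∧ a + 1 = j) := by rintro ⟨rfl, h⟩; exact h1 h.symm
      have e2 : ¬ (a = j ∧ a + 1 = i) := by rintro ⟨rfl, h⟩; exact h2 h.symm
      simp [hX2, unitCochain, e1, e2]
    · intro q hq
      rw [circulation_add_smul, hX4 q hq, circulation_unitCochain, hsign q hq hts hst hsgn, ← hσ]
      linear_combination ((if q = t then 1 else 0) - (if q = s then 1 else 0) : ℝ) * hσ1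
  -- Across an edge (k, l) other than (i, j) a multiple of its unit cochain moves the unit of
  -- circulation on to the neighbour.
  have good_closed : ∀ t' ∈ T, ∀ k ∈ t', ∀ l ∈ t', k ≠ l → l ≠ k + 1 → k ≠ l + 1 →
      ¬ (k = i ∧ l = j) → ¬ (k = j ∧ l = i) → ∀ s' ∈ T, k ∈ s' → l ∈ s' → good t' → good s' := by
    rintro t' ht' k hk l hl hkl g1 g2 g3 g4 s' hs' hks hls ⟨X, hX1, hX2, hX3, hX4⟩
    obtain ⟨s'', hs'', hst', hks'', hls'', hsgn', hts'⟩ :=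
      hT.exists_neighbor hP ht' hk hl hkl g1 g2
    rcases hts' s' hs' hks hls with rfl | rfl
    · exact ⟨X, hX1, hX2, hX3, hX4⟩
    have hτ := hT.edgeSign_mul_self ht' hk hl hkl
    set τ := edgeSign p t' k l with hτd
    refine ⟨fun a b => X a b + (-τ) * unitCochain k l a b, ?_, ?_, ?_, ?_⟩
    · intro a b
      beta_reduce
      rw [hX1, unitCochain_swap]; ring
    · intro a
      have e1 : ¬ (a = k ∧ a + 1 = l) := by rintro ⟨rfl, h⟩; exact g1 h.symm
      have e2 : ¬ (a = l ∧ a + 1 = k) := by rintro ⟨rfl, h⟩; exact g2 h.symm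
      simp [hX2, unitCochain, e1, e2]
    · have e1 : ¬ (i = k ∧ j = l) := by rintro ⟨rfl, rfl⟩; exact g3 ⟨rfl, rfl⟩
      have e2 : ¬ (i = l ∧ j = k) := by rintro ⟨rfl, rfl⟩; exact g4 ⟨rfl, rfl⟩
      simp [hX3, unitCochain, e1, e2]
    · intro q hq
      rw [circulation_add_smul, hX4 q hq, circulation_unitCochain, hsign q hq hts' hst' hsgn',
        ← hτd]
      linear_combination (-(if q = t' then 1 else 0) + (if q = s' then 1 else 0) : ℝ) * hτ
  -- Summation over the good triangles: an interior edge other than (i, j) has both of its triangles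
  -- or none of them in the sum and cancels, and d is zero on boundary edges. On (i, j) only t
  -- contributes, because s is not good.
  have hsum : ∑ q ∈ T.filter good, circulation p q d = σ * d i j := by
    have e1 : ∑ q ∈ T.filter good, circulation p q d
        = 1 / 2 * ∑ a, ∑ b, (∑ q ∈ T.filter good, edgeSign p q a b) * d a b := by
      simp only [circulation]
      rw [← Finset.mul_sum, Finset.sum_comm]
      congr 1
      refine Finset.sum_congr rfl fun i _ => ?_
      rw [Finset.sum_comm]
      exact Finset.sum_congr rfl fun j _ => (Finset.sum_mul _ _ _).symm
    have e0 : ∑ q ∈ T.filter good, edgeSign p q i j = σ := by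
      rw [hσ]
      refine Finset.sum_eq_single_of_mem t (Finset.mem_filter.2 ⟨ht, good_t⟩) fun q hq hqt => ?_
      obtain ⟨hqT, hqg⟩ := Finset.mem_filter.1 hq
      refine if_neg fun h => ?_
      rcases hts q hqT h.1 h.2 with rfl | rfl
      · exact hqt rfl
      · exact not_good_s hqg
    have e2 : ∀ a b, (∑ q ∈ T.filter good, edgeSign p q a b) * d a b
        = σ * d i j * ((if a = i ∧ b = j then 1 else 0) + (if a = j ∧ b = i then 1 else 0)) := by
      intro a b
      by_cases c1 : a = i ∧ b = j
      · obtain ⟨rfl, rfl⟩ := c1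
        rw [e0]; simp [hij]
      by_cases c2 : a = j ∧ b = i
      · obtain ⟨rfl, rfl⟩ := c2
        have : ∑ q ∈ T.filter good, edgeSign p q a b = - σ := by
          rw [← e0, ← Finset.sum_neg_distrib]
          exact Finset.sum_congr rfl fun q _ => edgeSign_swap q b a
        rw [this, hd b a]; simp [hij.symm]
      rw [if_neg c1, if_neg c2]
      rcases eq_or_ne b (a + 1) with rfl | h3
      · rw [hd0]; simp
      rcases eq_or_ne a (b + 1) with rfl | h4
      · rw [hd, hd0]; simp
      have : ∑ q ∈ T.filter good, edgeSign p q a b = 0 := by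
        rcases eq_or_ne a b with rfl | hab
        · exact Finset.sum_eq_zero fun t _ => edgeSign_self t a
        by_cases hex : ∃ q ∈ T, good q ∧ a ∈ q ∧ b ∈ q
        · obtain ⟨q, hq, hqg, haq, hbq⟩ := hex
          obtain ⟨r, hr, hrq, har, hbr, hrs, hqr⟩ := hT.exists_neighbor hP hq haq hbq hab h3 h4
          have hrg : good r := good_closed q hq a haq b hbq hab h3 h4 c1 c2 r hr har hbr hqg
          rw [Finset.sum_eq_add q r hrq.symm]
          · rw [hrs]; ring
          · rintro u hu ⟨huq, hur⟩
            refine if_neg fun h => ?_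
            rcases hqr u (Finset.mem_filter.1 hu).1 h.1 h.2 with h' | h'
            · exact huq h'
            · exact hur h'
          · exact fun h => absurd (Finset.mem_filter.2 ⟨hq, hqg⟩) h
          · exact fun h => absurd (Finset.mem_filter.2 ⟨hr, hrg⟩) h
        · push Not at hex
          refine Finset.sum_eq_zero fun q hq => if_neg ?_
          rintro ⟨g1, g2⟩
          exact hex q (Finset.mem_filter.1 hq).1 (Finset.mem_filter.1 hq).2 g1 g2
      rw [this]; simp
    have e3 : ∀ k l : Fin (n + 3), ∑ a, ∑ b, σ * d i j * (if a = k ∧ b = l then (1 : ℝ) else 0)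
        = σ * d i j := by
      intro k l
      rw [Fintype.sum_eq_single k, Fintype.sum_eq_single l]
      · simp
      · intro b hb; simp [hb]
      · intro a ha; simp [ha]
    rw [e1]
    simp only [e2, mul_add, Finset.sum_add_distrib, e3]
    ring
  have hσabs : |σ| = 1 := by
    have := abs_mul_abs_self σ
    rw [hσ1] at this
    nlinarith [abs_nonneg σ]
  calc |d i j| = |σ * d i j| := by rw [abs_mul, hσabs, one_mul]
    _ = |∑ q ∈ T.filter good, circulation p q d| := by rw [hsum]
    _ ≤ ∑ q ∈ T.filter good, |circulation p q d| := Finset.abs_sum_le_sum_abs _ _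
    _ ≤ ∑ q ∈ T, |circulation p q d| :=
      Finset.sum_le_sum_of_subset_of_nonneg (Finset.filter_subset _ _) fun q _ _ => abs_nonneg _

end IsTriangulation

/-! ### Lowest order Nédélec fields -/

lemma measurableSet_cell (t : Finset (Fin (n + 3))) : MeasurableSet (cell p t) :=
  (isCompact_cell t).isClosed.measurableSet

lemma volume_segment (a b : Plane) : volume (segment ℝ a b) = 0 := by
  obtain ⟨c, hc⟩ : ∃ c : Plane, c ∉ line[ℝ, a, b] := by
    by_contra hcon
    push Not at hcon
    have h : ∀ c, orient a b c = 0 := fun c => by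
      obtain ⟨r, rfl⟩ := mem_affineSpan_pair_iff_exists_lineMap_eq.1 (hcon c)
      simp [AffineMap.lineMap_apply, orient]; ring
    have h2 : ∀ c : Plane, ∃ r : ℝ, AffineMap.lineMap a b r = c := fun c =>
      mem_affineSpan_pair_iff_exists_lineMap_eq.1 (hcon c)
    have hab : a = b := by
      have e0 := h (a + !₂[1, 0])
      have e1 := h (a + !₂[0, 1])
      simp [orient] at e0 e1
      ext i; fin_cases i
      · simp; linarith
      · simp; linarith
    subst hab
    obtain ⟨r, hr⟩ := h2 (a + !₂[1, 0])
    have := congrArg (fun v : Plane => v 0) hr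
    simp at this
  refine measure_mono_null ?_ (Measure.addHaar_affineSubspace volume (line[ℝ, a, b]) ?_)
  · rw [← convexHull_pair]
    exact convexHull_subset_affineSpan _
  · rintro h
    rw [h] at hc
    exact hc (AffineSubspace.mem_top ℝ Plane c)

namespace IsTriangulation

lemma volume_inter_eq_zero (hT : IsTriangulation p P T) {s t} (hs : s ∈ T) (ht : t ∈ T)
    (hst : s ≠ t) : volume (cell p s ∩ cell p t) = 0 := by
  obtain ⟨i, hit, his⟩ : ∃ i ∈ t, i ∉ s := by
    by_contra hcon
    push Not at hcon
    exact hst (Finset.eq_of_subset_of_card_le (fun x hx => hcon x hx)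
      (by rw [hT.card_eq s hs, hT.card_eq t ht])).symm
  obtain ⟨j, hj, hji⟩ : ∃ j ∈ t, j ≠ i := by
    by_contra hcon
    push Not at hcon
    have : t ⊆ {i} := fun x hx => by simpa using hcon x hx
    have := Finset.card_le_card this
    simp [hT.card_eq t ht] at this
  obtain ⟨k, -, -, htt⟩ := exists_third (hT.card_eq t ht) hit hj hji.symm
  rw [hT.inter_eq s hs t ht]
  refine measure_mono_null ?_ (volume_segment (p j) (p k))
  rw [← convexHull_pair]
  refine convexHull_mono ?_
  rintro _ ⟨l, hl, rfl⟩
  simp [htt] at hl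
  rcases hl.2 with rfl | rfl | rfl
  · exact absurd hl.1 his
  · simp
  · simp

lemma ae_eq_of_mem_cell (hT : IsTriangulation p P T) :
    ∀ᵐ x : Plane, ∀ s ∈ T, ∀ t ∈ T, x ∈ cell p s → x ∈ cell p t → s = t := by
  have h : ∀ s t : Finset (Fin (n + 3)), ∀ᵐ x : Plane,
      s ∈ T → t ∈ T → x ∈ cell p s → x ∈ cell p t → s = t := by
    intro s t
    by_cases hst : s ∈ T ∧ t ∈ T ∧ s ≠ t
    · have h0 := hT.volume_inter_eq_zero hst.1 hst.2.1 hst.2.2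
      filter_upwards [measure_eq_zero_iff_ae_notMem.1 h0] with x hx _ _ h1 h2
      exact absurd ⟨h1, h2⟩ hx
    · refine Eventually.of_forall fun x h1 h2 _ _ => ?_
      by_contra hne
      exact hst ⟨h1, h2, hne⟩
  filter_upwards [ae_all_iff.2 fun s => ae_all_iff.2 (h s)] with x hx s hs t ht
  exact hx s t hs ht

lemma integral_eq_sum (hT : IsTriangulation p P T) {f : Plane → ℝ} (hf : IntegrableOn f P) :
    ∫ x in P, f x = ∑ t ∈ T, ∫ x in cell p t, f x := by
  have hPm : MeasurableSet P := by
    rw [← hT.iUnion_eq]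
    exact Finset.measurableSet_biUnion _ fun t _ => measurableSet_cell t
  have h : P.indicator f =ᵐ[volume] fun x => ∑ t ∈ T, (cell p t).indicator f x := by
    filter_upwards [hT.ae_eq_of_mem_cell] with x hx
    by_cases hxP : x ∈ P
    · obtain ⟨q, hq, hxq⟩ := hT.exists_mem_cell hxP
      rw [Finset.sum_eq_single_of_mem q hq, Set.indicator_of_mem hxP, Set.indicator_of_mem hxq]
      exact fun r hr hrq => Set.indicator_of_notMem (fun hxr => hrq (hx r hr q hq hxr hxq)) _
    · rw [Set.indicator_of_notMem hxP]
      exact (Finset.sum_eq_zero fun q hq => Set.indicator_of_notMem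
        (fun h => hxP (hT.cell_subset hq h)) _).symm
  rw [← integral_indicator hPm, integral_congr_ae h, integral_finsetSum]
  · exact Finset.sum_congr rfl fun t _ => integral_indicator (measurableSet_cell t)
  · exact fun t ht => (integrable_indicator_iff (measurableSet_cell t)).2
      (hf.mono_set (hT.cell_subset ht))

/-- Green's formula on a triangle of the triangulation. -/
lemma integral_curl_cell (hT : IsTriangulation p P T) {t} (ht : t ∈ T) {f₀ f₁ : Plane → ℝ}
    (h₀ : ContDiff ℝ 1 f₀) (h₁ : ContDiff ℝ 1 f₁) :
    ∫ x in cell p t, (pderiv 0 f₁ x - pderiv 1 f₀ x)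
      = circulation p t fun i j => lineInt f₀ f₁ (p i) (p j) := by
  obtain ⟨i, j, k, hij, hik, hjk, htt⟩ := Finset.card_eq_three.1 (hT.card_eq t ht)
  have ho := hT.orient_ne_zero ht (i := i) (j := j) (k := k) (by simp [htt]) (by simp [htt])
    (by simp [htt]) hij hik hjk
  rw [circulation_eq htt hij hik hjk fun a b => lineInt_swap _ _ _ _, ← integral_curl_triangle h₀ h₁ ho,
    htt, cell_triple]

end IsTriangulation

/-- The circulation of the field `a + b (x₂, -x₁)` along the segment from `x` to `y`. -/
def nedDof (a : Plane) (b : ℝ) (x y : Plane) : ℝ :=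
  a 0 * (y 0 - x 0) + a 1 * (y 1 - x 1) + b * (x 1 * y 0 - x 0 * y 1)

lemma nedDof_swap (a : Plane) (b : ℝ) (x y : Plane) : nedDof a b y x = - nedDof a b x y := by
  unfold nedDof; ring

/-- The mean value of `ψ` on the segment from `x` to `y`. -/
noncomputable def segMean (ψ : Plane → ℝ) (x y : Plane) : ℝ :=
  ∫ s in (0 : ℝ)..1, ψ (x + s • (y - x))

lemma segMean_swap (ψ : Plane → ℝ) (x y : Plane) : segMean ψ y x = segMean ψ x y := by
  unfold segMean
  have key := intervalIntegral.integral_comp_sub_left (a := 0) (b := 1)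
    (f := fun s : ℝ => ψ (y + s • (x - y))) 1
  simp only [sub_self, sub_zero] at key
  rw [← key]
  congr 1; ext s
  congr 1; module

/-- The tangential component of the field a + b (x₂, -x₁) is constant along every segment, so the
weight factors out as its mean value. -/
lemma lineInt_ned (ψ : Plane → ℝ) (a : Plane) (b : ℝ) (x y : Plane) :
    lineInt (fun z => ψ z * (b * z 1 + a 0)) (fun z => ψ z * (-b * z 0 + a 1)) x y
      = nedDof a b x y * segMean ψ x y := by
  unfold lineInt segMean
  rw [← intervalIntegral.integral_const_mul]
  congr 1; ext s
  simp [nedDof]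
  ring

lemma circulation_congr {t : Finset (Fin (n + 3))} {X Y : Fin (n + 3) → Fin (n + 3) → ℝ}
    (h : ∀ i ∈ t, ∀ j ∈ t, X i j = Y i j) : circulation p t X = circulation p t Y := by
  unfold circulation
  congr 1
  refine Finset.sum_congr rfl fun i _ => Finset.sum_congr rfl fun j _ => ?_
  by_cases hij : i ∈ t ∧ j ∈ t
  · rw [h i hij.1 j hij.2]
  · rw [edgeSign, if_neg hij, zero_mul, zero_mul]

namespace IsTriangulation

/-- Integration by parts: the field has curl -2b, and by `lineInt_ned` its edge terms form the
circulation of a cochain. After summation over the triangles these terms cancel on every interior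
edge on which the tangential components match. -/
lemma integral_ned_mul (hT : IsTriangulation p P T) {t} (ht : t ∈ T) {ψ : Plane → ℝ}
    (hψ : ContDiff ℝ 1 ψ) (a : Plane) (b : ℝ) :
    ∫ x in cell p t, ((a 0 + b * x 1) * pderiv 1 ψ x - (a 1 - b * x 0) * pderiv 0 ψ x)
      = -2 * b * (∫ x in cell p t, ψ x)
        - circulation p t (fun i j => nedDof a b (p i) (p j) * segMean ψ (p i) (p j)) := by
  have c0 : ContDiff ℝ 1 fun z : Plane => b * z 1 + a 0 := contDiff_affine 1 b (a 0)
  have c1 : ContDiff ℝ 1 fun z : Plane => -b * z 0 + a 1 := contDiff_affine 0 (-b) (a 1)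
  have key := hT.integral_curl_cell ht (hψ.mul c0) (hψ.mul c1)
  have e : ∀ x, pderiv 0 (fun z => ψ z * (-b * z 0 + a 1)) x
      - pderiv 1 (fun z => ψ z * (b * z 1 + a 0)) x
      = -2 * b * ψ x - ((a 0 + b * x 1) * pderiv 1 ψ x - (a 1 - b * x 0) * pderiv 0 ψ x) := by
    intro x
    rw [pderiv_mul hψ c0, pderiv_mul hψ c1, pderiv_affine, pderiv_affine]
    simp; ring
  have hb : Bornology.IsBounded (cell p t) := (isCompact_cell t).isBounded
  have i1 : IntegrableOn (fun x => -2 * b * ψ x) (cell p t) :=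
    integrableOn_of_continuous hb (continuous_const.mul hψ.continuous)
  have i2 : IntegrableOn (fun x : Plane => (a 0 + b * x 1) * pderiv 1 ψ x
      - (a 1 - b * x 0) * pderiv 0 ψ x) (cell p t) := by
    have := pderiv_continuous hψ 0
    have := pderiv_continuous hψ 1
    exact integrableOn_of_continuous hb (by fun_prop)
  simp only [lineInt_ned] at key
  rw [setIntegral_congr_fun (measurableSet_cell t) (fun x _ => e x), integral_sub i1 i2,
    integral_const_mul] at key
  linarith

/-- A cochain with vanishing circulation comes from a constant field on every triangle. -/
lemma exists_nedDof_eq (hT : IsTriangulation p P T) {t} (ht : t ∈ T)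
    {X : Fin (n + 3) → Fin (n + 3) → ℝ} (hX : ∀ a b, X b a = - X a b)
    (hc : circulation p t X = 0) :
    ∃ a : Plane, ∀ i ∈ t, ∀ j ∈ t, nedDof a 0 (p i) (p j) = X i j := by
  obtain ⟨i, j, k, hij, hik, hjk, htt⟩ := Finset.card_eq_three.1 (hT.card_eq t ht)
  have ho := hT.orient_ne_zero ht (i := i) (j := j) (k := k) (by simp [htt]) (by simp [htt])
    (by simp [htt]) hij hik hjk
  rw [circulation_eq htt hij hik hjk hX] at hc
  have hs : Real.sign (orient (p i) (p j) (p k)) ≠ 0 := by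
    rcases ho.lt_or_gt with h | h
    · rw [Real.sign_of_neg h]; norm_num
    · rw [Real.sign_of_pos h]; norm_num
  have hc' : X i j + X j k + X k i = 0 := (mul_eq_zero.1 hc).resolve_left hs
  set o := orient (p i) (p j) (p k) with hod
  have hzero : ∀ a, X a a = 0 := fun a => by linarith [hX a a]
  -- Cramer's rule for a·(p j - p i) = X i j and a·(p k - p i) = X i k. The third edge follows from
  -- the vanishing circulation.
  set a : Plane := !₂[(X i j * (p k 1 - p i 1) - X i k * (p j 1 - p i 1)) / o,
    (X i k * (p j 0 - p i 0) - X i j * (p k 0 - p i 0)) / o] with ha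
  have e1 : nedDof a 0 (p i) (p j) = X i j := by
    simp [nedDof, ha]; field_simp; rw [hod, orient]; ring
  have e2 : nedDof a 0 (p i) (p k) = X i k := by
    simp [nedDof, ha]; field_simp; rw [hod, orient]; ring
  have e3 : nedDof a 0 (p j) (p k) = X j k := by
    have : nedDof a 0 (p j) (p k) = nedDof a 0 (p i) (p k) - nedDof a 0 (p i) (p j) := by
      simp [nedDof]; ring
    rw [this, e1, e2]
    linarith [hX i k]
  have e0 : ∀ x, nedDof a 0 (p x) (p x) = 0 := fun x => by simp [nedDof]
  refine ⟨a, fun x hx y hy => ?_⟩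
  rw [htt] at hx hy
  simp only [Finset.mem_insert, Finset.mem_singleton] at hx hy
  rcases hx with rfl | rfl | rfl <;> rcases hy with rfl | rfl | rfl <;>
    first
    | rw [e0, hzero]
    | assumption
    | (rw [nedDof_swap, hX]; congr 1)

/-! ### Uniqueness of cochains with vanishing circulations -/

/-- The `m`-th component of the piecewise constant field with values `a t`, extended by zero. -/
noncomputable def pieceConst (p : Polygon Plane (n + 3)) (T : Finset (Finset (Fin (n + 3))))
    (a : Finset (Fin (n + 3)) → Plane) (m : Fin 2) (x : Plane) : ℝ :=
  ∑ t ∈ T, (cell p t).indicator (fun _ => a t m) x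

lemma measurable_pieceConst (a : Finset (Fin (n + 3)) → Plane) (m : Fin 2) :
    Measurable (pieceConst p T a m) :=
  Finset.measurable_sum _ fun t _ => measurable_const.indicator (measurableSet_cell t)

lemma memLp_pieceConst (a : Finset (Fin (n + 3)) → Plane) (m : Fin 2) :
    MemLp (pieceConst p T a m) 2 volume :=
  memLp_finsetSum _ fun t _ => memLp_indicator_const 2 (measurableSet_cell t) _
    (Or.inr (isCompact_cell t).measure_lt_top.ne)

lemma abs_pieceConst_le (a : Finset (Fin (n + 3)) → Plane) (m : Fin 2) (x : Plane) :
    |pieceConst p T a m x| ≤ ∑ t ∈ T, |a t m| := by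
  refine (Finset.abs_sum_le_sum_abs _ _).trans (Finset.sum_le_sum fun t _ => ?_)
  by_cases h : x ∈ cell p t <;> simp [h]

lemma integral_pieceConst_mul (a : Finset (Fin (n + 3)) → Plane) {ψ₀ ψ₁ : Plane → ℝ}
    (h₀ : Continuous ψ₀) (h₁ : Continuous ψ₁) :
    ∫ x, (pieceConst p T a 0 x * ψ₁ x - pieceConst p T a 1 x * ψ₀ x)
      = ∑ t ∈ T, ∫ x in cell p t, (a t 0 * ψ₁ x - a t 1 * ψ₀ x) := by
  have e : ∀ x, pieceConst p T a 0 x * ψ₁ x - pieceConst p T a 1 x * ψ₀ x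
      = ∑ t ∈ T, (cell p t).indicator (fun x => a t 0 * ψ₁ x - a t 1 * ψ₀ x) x := by
    intro x
    rw [pieceConst, pieceConst, Finset.sum_mul, Finset.sum_mul, ← Finset.sum_sub_distrib]
    refine Finset.sum_congr rfl fun t _ => ?_
    by_cases h : x ∈ cell p t <;> simp [h]
  simp only [e]
  rw [integral_finsetSum]
  · exact Finset.sum_congr rfl fun t _ => integral_indicator (measurableSet_cell t)
  · intro t _
    refine (integrable_indicator_iff (measurableSet_cell t)).2 ?_
    exact integrableOn_of_continuous (isCompact_cell t).isBounded (by fun_prop)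

/-- The mollified field is curl free if the tangential components match. -/
lemma curl_mollify_pieceConst (hP : IsSimplePolygon p P) (hT : IsTriangulation p P T)
    {X : Fin (n + 3) → Fin (n + 3) → ℝ} (hX : ∀ a b, X b a = - X a b)
    (hX0 : ∀ a, X a (a + 1) = 0) {a : Finset (Fin (n + 3)) → Plane}
    (ha : ∀ t ∈ T, ∀ i ∈ t, ∀ j ∈ t, nedDof (a t) 0 (p i) (p j) = X i j)
    {ρ : Plane → ℝ} (hρ : ContDiff ℝ 1 ρ) (hc : HasCompactSupport ρ) (x : Plane) :
    pderiv 0 (mollify 1 0 ρ (pieceConst p T a 1)) x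
      - pderiv 1 (mollify 1 0 ρ (pieceConst p T a 0)) x = 0 := by
  set ψ : Plane → ℝ := fun z => ρ (x - z) with hψ
  have hψc : ContDiff ℝ 1 ψ := hρ.comp (by fun_prop)
  have hder : ∀ i z, pderiv i ψ z = - pderiv i ρ (x - z) := by
    intro i z
    have h1 : HasFDerivAt (fun z : Plane => x - z) (-(ContinuousLinearMap.id ℝ Plane)) z :=
      (hasFDerivAt_id z).const_sub x
    have h2 := (hρ.differentiable one_ne_zero (x - z)).hasFDerivAt.comp z h1
    have h3 : HasFDerivAt ψ _ z := h2
    rw [pderiv, h3.fderiv]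
    simp [pderiv]
  rw [pderiv_mollify (memLp_pieceConst a 1) (by norm_num) 0 hρ hc,
    pderiv_mollify (memLp_pieceConst a 0) (by norm_num) 0 hρ hc]
  simp only [one_smul, add_zero]
  have hint : ∀ m i, Integrable fun z => pieceConst p T a m z * pderiv i ρ (x - z) := by
    intro m i
    have hd : HasCompactSupport (pderiv i ρ) :=
      hc.mono' (subset_closure.trans (tsupport_pderiv_subset ρ i))
    exact (hd.convolutionExists_right (ContinuousLinearMap.mul ℝ ℝ)
      ((memLp_pieceConst a m).locallyIntegrable (by norm_num)) (pderiv_continuous hρ i) x)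
  rw [← integral_sub (hint 1 0) (hint 0 1)]
  have e1 : ∀ z, pieceConst p T a 1 z * pderiv 0 ρ (x - z) - pieceConst p T a 0 z * pderiv 1 ρ (x - z)
      = pieceConst p T a 0 z * pderiv 1 ψ z - pieceConst p T a 1 z * pderiv 0 ψ z := fun z => by
    rw [hder, hder]; ring
  simp only [e1]
  rw [integral_pieceConst_mul a (pderiv_continuous hψc 0) (pderiv_continuous hψc 1)]
  have e2 : ∀ t ∈ T, ∫ x in cell p t, (a t 0 * pderiv 1 ψ x - a t 1 * pderiv 0 ψ x)
      = - circulation p t (fun i j => X i j * segMean ψ (p i) (p j)) := by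
    intro t ht
    have := hT.integral_ned_mul ht hψc (a t) 0
    simp only [zero_mul, add_zero, sub_zero, mul_zero, zero_sub] at this
    rw [this]
    congr 1
    exact circulation_congr fun i hi j hj => by rw [ha t ht i hi j hj]
  -- Interior edges cancel because X does not depend on the triangle. The kernel ψ need not vanish
  -- on the boundary of P; there it is X that vanishes. Hence the extension by zero is curl free
  -- across the boundary too.
  rw [Finset.sum_congr rfl e2, Finset.sum_neg_distrib]
  obtain ⟨ε, -, hε⟩ := hT.exists_orientation hP
  rw [hT.sum_circulation hP hε]
  simp [hX _ (_ + 1), hX0]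

/-- Every triangle that meets a small ball around an inner point of an edge has this edge, so the
tangential component there is X i j. Points outside P occur in the ball only at a boundary edge,
where both the field and X i j are zero. -/
lemma eventually_pieceConst_eq (hP : IsSimplePolygon p P) (hT : IsTriangulation p P T)
    {X : Fin (n + 3) → Fin (n + 3) → ℝ} (hX : ∀ a b, X b a = - X a b)
    (hX0 : ∀ a, X a (a + 1) = 0) {a : Finset (Fin (n + 3)) → Plane}
    (ha : ∀ t ∈ T, ∀ i ∈ t, ∀ j ∈ t, nedDof (a t) 0 (p i) (p j) = X i j)
    {t} (ht : t ∈ T) {i j : Fin (n + 3)} (hi : i ∈ t) (hj : j ∈ t) (hij : i ≠ j)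
    {s : ℝ} (hs0 : 0 < s) (hs1 : s < 1) :
    ∃ δ > 0, ∀ᵐ z : Plane, ‖z - (p i + s • (p j - p i))‖ < δ →
      pieceConst p T a 0 z * (p j 0 - p i 0) + pieceConst p T a 1 z * (p j 1 - p i 1) = X i j := by
  set x := p i + s • (p j - p i) with hx
  have h1 : ∀ᶠ z in 𝓝 x, ∀ q ∈ T, z ∈ cell p q → x ∈ cell p q := by
    refine (Filter.eventually_all_finset T).2 fun q _ => ?_
    by_cases hxq : x ∈ cell p q
    · exact Eventually.of_forall fun _ _ => hxq
    · filter_upwards [(isCompact_cell q).isClosed.isOpen_compl.mem_nhds hxq] with z hz hz'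
      exact absurd hz' hz
  have h2 : ∀ᶠ z in 𝓝 x, z ∉ P → X i j = 0 := by
    rcases eq_or_ne j (i + 1) with rfl | g1
    · exact Eventually.of_forall fun _ _ => hX0 i
    rcases eq_or_ne i (j + 1) with rfl | g2
    · exact Eventually.of_forall fun _ _ => by rw [hX, hX0, neg_zero]
    filter_upwards [mem_interior_iff_mem_nhds.1
      (hT.interior_edge_subset hP ht hi hj hij g1 g2 hs0 hs1)] with z hz hz'
    exact absurd hz hz'
  obtain ⟨δ, hδ, hball⟩ := Metric.eventually_nhds_iff.1 (h1.and h2)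
  refine ⟨δ, hδ, ?_⟩
  filter_upwards [hT.ae_eq_of_mem_cell] with z hz hzδ
  obtain ⟨k1, k2⟩ := hball (by rwa [dist_eq_norm])
  by_cases hzP : z ∈ P
  · obtain ⟨q, hq, hzq⟩ := hT.exists_mem_cell hzP
    have hw : ∀ m, pieceConst p T a m z = a q m := fun m => by
      rw [pieceConst, Finset.sum_eq_single_of_mem q hq]
      · simp [hzq]
      · intro r hr hrq
        refine Set.indicator_of_notMem (fun hzr => hrq (hz r hr q hq hzr hzq)) _
    obtain ⟨g1, g2⟩ := hT.edge_mem hq ht hi hj hij hs0 hs1 (k1 q hq hzq)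
    rw [hw, hw, ← ha q hq i g1 j g2]
    simp [nedDof]
  · have hw : ∀ m, pieceConst p T a m z = 0 := fun m =>
      Finset.sum_eq_zero fun q hq => Set.indicator_of_notMem
        (fun h => hzP (hT.cell_subset hq h)) _
    rw [hw, hw, k2 hzP]
    simp

/-- A mollifier with support in the ball of radius `1 / (k + 1)`. -/
noncomputable def stdBump (k : ℕ) : ContDiffBump (0 : Plane) :=
  ⟨1 / (k + 1) / 2, 1 / (k + 1), by positivity, by
    have : (0 : ℝ) < 1 / (k + 1) := by positivity
    linarith⟩

/-- Dominated convergence along the edge. At a fixed inner point the mollified tangential component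
is equal to X i j as soon as the kernel is supported in the ball of `eventually_pieceConst_eq`; near
the end points only the uniform bound is available. -/
lemma tendsto_lineInt_mollify (hP : IsSimplePolygon p P) (hT : IsTriangulation p P T)
    {X : Fin (n + 3) → Fin (n + 3) → ℝ} (hX : ∀ a b, X b a = - X a b)
    (hX0 : ∀ a, X a (a + 1) = 0) {a : Finset (Fin (n + 3)) → Plane}
    (ha : ∀ t ∈ T, ∀ i ∈ t, ∀ j ∈ t, nedDof (a t) 0 (p i) (p j) = X i j)
    {t} (ht : t ∈ T) {i j : Fin (n + 3)} (hi : i ∈ t) (hj : j ∈ t) (hij : i ≠ j) :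
    Tendsto (fun k => lineInt (mollify 1 0 ((stdBump k).normed volume) (pieceConst p T a 0))
      (mollify 1 0 ((stdBump k).normed volume) (pieceConst p T a 1)) (p i) (p j)) atTop
      (𝓝 (X i j)) := by
  set ρ : ℕ → Plane → ℝ := fun k => (stdBump k).normed volume with hρ
  have hρ0 : ∀ k y, 0 ≤ ρ k y := fun k y => (stdBump k).nonneg_normed y
  have hρi : ∀ k, Integrable (ρ k) := fun k => (stdBump k).integrable_normed
  have hρ1 : ∀ k, ∫ y, ρ k y = 1 := fun k => (stdBump k).integral_normed
  set C : ℝ := (∑ t ∈ T, |a t 0|) * |p j 0 - p i 0| + (∑ t ∈ T, |a t 1|) * |p j 1 - p i 1|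
  set W : Plane → ℝ := fun z =>
    pieceConst p T a 0 z * (p j 0 - p i 0) + pieceConst p T a 1 z * (p j 1 - p i 1) with hW
  have hWC : ∀ z, |W z| ≤ C := fun z => by
    refine (abs_add_le _ _).trans ?_
    rw [abs_mul, abs_mul]
    exact add_le_add (mul_le_mul_of_nonneg_right (abs_pieceConst_le a 0 z) (abs_nonneg _))
      (mul_le_mul_of_nonneg_right (abs_pieceConst_le a 1 z) (abs_nonneg _))
  have hWm : Measurable W :=
    ((measurable_pieceConst a 0).mul_const _).add ((measurable_pieceConst a 1).mul_const _)
  have hmi : ∀ k x m, Integrable fun y => ρ k y * pieceConst p T a m (x - y) := by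
    intro k x m
    refine (hρi k).mul_bdd (c := ∑ t ∈ T, |a t m|) ?_ ?_
    · exact ((measurable_pieceConst a m).comp (by fun_prop)).aestronglyMeasurable
    · exact Eventually.of_forall fun y => abs_pieceConst_le _ _ _
  have hav : ∀ k x, mollify 1 0 (ρ k) (pieceConst p T a 0) x * (p j 0 - p i 0)
      + mollify 1 0 (ρ k) (pieceConst p T a 1) x * (p j 1 - p i 1) = ∫ y, ρ k y * W (x - y) := by
    intro k x
    rw [mollify_apply', mollify_apply', ← integral_mul_const, ← integral_mul_const]
    simp only [one_smul, add_zero]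
    rw [← integral_add ((hmi k x 0).mul_const _) ((hmi k x 1).mul_const _)]
    congr 1; ext y
    simp only [hW]; ring
  have hlim : X i j = ∫ s in (0 : ℝ)..1, X i j := by simp
  rw [hlim]
  simp only [lineInt]
  have hmc : ∀ k m, Continuous (mollify 1 0 (ρ k) (pieceConst p T a m)) := fun k m =>
    (contDiff_mollify (memLp_pieceConst a m) (by norm_num) 0 (stdBump k).contDiff_normed
      (stdBump k).hasCompactSupport_normed).continuous
  refine intervalIntegral.tendsto_integral_filter_of_dominated_convergence (fun _ => C) ?_ ?_ ?_ ?_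
  · refine Eventually.of_forall fun k => Continuous.aestronglyMeasurable ?_
    have h0 := hmc k 0
    have h1 := hmc k 1
    fun_prop
  · refine Eventually.of_forall fun k => Eventually.of_forall fun s _ => ?_
    rw [hav, Real.norm_eq_abs]
    refine (abs_integral_le_integral_abs).trans ?_
    calc ∫ y, |ρ k y * W (p i + s • (p j - p i) - y)| ≤ ∫ y, ρ k y * C := by
          refine integral_mono_of_nonneg (Eventually.of_forall fun _ => abs_nonneg _)
            ((hρi k).mul_const C) (Eventually.of_forall fun y => ?_)
          simp only [abs_mul, abs_of_nonneg (hρ0 k y)]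
          exact mul_le_mul_of_nonneg_left (hWC _) (hρ0 k y)
      _ = C := by rw [integral_mul_const, hρ1, one_mul]
  · simp
  · have hne : ∀ᵐ s : ℝ, s ≠ 1 := by simp [ae_iff, measure_singleton]
    filter_upwards [hne] with s hs1 hs
    rw [Set.uIoc_of_le zero_le_one] at hs
    obtain ⟨δ, hδ, hae⟩ := hT.eventually_pieceConst_eq hP hX hX0 ha ht hi hj hij hs.1
      (lt_of_le_of_ne hs.2 hs1)
    refine tendsto_const_nhds.congr' ?_
    have hk : ∀ᶠ k : ℕ in atTop, (1 : ℝ) / (k + 1) < δ :=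
      tendsto_one_div_add_atTop_nhds_zero_nat.eventually (gt_mem_nhds hδ)
    filter_upwards [hk] with k hk
    rw [hav]
    set x := p i + s • (p j - p i)
    have e : ∫ y, ρ k y * W (x - y) = ∫ y, ρ k y * X i j := by
      refine integral_congr_ae ?_
      have hq := (quasiMeasurePreserving_sub_left (volume : Measure Plane) x).ae hae
      filter_upwards [hq] with y hy
      by_cases hy0 : ρ k y = 0
      · rw [hy0, zero_mul, zero_mul]
      · have hys : y ∈ tsupport (ρ k) := subset_tsupport _ hy0
        rw [hρ] at hys
        simp only at hys
        rw [ContDiffBump.tsupport_normed_eq, mem_closedBall_zero_iff] at hys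
        have hys' : ‖y‖ ≤ 1 / ((k : ℝ) + 1) := hys
        have := hy (by
          rw [sub_sub_cancel_left, norm_neg]
          exact lt_of_le_of_lt hys' hk)
        rw [show W (x - y) = X i j from this]
    rw [e, integral_mul_const, hρ1, one_mul]

/-- A cochain that vanishes on the boundary and has no circulations vanishes. -/
lemma cochain_eq_zero (hP : IsSimplePolygon p P) (hT : IsTriangulation p P T)
    {X : Fin (n + 3) → Fin (n + 3) → ℝ} (hX : ∀ a b, X b a = - X a b)
    (hX0 : ∀ a, X a (a + 1) = 0) (hc : ∀ t ∈ T, circulation p t X = 0)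
    {t} (ht : t ∈ T) {i j : Fin (n + 3)} (hi : i ∈ t) (hj : j ∈ t) : X i j = 0 := by
  rcases eq_or_ne i j with rfl | hij
  · linarith [hX i i]
  -- The mollified field is curl free in the whole plane, so its integral from p i to p j may be
  -- taken through p 0 and along the polygon. There it tends to zero edge by edge, while along the
  -- straight edge it tends to X i j.
  choose! a ha using fun t ht => hT.exists_nedDof_eq (t := t) ht hX (hc t ht)
  set w : Fin 2 → ℕ → Plane → ℝ := fun m k =>
    mollify 1 0 ((stdBump k).normed volume) (pieceConst p T a m) with hw
  have hwc : ∀ m k, ContDiff ℝ 1 (w m k) := fun m k =>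
    (contDiff_mollify (memLp_pieceConst a m) (by norm_num) 0 (stdBump k).contDiff_normed
      (stdBump k).hasCompactSupport_normed).of_le (by exact_mod_cast le_top)
  have hcurl : ∀ k x, pderiv 0 (w 1 k) x - pderiv 1 (w 0 k) x = 0 := fun k x =>
    hT.curl_mollify_pieceConst hP hX hX0 ha
      ((stdBump k).contDiff_normed.of_le (by exact_mod_cast le_top : (1 : WithTop ℕ∞) ≤ ∞))
      (stdBump k).hasCompactSupport_normed x
  have hadd : ∀ k x y z, lineInt (w 0 k) (w 1 k) x z
      = lineInt (w 0 k) (w 1 k) x y + lineInt (w 0 k) (w 1 k) y z := fun k x y z => by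
    have := lineInt_cocycle (hwc 0 k) (hwc 1 k) (hcurl k) x y z
    rw [lineInt_swap _ _ x z] at this
    linarith
  have hbd : ∀ l : Fin (n + 3),
      Tendsto (fun k => lineInt (w 0 k) (w 1 k) (p l) (p (l + 1))) atTop (𝓝 0) := by
    intro l
    obtain ⟨q, hq, hl, hl'⟩ := hT.exists_boundary_triangle hP l
    have := hT.tendsto_lineInt_mollify hP hX hX0 ha hq hl hl' (fin_succ_ne l).symm
    rwa [hX0] at this
  have hpath : ∀ l : Fin (n + 3),
      Tendsto (fun k => lineInt (w 0 k) (w 1 k) (p 0) (p l)) atTop (𝓝 0) := by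
    intro l
    induction l using Fin.induction with
    | zero =>
      have : ∀ k, lineInt (w 0 k) (w 1 k) (p 0) (p 0) = 0 := fun k => by
        linarith [lineInt_swap (w 0 k) (w 1 k) (p 0) (p 0)]
      simp only [this]
      exact tendsto_const_nhds
    | succ l ih =>
      have := ih.add (hbd l.castSucc)
      rw [Fin.coeSucc_eq_succ, add_zero] at this
      refine this.congr fun k => ?_
      rw [← hadd]
  have h1 := hT.tendsto_lineInt_mollify hP hX hX0 ha ht hi hj hij
  have h2 : Tendsto (fun k => lineInt (w 0 k) (w 1 k) (p i) (p j)) atTop (𝓝 0) := by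
    have := (hpath j).sub (hpath i)
    rw [sub_zero] at this
    refine this.congr fun k => ?_
    rw [hadd k (p 0) (p i) (p j)]
    ring
  exact tendsto_nhds_unique h1 h2

end IsTriangulation

/-! ### Convergence of integrals -/

section Limits

variable {α : Type*} [MeasurableSpace α] {μ : Measure α}

lemma eLpNorm_two_eq_ofReal {f : α → ℝ} (hf : MemLp f 2 μ) :
    eLpNorm f 2 μ = ENNReal.ofReal √(∫ x, f x ^ 2 ∂μ) := by
  rw [hf.eLpNorm_eq_integral_rpow_norm (by norm_num) (by norm_num), Real.sqrt_eq_rpow]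
  simp

lemma tendsto_eLpNorm_two_iff {F : ℕ → α → ℝ} (hF : ∀ k, MemLp (F k) 2 μ) :
    Tendsto (fun k => eLpNorm (F k) 2 μ) atTop (𝓝 0) ↔
      Tendsto (fun k => ∫ x, F k x ^ 2 ∂μ) atTop (𝓝 0) := by
  simp only [fun k => eLpNorm_two_eq_ofReal (hF k)]
  constructor
  · intro h
    have h1 := (ENNReal.tendsto_toReal ENNReal.zero_ne_top).comp h
    have h2 := h1.pow 2
    rw [ENNReal.toReal_zero, zero_pow two_ne_zero] at h2
    refine h2.congr fun k => ?_
    simp only [Function.comp_apply, ENNReal.toReal_ofReal (Real.sqrt_nonneg _)]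
    exact Real.sq_sqrt (integral_nonneg fun x => sq_nonneg _)
  · intro h
    have := ENNReal.tendsto_ofReal h.sqrt
    simpa using this

lemma tendsto_integral_mul {f g : α → ℝ} {F G : ℕ → α → ℝ} (hf : MemLp f 2 μ)
    (hg : MemLp g 2 μ) (hF : ∀ k, MemLp (F k) 2 μ) (hG : ∀ k, MemLp (G k) 2 μ)
    (h₁ : Tendsto (fun k => eLpNorm (F k - f) 2 μ) atTop (𝓝 0))
    (h₂ : Tendsto (fun k => eLpNorm (G k - g) 2 μ) atTop (𝓝 0)) :
    Tendsto (fun k => ∫ x, F k x * G k x ∂μ) atTop (𝓝 (∫ x, f x * g x ∂μ)) := by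
  have t₁ := (Lp.tendsto_Lp_iff_tendsto_eLpNorm'' F hF f hf).2 h₁
  have t₂ := (Lp.tendsto_Lp_iff_tendsto_eLpNorm'' G hG g hg).2 h₂
  have key : ∀ {a b : α → ℝ} (ha : MemLp a 2 μ) (hb : MemLp b 2 μ),
      inner ℝ (ha.toLp a) (hb.toLp b) = ∫ x, b x * a x ∂μ := by
    intro a b ha hb
    rw [L2.inner_def]
    refine integral_congr_ae ?_
    filter_upwards [ha.coeFn_toLp, hb.coeFn_toLp] with x h1 h2
    rw [h1, h2]
    simp
  have := t₂.inner (𝕜 := ℝ) t₁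
  simpa only [key] using this

lemma exists_tendsto_of_cauchy {F : ℕ → α → ℝ} (hF : ∀ k, MemLp (F k) 2 μ)
    (h : ∀ ε > 0, ∃ N, ∀ m ≥ N, ∀ n ≥ N, ∫ x, (F m x - F n x) ^ 2 ∂μ < ε) :
    ∃ f : α → ℝ, MemLp f 2 μ ∧ Tendsto (fun k => ∫ x, (F k x - f x) ^ 2 ∂μ) atTop (𝓝 0) := by
  have hc : CauchySeq fun k => (hF k).toLp (F k) := by
    rw [Metric.cauchySeq_iff]
    intro ε hε
    obtain ⟨N, hN⟩ := h (ε ^ 2) (by positivity)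
    refine ⟨N, fun m hm n hn => ?_⟩
    rw [dist_eq_norm, ← MemLp.toLp_sub, Lp.norm_toLp,
      eLpNorm_two_eq_ofReal ((hF m).sub (hF n)), ENNReal.toReal_ofReal (Real.sqrt_nonneg _)]
    exact (Real.sqrt_lt' hε).2 (hN m hm n hn)
  obtain ⟨f, hf⟩ := cauchySeq_tendsto_of_complete hc
  refine ⟨f, Lp.memLp f, ?_⟩
  have hsub : ∀ k, MemLp (F k - ⇑f) 2 μ := fun k => (hF k).sub (Lp.memLp f)
  refine (tendsto_eLpNorm_two_iff hsub).1 ?_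
  rw [← Lp.tendsto_Lp_iff_tendsto_eLpNorm'' F hF f (Lp.memLp f), Lp.toLp_coeFn]
  exact hf

end Limits

/-! ### Smooth approximation in `H¹` -/

/-- The smooth functions `Φ k` converge in `L²(D)` to `f`, and their gradients to `g`. -/
structure SmoothApprox (D : Set Plane) (f : Plane → ℝ) (g : Fin 2 → Plane → ℝ)
    (Φ : ℕ → Plane → ℝ) : Prop where
  memLp : MemLp f 2 (volume.restrict D)
  partial_memLp : ∀ i, MemLp (g i) 2 (volume.restrict D)
  contDiff : ∀ k, ContDiff ℝ ∞ (Φ k)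
  tendsto : Tendsto (fun k => eLpNorm (Φ k - f) 2 (volume.restrict D)) atTop (𝓝 0)
  tendsto_pderiv : ∀ i, Tendsto (fun k => eLpNorm (pderiv i (Φ k) - g i) 2 (volume.restrict D))
    atTop (𝓝 0)

lemma HasH1.exists_smoothApprox {D : Set Plane} (hD : IsOpen D) (hconv : Convex ℝ D)
    (hne : D.Nonempty) {f : Plane → ℝ} {g : Fin 2 → Plane → ℝ} (h : HasH1 D f g) :
    ∃ Φ, SmoothApprox D f g Φ := by
  obtain ⟨Φ, h1, h2, h3⟩ := exists_contDiff_tendsto hD hconv hne h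
  exact ⟨Φ, h.memLp, h.partial_memLp, h1, h2, h3⟩

lemma smoothApprox_const {D : Set Plane} (hb : Bornology.IsBounded D) {f φ : Plane → ℝ}
    (hφ : ContDiff ℝ ∞ φ) (hf : f =ᵐ[volume.restrict D] φ) :
    SmoothApprox D f (fun i => pderiv i φ) fun _ => φ := by
  have h1 : ContDiff ℝ 1 φ := hφ.of_le (by exact_mod_cast le_top)
  refine ⟨(memLp_two_of_continuous hb hφ.continuous).ae_eq hf.symm,
    fun i => memLp_two_of_continuous hb (pderiv_continuous h1 i), fun _ => hφ, ?_, fun i => ?_⟩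
  · have : φ - f =ᵐ[volume.restrict D] 0 := by
      filter_upwards [hf] with x hx
      simp [hx]
    simp only [eLpNorm_congr_ae this, eLpNorm_zero]
    exact tendsto_const_nhds
  · simp

lemma pderiv_lincomb {f f' : Plane → ℝ} (hf : ContDiff ℝ 1 f) (hf' : ContDiff ℝ 1 f') (r s : ℝ)
    (i : Fin 2) (x : Plane) : pderiv i (fun x => r * f x + s * f' x) x
      = r * pderiv i f x + s * pderiv i f' x := by
  have h1 := (hf.differentiable one_ne_zero x).hasFDerivAt.const_mul r
  have h2 := (hf'.differentiable one_ne_zero x).hasFDerivAt.const_mul s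
  have h3 : HasFDerivAt (fun x => r * f x + s * f' x) _ x := h1.add h2
  rw [pderiv, h3.fderiv]
  simp [pderiv]

lemma tendsto_eLpNorm_lincomb {D : Set Plane} {f f' : Plane → ℝ} {F F' : ℕ → Plane → ℝ}
    (hF : ∀ k, AEStronglyMeasurable (F k - f) (volume.restrict D))
    (hF' : ∀ k, AEStronglyMeasurable (F' k - f') (volume.restrict D))
    (h : Tendsto (fun k => eLpNorm (F k - f) 2 (volume.restrict D)) atTop (𝓝 0))
    (h' : Tendsto (fun k => eLpNorm (F' k - f') 2 (volume.restrict D)) atTop (𝓝 0)) (r s : ℝ) :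
    Tendsto (fun k => eLpNorm ((fun x => r * F k x + s * F' k x) - fun x => r * f x + s * f' x) 2
      (volume.restrict D)) atTop (𝓝 0) := by
  have hlim := (ENNReal.Tendsto.const_mul (a := ‖r‖ₑ) h (Or.inr (by simp))).add
    (ENNReal.Tendsto.const_mul (a := ‖s‖ₑ) h' (Or.inr (by simp)))
  simp only [mul_zero, add_zero] at hlim
  refine tendsto_of_tendsto_of_tendsto_of_le_of_le tendsto_const_nhds hlim (fun _ => zero_le)
    fun k => ?_
  have e : ((fun x => r * F k x + s * F' k x) - fun x => r * f x + s * f' x)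
      = r • (F k - f) + s • (F' k - f') := by
    ext x; simp; ring
  simp only [e]
  refine (eLpNorm_add_le ((hF k).const_smul r) ((hF' k).const_smul s) (by norm_num)).trans ?_
  rw [eLpNorm_const_smul, eLpNorm_const_smul]

namespace SmoothApprox

variable {D D' : Set Plane} {f f' : Plane → ℝ} {g g' : Fin 2 → Plane → ℝ} {Φ Φ' : ℕ → Plane → ℝ}

lemma contDiff_one (h : SmoothApprox D f g Φ) (k : ℕ) : ContDiff ℝ 1 (Φ k) :=
  (h.contDiff k).of_le (by exact_mod_cast le_top)

lemma mono (hD : D' ⊆ D) (h : SmoothApprox D f g Φ) : SmoothApprox D' f g Φ := by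
  have hμ : volume.restrict D' ≤ volume.restrict D := Measure.restrict_mono hD le_rfl
  exact ⟨h.memLp.mono_measure hμ, fun i => (h.partial_memLp i).mono_measure hμ, h.contDiff,
    tendsto_of_tendsto_of_tendsto_of_le_of_le tendsto_const_nhds h.tendsto (fun _ => zero_le)
      fun k => eLpNorm_mono_measure _ hμ,
    fun i => tendsto_of_tendsto_of_tendsto_of_le_of_le tendsto_const_nhds (h.tendsto_pderiv i)
      (fun _ => zero_le) fun k => eLpNorm_mono_measure _ hμ⟩

lemma of_measure_eq (hD : volume.restrict D = volume.restrict D') (h : SmoothApprox D f g Φ) :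
    SmoothApprox D' f g Φ := by
  obtain ⟨h1, h2, h3, h4, h5⟩ := h
  rw [hD] at h1 h4
  simp only [hD] at h2 h5
  exact ⟨h1, h2, h3, h4, h5⟩

lemma lincomb (h : SmoothApprox D f g Φ) (h' : SmoothApprox D f' g' Φ') (r s : ℝ) :
    SmoothApprox D (fun x => r * f x + s * f' x) (fun i x => r * g i x + s * g' i x)
      fun k x => r * Φ k x + s * Φ' k x := by
  refine ⟨(h.memLp.const_mul r).add (h'.memLp.const_mul s),
    fun i => ((h.partial_memLp i).const_mul r).add ((h'.partial_memLp i).const_mul s),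
    fun k => (contDiff_const.mul (h.contDiff k)).add (contDiff_const.mul (h'.contDiff k)), ?_,
    fun i => ?_⟩
  · exact tendsto_eLpNorm_lincomb
      (fun k => (h.contDiff k).continuous.aestronglyMeasurable.sub h.memLp.1)
      (fun k => (h'.contDiff k).continuous.aestronglyMeasurable.sub h'.memLp.1)
      h.tendsto h'.tendsto r s
  · have e : ∀ k, pderiv i (fun x => r * Φ k x + s * Φ' k x)
        = fun x => r * pderiv i (Φ k) x + s * pderiv i (Φ' k) x := fun k =>
      funext fun x => pderiv_lincomb (h.contDiff_one k) (h'.contDiff_one k) r s i x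
    simp only [e]
    exact tendsto_eLpNorm_lincomb
      (fun k => (pderiv_continuous (h.contDiff_one k) i).aestronglyMeasurable.sub
        (h.partial_memLp i).1)
      (fun k => (pderiv_continuous (h'.contDiff_one k) i).aestronglyMeasurable.sub
        (h'.partial_memLp i).1)
      (h.tendsto_pderiv i) (h'.tendsto_pderiv i) r s

lemma tendsto_integral_sq_sub (hb : Bornology.IsBounded D) (h : SmoothApprox D f g Φ) :
    Tendsto (fun k => ∫ x in D, (Φ k x - f x) ^ 2) atTop (𝓝 0) :=
  (tendsto_eLpNorm_two_iff fun k =>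
    (memLp_two_of_continuous hb (h.contDiff k).continuous).sub h.memLp).1 h.tendsto

lemma tendsto_integral_pderiv_sq_sub (hb : Bornology.IsBounded D) (h : SmoothApprox D f g Φ)
    (i : Fin 2) : Tendsto (fun k => ∫ x in D, (pderiv i (Φ k) x - g i x) ^ 2) atTop (𝓝 0) :=
  (tendsto_eLpNorm_two_iff fun k =>
    (memLp_two_of_continuous hb (pderiv_continuous (h.contDiff_one k) i)).sub
      (h.partial_memLp i)).1 (h.tendsto_pderiv i)

lemma tendsto_h1NormSq (hD : IsOpen D) (hb : Bornology.IsBounded D) (hf : HasH1 D f g)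
    (h : SmoothApprox D f g Φ) :
    Tendsto (fun k => h1NormSq D fun x => Φ k x - f x) atTop (𝓝 0) := by
  simp only [fun k => ((hasH1_of_contDiff hb (h.contDiff_one k)).sub hf).h1NormSq_eq hD]
  simpa using (h.tendsto_integral_sq_sub hb).add
    ((h.tendsto_integral_pderiv_sq_sub hb 0).add (h.tendsto_integral_pderiv_sq_sub hb 1))

lemma of_h1NormSq (hD : IsOpen D) (hb : Bornology.IsBounded D) (hf : HasH1 D f g)
    (hΦ : ∀ k, ContDiff ℝ ∞ (Φ k))
    (h : Tendsto (fun k => h1NormSq D fun x => Φ k x - f x) atTop (𝓝 0)) :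
    SmoothApprox D f g Φ := by
  have h1 : ∀ k, ContDiff ℝ 1 (Φ k) := fun k => (hΦ k).of_le (by exact_mod_cast le_top)
  simp only [fun k => ((hasH1_of_contDiff hb (h1 k)).sub hf).h1NormSq_eq hD] at h
  have n : ∀ (F : ℕ → Plane → ℝ) k, 0 ≤ ∫ x in D, F k x ^ 2 := fun F k =>
    integral_nonneg fun x => sq_nonneg _
  refine ⟨hf.memLp, hf.partial_memLp, hΦ, ?_, fun i => ?_⟩
  · refine (tendsto_eLpNorm_two_iff fun k =>
      (memLp_two_of_continuous hb (hΦ k).continuous).sub hf.memLp).2 ?_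
    refine squeeze_zero (fun k => integral_nonneg fun x => sq_nonneg _) (fun k => ?_) h
    exact le_add_of_nonneg_right (add_nonneg (n (fun k x => pderiv 0 (Φ k) x - g 0 x) k)
      (n (fun k x => pderiv 1 (Φ k) x - g 1 x) k))
  · refine (tendsto_eLpNorm_two_iff fun k =>
      (memLp_two_of_continuous hb (pderiv_continuous (h1 k) i)).sub (hf.partial_memLp i)).2 ?_
    refine squeeze_zero (fun k => integral_nonneg fun x => sq_nonneg _) (fun k => ?_) h
    have n0 := n (fun k x => Φ k x - f x) k
    have n1 := n (fun k x => pderiv 0 (Φ k) x - g 0 x) k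
    have n2 := n (fun k x => pderiv 1 (Φ k) x - g 1 x) k
    fin_cases i
    · simp only [Pi.sub_apply] at n0 n1 n2 ⊢
      simp only [Fin.zero_eta]
      linarith
    · simp only [Pi.sub_apply] at n0 n1 n2 ⊢
      simp only [Fin.mk_one]
      linarith

lemma tendsto_integral_sq (hb : Bornology.IsBounded D) (h : SmoothApprox D f g Φ) :
    Tendsto (fun k => ∫ x in D, Φ k x ^ 2) atTop (𝓝 (∫ x in D, f x ^ 2)) := by
  simp only [sq]
  exact tendsto_integral_mul h.memLp h.memLp
    (fun k => memLp_two_of_continuous hb (h.contDiff k).continuous)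
    (fun k => memLp_two_of_continuous hb (h.contDiff k).continuous) h.tendsto h.tendsto

lemma tendsto_integral_pderiv (hb : Bornology.IsBounded D) (h : SmoothApprox D f g Φ) (i : Fin 2) :
    Tendsto (fun k => ∫ x in D, pderiv i (Φ k) x) atTop (𝓝 (∫ x in D, g i x)) := by
  have h1 : MemLp (fun _ : Plane => (1 : ℝ)) 2 (volume.restrict D) :=
    memLp_two_of_continuous hb continuous_const
  simpa using tendsto_integral_mul (h.partial_memLp i) h1
    (fun k => memLp_two_of_continuous hb (pderiv_continuous (h.contDiff_one k) i)) (fun _ => h1)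
    (h.tendsto_pderiv i) (by simp)

lemma tendsto_integral_gradSq (hb : Bornology.IsBounded D) (h : SmoothApprox D f g Φ) :
    Tendsto (fun k => ∫ x in D, gradSq (Φ k) x) atTop
      (𝓝 (∫ x in D, (g 0 x ^ 2 + g 1 x ^ 2))) := by
  have hm : ∀ i k, MemLp (pderiv i (Φ k)) 2 (volume.restrict D) := fun i k =>
    memLp_two_of_continuous hb (pderiv_continuous (h.contDiff_one k) i)
  have key : ∀ i, Tendsto (fun k => ∫ x in D, pderiv i (Φ k) x ^ 2) atTop
      (𝓝 (∫ x in D, g i x ^ 2)) := fun i => by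
    simp only [sq]
    exact tendsto_integral_mul (h.partial_memLp i) (h.partial_memLp i) (hm i) (hm i)
      (h.tendsto_pderiv i) (h.tendsto_pderiv i)
  rw [integral_add (h.partial_memLp 0).integrable_sq (h.partial_memLp 1).integrable_sq]
  refine ((key 0).add (key 1)).congr fun k => ?_
  rw [← integral_add (hm 0 k).integrable_sq (hm 1 k).integrable_sq]
  rfl

end SmoothApprox

/-- The Poincaré inequality on a bounded convex open set, in the form of a sequence of constants. -/
lemma HasH1.integral_sub_sq_le {D A : Set Plane} (hD : IsOpen D) (hconv : Convex ℝ D)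
    (hne : D.Nonempty) {h : ℝ} (hh : ∀ x ∈ D, ∀ y ∈ D, ‖x - y‖ ≤ h) (hb : Bornology.IsBounded D)
    {f : Plane → ℝ} {g : Fin 2 → Plane → ℝ} (hf : HasH1 D f g) (hA : A ⊆ D) {S : ℝ}
    (hS : ∀ a : ℝ, S ≤ ∫ x in A, (f x - a) ^ 2) :
    S ≤ 8 * h ^ 2 * ∫ x in D, (g 0 x ^ 2 + g 1 x ^ 2) := by
  obtain ⟨Φ, hΦ⟩ := hf.exists_smoothApprox hD hconv hne
  have hlim := ((hΦ.tendsto_integral_sq_sub hb).const_mul 2).add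
    ((hΦ.tendsto_integral_gradSq hb).const_mul (8 * h ^ 2))
  rw [mul_zero, zero_add] at hlim
  refine ge_of_tendsto hlim (Eventually.of_forall fun k => ?_)
  -- The constant a depends on k. The lower bound `hS` is assumed for all constants at once, so the
  -- sequence of constants need not converge. The factor 8 is twice the Poincaré constant 4.
  obtain ⟨a, ha⟩ := exists_integral_sub_sq_le hconv hD.measurableSet hb
    (hD.measure_pos volume hne).ne' hh (hΦ.contDiff_one k)
  have c1 : MemLp (fun x => f x - a) 2 (volume.restrict D) :=
    hf.memLp.sub (memLp_two_of_continuous hb continuous_const)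
  have c2 : MemLp (fun x => Φ k x - f x) 2 (volume.restrict D) :=
    (memLp_two_of_continuous hb (hΦ.contDiff k).continuous).sub hf.memLp
  have c3 : MemLp (fun x => Φ k x - a) 2 (volume.restrict D) :=
    memLp_two_of_continuous hb ((hΦ.contDiff k).continuous.sub continuous_const)
  have i2 := c2.integrable_sq
  have i3 := c3.integrable_sq
  calc S ≤ ∫ x in A, (f x - a) ^ 2 := hS a
    _ ≤ ∫ x in D, (f x - a) ^ 2 := setIntegral_mono_set c1.integrable_sq
        (Eventually.of_forall fun x => sq_nonneg _) hA.eventuallyLE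
    _ ≤ ∫ x in D, (2 * (Φ k x - f x) ^ 2 + 2 * (Φ k x - a) ^ 2) := by
        refine integral_mono c1.integrable_sq ((i2.const_mul 2).add (i3.const_mul 2)) fun x => ?_
        simp only
        nlinarith [sq_nonneg (Φ k x - f x + (Φ k x - a))]
    _ = 2 * (∫ x in D, (Φ k x - f x) ^ 2) + 2 * ∫ x in D, (Φ k x - a) ^ 2 := by
        rw [integral_add (i2.const_mul 2) (i3.const_mul 2), integral_const_mul,
          integral_const_mul]
    _ ≤ _ := by linarith

/-! ### Traces on the edges of a triangle -/

lemma Convex.restrict_interior {K : Set Plane} (hK : Convex ℝ K) :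
    volume.restrict (interior K) = volume.restrict K :=
  Measure.restrict_congr_set (interior_ae_eq_of_null_frontier (hK.addHaar_frontier volume))

/-- The squared distance of `φ` from `(f, g)` in a weighted `H¹` norm. -/
noncomputable def approxError (K : Set Plane) (h : ℝ) (f : Plane → ℝ) (g : Fin 2 → Plane → ℝ)
    (φ : Plane → ℝ) : ℝ :=
  6 * (∫ x in K, (φ x - f x) ^ 2) + 2 * h ^ 2 *
    ((∫ x in K, (pderiv 0 φ x - g 0 x) ^ 2) + ∫ x in K, (pderiv 1 φ x - g 1 x) ^ 2)

lemma SmoothApprox.tendsto_approxError {K : Set Plane} (hb : Bornology.IsBounded K)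
    {f : Plane → ℝ} {g : Fin 2 → Plane → ℝ} {Φ : ℕ → Plane → ℝ} (h : SmoothApprox K f g Φ)
    (r : ℝ) : Tendsto (fun k => approxError K r f g (Φ k)) atTop (𝓝 0) := by
  have := ((h.tendsto_integral_sq_sub hb).const_mul 6).add
    (((h.tendsto_integral_pderiv_sq_sub hb 0).add
      (h.tendsto_integral_pderiv_sq_sub hb 1)).const_mul (2 * r ^ 2))
  simpa [approxError] using this

lemma integral_sub_sq_le_two_mul {α : Type*} [MeasurableSpace α] {μ : Measure α} {u v f : α → ℝ}
    (hu : MemLp u 2 μ) (hv : MemLp v 2 μ) (hf : MemLp f 2 μ) :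
    ∫ x, (u x - v x) ^ 2 ∂μ ≤ 2 * (∫ x, (u x - f x) ^ 2 ∂μ) + 2 * ∫ x, (v x - f x) ^ 2 ∂μ := by
  have i1 := (hu.sub hf).integrable_sq
  have i2 := (hv.sub hf).integrable_sq
  simp only [Pi.sub_apply] at i1 i2
  rw [← integral_const_mul, ← integral_const_mul, ← integral_add (i1.const_mul 2) (i2.const_mul 2)]
  refine integral_mono (hu.sub hv).integrable_sq ((i1.const_mul 2).add (i2.const_mul 2))
    fun x => ?_
  change (u x - v x) ^ 2 ≤ 2 * (u x - f x) ^ 2 + 2 * (v x - f x) ^ 2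
  nlinarith [sq_nonneg (u x - f x + (v x - f x))]

/-- The trace inequality for φ - ψ, split at (f, g); the splitting doubles the weights 3 and h² to
those of `approxError`. It makes approximating sequences Cauchy on an edge. -/
lemma orient_mul_integral_edge_sub_le {a b c : Plane} (ho : orient a b c ≠ 0) {φ ψ f : Plane → ℝ}
    {g : Fin 2 → Plane → ℝ} (hφ : ContDiff ℝ 1 φ) (hψ : ContDiff ℝ 1 ψ)
    (hf : MemLp f 2 (volume.restrict (convexHull ℝ {a, b, c})))
    (hg : ∀ i, MemLp (g i) 2 (volume.restrict (convexHull ℝ {a, b, c}))) {h : ℝ}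
    (hh : ∀ x ∈ convexHull ℝ {a, b, c}, ‖x - c‖ ≤ h) :
    |orient a b c| * ∫ s in (0 : ℝ)..1, (φ (a + s • (b - a)) - ψ (a + s • (b - a))) ^ 2
      ≤ approxError (convexHull ℝ {a, b, c}) h f g φ
        + approxError (convexHull ℝ {a, b, c}) h f g ψ := by
  have hb := isBounded_triangle a b c
  have hχ : ContDiff ℝ 1 fun x => φ x - ψ x := hφ.sub hψ
  have key := orient_mul_integral_edge_le hχ ho hh
  refine key.trans ?_
  have hp : ∀ i x, pderiv i (fun x => φ x - ψ x) x = pderiv i φ x - pderiv i ψ x := fun i x => by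
    have := pderiv_lincomb hφ hψ 1 (-1) i x
    simpa [← sub_eq_add_neg] using this
  have m1 := memLp_two_of_continuous hb hφ.continuous
  have m2 := memLp_two_of_continuous hb hψ.continuous
  have d1 := fun i => memLp_two_of_continuous hb (pderiv_continuous hφ i)
  have d2 := fun i => memLp_two_of_continuous hb (pderiv_continuous hψ i)
  have e0 := integral_sub_sq_le_two_mul m1 m2 hf
  have e1 := integral_sub_sq_le_two_mul (d1 0) (d2 0) (hg 0)
  have e2 := integral_sub_sq_le_two_mul (d1 1) (d2 1) (hg 1)
  have i0 := (m1.sub m2).integrable_sq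
  have i1 := ((d1 0).sub (d2 0)).integrable_sq
  have i2 := ((d1 1).sub (d2 1)).integrable_sq
  simp only [Pi.sub_apply] at i0 i1 i2
  have : ∫ x in convexHull ℝ {a, b, c},
      (3 * (φ x - ψ x) ^ 2 + h ^ 2 * gradSq (fun x => φ x - ψ x) x)
      = 3 * (∫ x in convexHull ℝ {a, b, c}, (φ x - ψ x) ^ 2) + h ^ 2 *
        ((∫ x in convexHull ℝ {a, b, c}, (pderiv 0 φ x - pderiv 0 ψ x) ^ 2)
          + ∫ x in convexHull ℝ {a, b, c}, (pderiv 1 φ x - pderiv 1 ψ x) ^ 2) := by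
    simp only [gradSq, hp]
    have i12 : Integrable (fun x => (pderiv 0 φ x - pderiv 0 ψ x) ^ 2
        + (pderiv 1 φ x - pderiv 1 ψ x) ^ 2) (volume.restrict (convexHull ℝ {a, b, c})) := i1.add i2
    rw [integral_add (i0.const_mul 3) (i12.const_mul _), integral_const_mul,
      integral_const_mul, integral_add i1 i2]
  rw [this]
  unfold approxError
  nlinarith [mul_le_mul_of_nonneg_left (add_le_add e1 e2) (sq_nonneg h)]

lemma norm_sub_le_diam_triangle (a b c : Plane) :
    ∀ x ∈ convexHull ℝ {a, b, c}, ‖x - c‖ ≤ Metric.diam (convexHull ℝ {a, b, c}) := by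
  intro x hx
  rw [← dist_eq_norm]
  exact Metric.dist_le_diam_of_mem (isBounded_triangle a b c) hx
    (subset_convexHull ℝ _ (by simp))

section Edge

variable {a b c : Plane} {f : Plane → ℝ} {g : Fin 2 → Plane → ℝ} {Φ Ψ : ℕ → Plane → ℝ}

lemma memLp_edge {φ : Plane → ℝ} (hφ : Continuous φ) (a b : Plane) :
    MemLp (fun s : ℝ => φ (a + s • (b - a))) 2 (volume.restrict (Set.Icc (0 : ℝ) 1)) := by
  have hc : Continuous fun s : ℝ => φ (a + s • (b - a)) := by fun_prop
  exact (memLp_two_iff_integrable_sq hc.aestronglyMeasurable).2 (hc.pow 2).integrableOn_Icc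

lemma integral_Icc_eq (φ : ℝ → ℝ) :
    ∫ s in Set.Icc (0 : ℝ) 1, φ s = ∫ s in (0 : ℝ)..1, φ s := by
  rw [intervalIntegral.integral_of_le zero_le_one, integral_Icc_eq_integral_Ioc]

/-- The trace on an edge does not depend on the approximating sequence. -/
lemma SmoothApprox.tendsto_edge_sub (ho : orient a b c ≠ 0)
    (hΦ : SmoothApprox (convexHull ℝ {a, b, c}) f g Φ)
    (hΨ : SmoothApprox (convexHull ℝ {a, b, c}) f g Ψ) :
    Tendsto (fun k => ∫ s in Set.Icc (0 : ℝ) 1,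
      (Φ k (a + s • (b - a)) - Ψ k (a + s • (b - a))) ^ 2) atTop (𝓝 0) := by
  have hb := isBounded_triangle a b c
  have hlim := ((hΦ.tendsto_approxError hb (Metric.diam (convexHull ℝ {a, b, c}))).add
    (hΨ.tendsto_approxError hb (Metric.diam (convexHull ℝ {a, b, c})))).const_mul
      |orient a b c|⁻¹
  rw [add_zero, mul_zero] at hlim
  refine squeeze_zero (fun k => integral_nonneg fun x => sq_nonneg _) (fun k => ?_) hlim
  rw [← div_eq_inv_mul, le_div_iff₀ (abs_pos.2 ho), mul_comm, integral_Icc_eq]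
  exact orient_mul_integral_edge_sub_le ho (hΦ.contDiff_one k) (hΨ.contDiff_one k) hΦ.memLp
    hΦ.partial_memLp (norm_sub_le_diam_triangle a b c)

/-- Existence of the trace: by the trace inequality the restrictions to the edge form a Cauchy
sequence in L². -/
lemma SmoothApprox.exists_edge_limit (ho : orient a b c ≠ 0)
    (hΦ : SmoothApprox (convexHull ℝ {a, b, c}) f g Φ) :
    ∃ τ : ℝ → ℝ, MemLp τ 2 (volume.restrict (Set.Icc (0 : ℝ) 1)) ∧
      Tendsto (fun k => ∫ s in Set.Icc (0 : ℝ) 1, (Φ k (a + s • (b - a)) - τ s) ^ 2) atTop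
        (𝓝 0) := by
  have hb := isBounded_triangle a b c
  have hlim := hΦ.tendsto_approxError hb (Metric.diam (convexHull ℝ {a, b, c}))
  refine exists_tendsto_of_cauchy
    (fun k => memLp_edge (hΦ.contDiff k).continuous a b) fun ε hε => ?_
  have hε' : 0 < |orient a b c| * ε / 2 := by have := abs_pos.2 ho; positivity
  obtain ⟨N, hN⟩ := eventually_atTop.1 (hlim.eventually (gt_mem_nhds hε'))
  refine ⟨N, fun k hk l hl => ?_⟩
  have := orient_mul_integral_edge_sub_le ho (hΦ.contDiff_one k) (hΦ.contDiff_one l) hΦ.memLp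
    hΦ.partial_memLp (norm_sub_le_diam_triangle a b c)
  rw [integral_Icc_eq]
  refine lt_of_mul_lt_mul_left (this.trans_lt ?_) (abs_nonneg (orient a b c))
  linarith [hN k hk, hN l hl]

lemma tendsto_lineInt {F₀ F₁ : ℕ → Plane → ℝ} {τ₀ τ₁ : ℝ → ℝ} (h₀ : ∀ k, Continuous (F₀ k))
    (h₁ : ∀ k, Continuous (F₁ k))
    (m₀ : MemLp τ₀ 2 (volume.restrict (Set.Icc (0 : ℝ) 1)))
    (m₁ : MemLp τ₁ 2 (volume.restrict (Set.Icc (0 : ℝ) 1)))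
    (t₀ : Tendsto (fun k => ∫ s in Set.Icc (0 : ℝ) 1, (F₀ k (a + s • (b - a)) - τ₀ s) ^ 2) atTop
      (𝓝 0))
    (t₁ : Tendsto (fun k => ∫ s in Set.Icc (0 : ℝ) 1, (F₁ k (a + s • (b - a)) - τ₁ s) ^ 2) atTop
      (𝓝 0)) :
    Tendsto (fun k => lineInt (F₀ k) (F₁ k) a b) atTop
      (𝓝 (∫ s in Set.Icc (0 : ℝ) 1, (τ₀ s * (b 0 - a 0) + τ₁ s * (b 1 - a 1)))) := by
  have hone : ∀ r : ℝ, MemLp (fun _ : ℝ => r) 2 (volume.restrict (Set.Icc (0 : ℝ) 1)) :=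
    fun r => memLp_const r
  have key : ∀ {F : ℕ → Plane → ℝ} {τ : ℝ → ℝ} (r : ℝ), (∀ k, Continuous (F k)) →
      MemLp τ 2 (volume.restrict (Set.Icc (0 : ℝ) 1)) →
      Tendsto (fun k => ∫ s in Set.Icc (0 : ℝ) 1, (F k (a + s • (b - a)) - τ s) ^ 2) atTop
        (𝓝 0) → Tendsto (fun k => ∫ s in Set.Icc (0 : ℝ) 1, F k (a + s • (b - a)) * r) atTop
        (𝓝 (∫ s in Set.Icc (0 : ℝ) 1, τ s * r)) := by
    intro F τ r hF hτ ht
    refine tendsto_integral_mul hτ (hone r) (fun k => memLp_edge (hF k) a b)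
      (fun _ => hone r) ?_ (by simp)
    exact (tendsto_eLpNorm_two_iff fun k => (memLp_edge (hF k) a b).sub hτ).2 ht
  have hsum := (key (b 0 - a 0) h₀ m₀ t₀).add (key (b 1 - a 1) h₁ m₁ t₁)
  have hi : ∀ {τ : ℝ → ℝ} (r : ℝ), MemLp τ 2 (volume.restrict (Set.Icc (0 : ℝ) 1)) →
      Integrable (fun s => τ s * r) (volume.restrict (Set.Icc (0 : ℝ) 1)) := fun r hτ =>
    (hτ.integrable (by norm_num)).mul_const r
  rw [← integral_add (hi _ m₀) (hi _ m₁)] at hsum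
  refine hsum.congr fun k => ?_
  rw [← integral_add (hi _ (memLp_edge (h₀ k) a b)) (hi _ (memLp_edge (h₁ k) a b)),
    integral_Icc_eq, lineInt]

variable {u : Plane → Plane} {G : Fin 2 → Fin 2 → Plane → ℝ} {F : Fin 2 → ℕ → Plane → ℝ}

lemma inner_plane (x y : Plane) : inner ℝ x y = x 0 * y 0 + x 1 * y 1 := by
  simp [PiLp.inner_apply, Fin.sum_univ_two, mul_comm]

/-- The tangential integral is the limit of those of smooth approximations. -/
lemma exists_isTangentialIntegral (ho : orient a b c ≠ 0)
    (hu : ∀ j, HasH1 (interior (convexHull ℝ {a, b, c})) (fun x => u x j) (G j))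
    (hF : ∀ j, SmoothApprox (interior (convexHull ℝ {a, b, c})) (fun x => u x j) (G j) (F j)) :
    ∃ m, IsTangentialIntegral (interior (convexHull ℝ {a, b, c})) a b u m ∧
      Tendsto (fun k => lineInt (F 0 k) (F 1 k) a b) atTop (𝓝 m) := by
  have hb := isBounded_triangle a b c
  have hF' := fun j => (hF j).of_measure_eq (Convex.restrict_interior (convex_convexHull ℝ _))
  choose τ hτ ht using fun j => (hF' j).exists_edge_limit ho
  set σ : ℝ → Plane := fun s => !₂[τ 0 s, τ 1 s] with hσ
  have hσm : MemLp σ 2 (volume.restrict (Set.Icc (0 : ℝ) 1)) := by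
    refine MemLp.of_eval_piLp fun j => ?_
    fin_cases j
    · exact hτ 0
    · exact hτ 1
  refine ⟨∫ s in Set.Icc (0 : ℝ) 1, (τ 0 s * (b 0 - a 0) + τ 1 s * (b 1 - a 1)),
    ⟨σ, ⟨fun j => (hu j).memH1, hσm, fun k x => !₂[F 0 k x, F 1 k x], fun k => ?_, fun j => ?_, ?_⟩,
      ?_⟩, ?_⟩
  · refine contDiff_euclidean.2 fun j => ?_
    fin_cases j
    · exact (hF 0).contDiff k
    · exact (hF 1).contDiff k
  · have := (hF j).tendsto_h1NormSq isOpen_interior (hb.subset interior_subset) (hu j)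
    fin_cases j <;> exact this
  · have hsum := (ht 0).add (ht 1)
    rw [add_zero] at hsum
    refine hsum.congr fun k => ?_
    have hi : ∀ j, Integrable (fun s => (F j k (a + s • (b - a)) - τ j s) ^ 2)
        (volume.restrict (Set.Icc (0 : ℝ) 1)) := fun j =>
      ((memLp_edge ((hF j).contDiff k).continuous a b).sub (hτ j)).integrable_sq
    rw [← integral_add (hi 0) (hi 1)]
    refine integral_congr_ae (Eventually.of_forall fun s => ?_)
    simp [norm_sq_plane, hσ]
  · refine integral_congr_ae (Eventually.of_forall fun s => ?_)
    simp [inner_plane, hσ]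
  · exact tendsto_lineInt (fun k => ((hF 0).contDiff k).continuous)
      (fun k => ((hF 1).contDiff k).continuous) (hτ 0) (hτ 1) (ht 0) (ht 1)

/-- The sequence that comes with a trace may be replaced by any other smooth approximation, because
both have the same limit on the edge. In particular the tangential integral is unique. -/
lemma IsTangentialIntegral.tendsto_lineInt (ho : orient a b c ≠ 0)
    (hu : ∀ j, HasH1 (interior (convexHull ℝ {a, b, c})) (fun x => u x j) (G j))
    (hF : ∀ j, SmoothApprox (interior (convexHull ℝ {a, b, c})) (fun x => u x j) (G j) (F j))
    {m : ℝ} (hm : IsTangentialIntegral (interior (convexHull ℝ {a, b, c})) a b u m) :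
    Tendsto (fun k => lineInt (F 0 k) (F 1 k) a b) atTop (𝓝 m) := by
  have hb := isBounded_triangle a b c
  have hK := Convex.restrict_interior (convex_convexHull ℝ ({a, b, c} : Set Plane))
  obtain ⟨σ, ⟨-, hσ, Ψ, hΨc, hΨ, hΨσ⟩, rfl⟩ := hm
  have hΨj : ∀ j k, ContDiff ℝ ∞ fun x => Ψ k x j := fun j k => contDiff_euclidean.1 (hΨc k) j
  have hΨS : ∀ j, SmoothApprox (interior (convexHull ℝ {a, b, c})) (fun x => u x j) (G j)
      fun k x => Ψ k x j := fun j =>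
    SmoothApprox.of_h1NormSq isOpen_interior (hb.subset interior_subset) (hu j) (hΨj j) (hΨ j)
  have hσj : ∀ j, MemLp (fun s => σ s j) 2 (volume.restrict (Set.Icc (0 : ℝ) 1)) := fun j =>
    hσ.eval_piLp j
  have hΨσj : ∀ j, Tendsto (fun k => ∫ s in Set.Icc (0 : ℝ) 1,
      (Ψ k (a + s • (b - a)) j - σ s j) ^ 2) atTop (𝓝 0) := by
    intro j
    have hi := fun k j => ((memLp_edge (hΨj j k).continuous a b).sub (hσj j)).integrable_sq
    refine squeeze_zero (fun k => integral_nonneg fun x => sq_nonneg _) (fun k => ?_) hΨσ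
    have e : ∀ s, ‖Ψ k (a + s • (b - a)) - σ s‖ ^ 2 = (Ψ k (a + s • (b - a)) 0 - σ s 0) ^ 2
        + (Ψ k (a + s • (b - a)) 1 - σ s 1) ^ 2 := fun s => by simp [norm_sq_plane]
    simp only [e]
    refine integral_mono (hi k j) ((hi k 0).add (hi k 1)) fun s => ?_
    have n0 := sq_nonneg (Ψ k (a + s • (b - a)) 0 - σ s 0)
    have n1 := sq_nonneg (Ψ k (a + s • (b - a)) 1 - σ s 1)
    fin_cases j <;> simpa using by linarith
  have key : ∀ j, Tendsto (fun k => ∫ s in Set.Icc (0 : ℝ) 1,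
      (F j k (a + s • (b - a)) - σ s j) ^ 2) atTop (𝓝 0) := by
    intro j
    have h1 := ((hF j).of_measure_eq hK).tendsto_edge_sub ho ((hΨS j).of_measure_eq hK)
    have hlim := (h1.const_mul 2).add ((hΨσj j).const_mul 2)
    simp only [mul_zero, add_zero] at hlim
    refine squeeze_zero (fun k => integral_nonneg fun x => sq_nonneg _) (fun k => ?_) hlim
    have := integral_sub_sq_le_two_mul (memLp_edge ((hF j).contDiff k).continuous a b) (hσj j)
      (memLp_edge (hΨj j k).continuous a b)
    refine this.trans (le_of_eq ?_)
    congr 2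
    refine integral_congr_ae (Eventually.of_forall fun s => ?_)
    simp only
    ring
  have := EdgeVEM.tendsto_lineInt (fun k => ((hF 0).contDiff k).continuous)
      (fun k => ((hF 1).contDiff k).continuous) (hσj 0) (hσj 1) (key 0) (key 1)
  simpa [inner_plane] using this

end Edge

/-! ### Degrees of freedom -/

/-- This admits edge means that vary with k into linear combinations of approximating sequences. -/
lemma smoothApprox_const_seq {D : Set Plane} (hb : Bornology.IsBounded D) {L : ℕ → ℝ} {U : ℝ}
    (h : Tendsto L atTop (𝓝 U)) :
    SmoothApprox D (fun _ => U) (fun _ _ => 0) fun k _ => L k := by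
  have hm : ∀ r : ℝ, MemLp (fun _ : Plane => r) 2 (volume.restrict D) := fun r =>
    memLp_two_of_continuous hb continuous_const
  refine ⟨hm U, fun _ => hm 0, fun _ => contDiff_const, ?_, fun i => ?_⟩
  · refine (tendsto_eLpNorm_two_iff fun k => (hm (L k)).sub (hm U)).2 ?_
    have := (((h.sub_const U).pow 2).const_mul ((volume.restrict D).real Set.univ))
    simpa using this
  · have : ∀ k, pderiv i (fun _ : Plane => L k) = 0 := fun k => by
      ext x; simp [pderiv]
    simp only [this]
    have h0 : (0 : Plane → ℝ) - (fun _ => 0) = 0 := by ext; simp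
    simp only [h0, eLpNorm_zero]
    exact tendsto_const_nhds

/-- The trace version of the Poincaré inequality, for the tangential component on an edge. -/
lemma integral_tangential_sub_sq_le {a b c : Plane} (ho : orient a b c ≠ 0) {h : ℝ}
    (hh : ∀ x ∈ convexHull ℝ {a, b, c}, ∀ y ∈ convexHull ℝ {a, b, c}, ‖x - y‖ ≤ h)
    {u : Plane → Plane} {G : Fin 2 → Fin 2 → Plane → ℝ} {F : Fin 2 → ℕ → Plane → ℝ}
    (hF : ∀ j, SmoothApprox (convexHull ℝ {a, b, c}) (fun x => u x j) (G j) (F j)) {m : ℝ}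
    (hm : Tendsto (fun k => lineInt (F 0 k) (F 1 k) a b) atTop (𝓝 m)) :
    ∫ x in convexHull ℝ {a, b, c}, (inner ℝ (u x) (b - a) - m) ^ 2
      ≤ 21 * h ^ 2 * (‖b - a‖ ^ 2 * ∫ x in convexHull ℝ {a, b, c},
        (G 0 0 x ^ 2 + G 0 1 x ^ 2 + G 1 0 x ^ 2 + G 1 1 x ^ 2)) := by
  set K := convexHull ℝ {a, b, c} with hK
  have hb : Bornology.IsBounded K := isBounded_triangle a b c
  set e := b - a with he
  -- The scalar function e·u is approximated by e·F, whose mean over the edge is `lineInt`. By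
  -- Cauchy-Schwarz its squared gradient is at most ‖e‖² times that of u.
  have h1 := (hF 0).lincomb (hF 1) (e 0) (e 1)
  have h2 := (h1.lincomb (smoothApprox_const_seq hb hm) 1 (-1)).tendsto_integral_sq hb
  have h3 := (h1.tendsto_integral_gradSq hb).const_mul (21 * h ^ 2)
  have key := le_of_tendsto_of_tendsto' h2 h3 fun k => ?_
  · have e1 : ∀ x, (inner ℝ (u x) e - m) ^ 2
        = (1 * (e 0 * u x 0 + e 1 * u x 1) + -1 * m) ^ 2 := fun x => by
      rw [inner_plane]; ring
    simp only [e1]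
    refine key.trans (mul_le_mul_of_nonneg_left ?_ (by positivity))
    rw [← integral_const_mul]
    have i := fun j l => ((hF j).partial_memLp l).integrable_sq
    refine integral_mono ((h1.partial_memLp 0).integrable_sq.add (h1.partial_memLp 1).integrable_sq)
      (((((i 0 0).add (i 0 1)).add (i 1 0)).add (i 1 1)).const_mul _) fun x => ?_
    simp only [norm_sq_plane]
    nlinarith [sq_nonneg (e 0 * G 1 0 x - e 1 * G 0 0 x), sq_nonneg (e 0 * G 1 1 x - e 1 * G 0 1 x)]
  · have := integral_sub_edge_mean_sq_le (h1.contDiff_one k) ho hh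
    refine le_trans (le_of_eq ?_) this
    refine integral_congr_ae (Eventually.of_forall fun x => ?_)
    have e2 : lineInt (F 0 k) (F 1 k) a b = ∫ s in (0 : ℝ)..1,
        (e 0 * F 0 k (a + s • (b - a)) + e 1 * F 1 k (a + s • (b - a))) := by
      rw [lineInt]
      congr 1; ext s
      simp only [he, PiLp.sub_apply]; ring
    simp only [e2]
    ring

namespace IsTriangulation

lemma exists_cell_eq (hT : IsTriangulation p P T) {t} (ht : t ∈ T) {i j : Fin (n + 3)}
    (hi : i ∈ t) (hj : j ∈ t) (hij : i ≠ j) :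
    ∃ k ∈ t, k ≠ i ∧ k ≠ j ∧ cell p t = convexHull ℝ {p i, p j, p k} ∧
      orient (p i) (p j) (p k) ≠ 0 := by
  obtain ⟨k, hki, hkj, htt⟩ := exists_third (hT.card_eq t ht) hi hj hij
  have hk : k ∈ t := by simp [htt]
  refine ⟨k, hk, hki, hkj, ?_, hT.orient_ne_zero ht hi hj hk hij hki.symm hkj.symm⟩
  rw [← cell_triple, ← htt]

lemma restrict_interior_cell (t : Finset (Fin (n + 3))) :
    volume.restrict (interior (cell p t)) = volume.restrict (cell p t) :=
  Convex.restrict_interior (convex_convexHull ℝ _)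

lemma isTangentialIntegral_ned (hT : IsTriangulation p P T) {t} (ht : t ∈ T) {i j : Fin (n + 3)}
    (hi : i ∈ t) (hj : j ∈ t) (hij : i ≠ j) {v : Plane → Plane} {a : Plane} {b : ℝ}
    (hv : ∀ᵐ x ∂(volume.restrict (cell p t)), v x = a + b • !₂[x 1, -x 0]) (m : ℝ) :
    IsTangentialIntegral (interior (cell p t)) (p i) (p j) v m ↔ m = nedDof a b (p i) (p j) := by
  obtain ⟨k, -, -, -, hc, ho⟩ := hT.exists_cell_eq ht hi hj hij
  have hb : Bornology.IsBounded (interior (cell p t)) :=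
    (isCompact_cell t).isBounded.subset interior_subset
  rw [← restrict_interior_cell] at hv
  set φ : Fin 2 → Plane → ℝ := ![fun z => b * z 1 + a 0, fun z => -b * z 0 + a 1] with hφ
  have hφc : ∀ l, ContDiff ℝ ∞ (φ l) := fun l => by
    fin_cases l
    · exact contDiff_affine 1 b (a 0)
    · exact contDiff_affine 0 (-b) (a 1)
  have hvφ : ∀ l, (fun x => v x l) =ᵐ[volume.restrict (interior (cell p t))] φ l := fun l => by
    filter_upwards [hv] with x hx
    rw [hx]
    fin_cases l <;> simp [hφ, add_comm]
  have hS := fun l => smoothApprox_const hb (hφc l) (hvφ l)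
  have hH : ∀ l, HasH1 (interior (cell p t)) (fun x => v x l) fun q => pderiv q (φ l) := fun l =>
    (hasH1_of_contDiff hb ((hφc l).of_le (by exact_mod_cast le_top))).congr (hvφ l).symm
      fun q => EventuallyEq.rfl
  have hline : lineInt (φ 0) (φ 1) (p i) (p j) = nedDof a b (p i) (p j) := by
    have := lineInt_ned (fun _ => 1) a b (p i) (p j)
    simpa [segMean, hφ] using this
  rw [hc] at hS hH ⊢
  constructor
  · intro hm
    have := hm.tendsto_lineInt ho hH hS
    rw [hline] at this
    exact tendsto_nhds_unique this tendsto_const_nhds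
  · rintro rfl
    obtain ⟨m, hm, ht⟩ := exists_isTangentialIntegral ho hH hS
    rw [hline] at ht
    rwa [tendsto_nhds_unique ht tendsto_const_nhds] at hm

lemma tendsto_circulation {t : Finset (Fin (n + 3))} {X : ℕ → Fin (n + 3) → Fin (n + 3) → ℝ}
    {Y : Fin (n + 3) → Fin (n + 3) → ℝ}
    (h : ∀ i ∈ t, ∀ j ∈ t, Tendsto (fun k => X k i j) atTop (𝓝 (Y i j))) :
    Tendsto (fun k => circulation p t (X k)) atTop (𝓝 (circulation p t Y)) := by
  unfold circulation
  refine Tendsto.const_mul _ (tendsto_finsetSum _ fun i _ => tendsto_finsetSum _ fun j _ => ?_)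
  by_cases hij : i ∈ t ∧ j ∈ t
  · exact (h i hij.1 j hij.2).const_mul _
  · simp only [edgeSign, if_neg hij, zero_mul]
    exact tendsto_const_nhds

/-- The tangential integrals of an `H¹` field on the edges of the triangulation. -/
lemma exists_tangential_dofs (hT : IsTriangulation p P T) {D : Set Plane} (hD : IsOpen D)
    (hconv : Convex ℝ D) (hne : D.Nonempty) (hPD : interior P ⊆ D) {h : ℝ}
    (hh : ∀ x ∈ P, ∀ y ∈ P, ‖x - y‖ ≤ h)
    {u : Plane → Plane} {G : Fin 2 → Fin 2 → Plane → ℝ}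
    (hu : ∀ j, HasH1 D (fun x => u x j) (G j)) :
    ∃ U : Fin (n + 3) → Fin (n + 3) → ℝ, (∀ a b, U b a = - U a b) ∧
      (∀ t ∈ T, circulation p t U = ∫ x in cell p t, (G 1 0 x - G 0 1 x)) ∧
      ∀ t ∈ T, ∀ i ∈ t, ∀ j ∈ t, i ≠ j →
        (∀ m, IsTangentialIntegral (interior (cell p t)) (p i) (p j) u m ↔ m = U i j) ∧
        ∫ x in cell p t, (inner ℝ (u x) (p j - p i) - U i j) ^ 2
          ≤ 21 * h ^ 2 * (‖p j - p i‖ ^ 2 * ∫ x in cell p t,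
            (G 0 0 x ^ 2 + G 0 1 x ^ 2 + G 1 0 x ^ 2 + G 1 1 x ^ 2)) := by
  classical
  choose F hF using fun j => (hu j).exists_smoothApprox hD hconv hne
  have hcD : ∀ t ∈ T, interior (cell p t) ⊆ D := fun t ht =>
    (interior_mono (hT.cell_subset ht)).trans hPD
  have hFi : ∀ t ∈ T, ∀ j, SmoothApprox (interior (cell p t)) (fun x => u x j) (G j) (F j) :=
    fun t ht j => (hF j).mono (hcD t ht)
  have hFc : ∀ t ∈ T, ∀ j, SmoothApprox (cell p t) (fun x => u x j) (G j) (F j) :=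
    fun t ht j => (hFi t ht j).of_measure_eq (restrict_interior_cell t)
  have hui : ∀ t ∈ T, ∀ j, HasH1 (interior (cell p t)) (fun x => u x j) (G j) :=
    fun t ht j => (hu j).mono (hcD t ht)
  set L : Fin (n + 3) → Fin (n + 3) → ℕ → ℝ := fun i j k => lineInt (F 0 k) (F 1 k) (p i) (p j)
    with hL
  -- One approximating sequence on D serves all triangles, so U i j is the same from both sides of
  -- an edge. For pairs without a limit the default value 0 keeps U antisymmetric.
  set U : Fin (n + 3) → Fin (n + 3) → ℝ := fun i j =>
    if h : ∃ m, Tendsto (L i j) atTop (𝓝 m) then h.choose else 0 with hU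
  have hLU : ∀ {i j m}, Tendsto (L i j) atTop (𝓝 m) → U i j = m := fun {i j m} hm => by
    have hex : ∃ m, Tendsto (L i j) atTop (𝓝 m) := ⟨m, hm⟩
    simp only [hU, dif_pos hex]
    exact tendsto_nhds_unique hex.choose_spec hm
  have hswap : ∀ i j k, L j i k = - L i j k := fun i j k => lineInt_swap _ _ _ _
  have hUswap : ∀ a b, U b a = - U a b := by
    intro a b
    by_cases hab : ∃ m, Tendsto (L a b) atTop (𝓝 m)
    · obtain ⟨m, hm⟩ := hab
      rw [hLU hm]
      exact hLU (hm.neg.congr fun k => (hswap a b k).symm)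
    · have hba : ¬ ∃ m, Tendsto (L b a) atTop (𝓝 m) := by
        rintro ⟨m, hm⟩
        exact hab ⟨-m, hm.neg.congr fun k => (hswap b a k).symm⟩
      simp only [hU, dif_neg hab, dif_neg hba, neg_zero]
  have hlim : ∀ t ∈ T, ∀ i ∈ t, ∀ j ∈ t, i ≠ j →
      IsTangentialIntegral (interior (cell p t)) (p i) (p j) u (U i j) ∧
        Tendsto (L i j) atTop (𝓝 (U i j)) := by
    intro t ht i hi j hj hij
    obtain ⟨k, -, -, -, hc, ho⟩ := hT.exists_cell_eq ht hi hj hij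
    have hu' := hui t ht
    have hF' := hFi t ht
    rw [hc] at hu' hF' ⊢
    obtain ⟨m, hm, hmt⟩ := exists_isTangentialIntegral ho hu' hF'
    rw [hLU hmt]
    exact ⟨hm, hmt⟩
  refine ⟨U, hUswap, fun t ht => ?_, fun t ht i hi j hj hij => ⟨fun m => ⟨fun hm => ?_, ?_⟩, ?_⟩⟩
  · have hc1 := tendsto_circulation (p := p) (t := t) (X := fun k i j => L i j k) (Y := U)
      fun i hi j hj => by
        rcases eq_or_ne i j with rfl | hij
        · have h0 : ∀ k, L i i k = 0 := fun k => by linarith [hswap i i k]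
          have h1 : U i i = 0 := by linarith [hUswap i i]
          simp only [h0, h1]
          exact tendsto_const_nhds
        · exact (hlim t ht i hi j hj hij).2
    have hb : Bornology.IsBounded (cell p t) := (isCompact_cell t).isBounded
    have i2 : ∀ j l k, IntegrableOn (pderiv l (F j k)) (cell p t) := fun j l k =>
      integrableOn_of_continuous hb (pderiv_continuous ((hF j).contDiff_one k) l)
    have : IsFiniteMeasure (volume.restrict (cell p t)) :=
      ⟨by simpa using (isCompact_cell t).measure_lt_top⟩
    have hc2 := ((hFc t ht 1).tendsto_integral_pderiv hb 0).sub
      ((hFc t ht 0).tendsto_integral_pderiv hb 1)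
    rw [← integral_sub (((hFc t ht 1).partial_memLp 0).integrable (by norm_num))
      (((hFc t ht 0).partial_memLp 1).integrable (by norm_num))] at hc2
    refine tendsto_nhds_unique hc1 (hc2.congr fun k => ?_)
    rw [← integral_sub (i2 1 0 k) (i2 0 1 k)]
    exact hT.integral_curl_cell ht ((hF 0).contDiff_one k) ((hF 1).contDiff_one k)
  · obtain ⟨k, -, -, -, hc, ho⟩ := hT.exists_cell_eq ht hi hj hij
    have hu' := hui t ht
    have hF' := hFi t ht
    rw [hc] at hu' hF' hm
    exact tendsto_nhds_unique (hm.tendsto_lineInt ho hu' hF') (hlim t ht i hi j hj hij).2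
  · rintro rfl
    exact (hlim t ht i hi j hj hij).1
  · obtain ⟨k, -, -, -, hc, ho⟩ := hT.exists_cell_eq ht hi hj hij
    have hF' := hFc t ht
    have hsub := hT.cell_subset ht
    rw [hc] at hF' hsub ⊢
    exact integral_tangential_sub_sq_le ho (fun x hx y hy => hh x (hsub hx) y (hsub hy)) hF'
      (hlim t ht i hi j hj hij).2

end IsTriangulation

/-! ### Piecewise Nédélec fields -/

lemma IsSimplePolygon.segMean_eq_zero (hP : IsSimplePolygon p P) {φ : Plane → ℝ}
    (hφ : tsupport φ ⊆ interior P) (i : Fin (n + 3)) : segMean φ (p i) (p (i + 1)) = 0 := by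
  unfold segMean
  rw [intervalIntegral.integral_congr (g := fun _ => (0 : ℝ)) fun s hs => ?_]
  · simp
  · rw [Set.uIcc_of_le zero_le_one] at hs
    by_contra h
    exact (hP.edge_subset_frontier i hs).2 (hφ (subset_tsupport _ h))

lemma IsSimplePolygon.volume_real_pos (hP : IsSimplePolygon p P) : 0 < volume.real P := by
  refine ENNReal.toReal_pos ?_ hP.isCompact.measure_lt_top.ne
  exact (lt_of_lt_of_le (isOpen_interior.measure_pos volume hP.interior_nonempty)
    (measure_mono interior_subset)).ne'

namespace IsTriangulation

lemma sum_volume_real (hP : IsSimplePolygon p P) (hT : IsTriangulation p P T) :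
    ∑ t ∈ T, volume.real (cell p t) = volume.real P := by
  have := hT.integral_eq_sum (f := fun _ => (1 : ℝ))
    (integrableOn_of_continuous hP.isCompact.isBounded continuous_const)
  simpa using this.symm

lemma circulation_nedDof (hT : IsTriangulation p P T) {t} (ht : t ∈ T) (a : Plane) (b : ℝ) :
    circulation p t (fun i j => nedDof a b (p i) (p j)) = -2 * b * volume.real (cell p t) := by
  have := hT.integral_ned_mul ht (ψ := fun _ => 1) contDiff_const a b
  have h0 : ∀ l x, pderiv l (fun _ : Plane => (1 : ℝ)) x = 0 := fun l x => by simp [pderiv]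
  simp only [h0, mul_zero, sub_zero, integral_zero, segMean] at this
  simp at this
  linarith

/-- The weak curl of a piecewise Nédélec field, tested with `φ`. -/
lemma integral_piecewise_ned (hT : IsTriangulation p P T) {v : Plane → Plane}
    {a : Finset (Fin (n + 3)) → Plane} {b : Finset (Fin (n + 3)) → ℝ}
    (hv : ∀ t ∈ T, ∀ᵐ x ∂(volume.restrict (cell p t)), v x = a t + b t • !₂[x 1, -x 0])
    {φ : Plane → ℝ} (hφ : IsTestFunction (interior P) φ) :
    ∫ x in interior P, (v x 0 * pderiv 1 φ x - v x 1 * pderiv 0 φ x)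
      = ∑ t ∈ T, (-2 * b t * (∫ x in cell p t, φ x)
        - circulation p t (fun i j => nedDof (a t) (b t) (p i) (p j) * segMean φ (p i) (p j))) := by
  have h1 := hφ.contDiff_one
  have h0 : ∀ l, ∀ x ∉ interior P, pderiv l φ x = 0 := fun l x hx => by
    by_contra h
    exact hx (hφ.2.2 (tsupport_pderiv_subset φ l (subset_tsupport _ h)))
  have hPm : MeasurableSet P := by
    rw [← hT.iUnion_eq]
    exact Finset.measurableSet_biUnion _ fun t _ => measurableSet_cell t
  have e : ∀ t ∈ T, (fun x => v x 0 * pderiv 1 φ x - v x 1 * pderiv 0 φ x)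
      =ᵐ[volume.restrict (cell p t)] fun x => (a t 0 + b t * x 1) * pderiv 1 φ x
        - (a t 1 - b t * x 0) * pderiv 0 φ x := fun t ht => by
    filter_upwards [hv t ht] with x hx
    rw [hx]
    simp [sub_eq_add_neg]
  have hint : IntegrableOn (fun x => v x 0 * pderiv 1 φ x - v x 1 * pderiv 0 φ x) P := by
    rw [← hT.iUnion_eq]
    refine integrableOn_finset_iUnion.2 fun t ht => Integrable.congr ?_ (e t ht).symm
    have := pderiv_continuous h1 0
    have := pderiv_continuous h1 1
    exact integrableOn_of_continuous (isCompact_cell t).isBounded (by fun_prop)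
  rw [← setIntegral_eq_of_subset_of_forall_sdiff_eq_zero hPm interior_subset
    (fun x hx => by rw [h0 1 x hx.2, h0 0 x hx.2]; simp), hT.integral_eq_sum hint]
  refine Finset.sum_congr rfl fun t ht => ?_
  rw [integral_congr_ae (e t ht)]
  exact hT.integral_ned_mul ht h1 (a t) (b t)

lemma pieceConst_ae_eq (hT : IsTriangulation p P T) (a : Finset (Fin (n + 3)) → Plane) {t}
    (ht : t ∈ T) : ∀ᵐ x ∂(volume.restrict (cell p t)), ∀ m, pieceConst p T a m x = a t m := by
  filter_upwards [ae_restrict_of_ae hT.ae_eq_of_mem_cell, ae_restrict_mem (measurableSet_cell t)]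
    with x hx hxt m
  rw [pieceConst, Finset.sum_eq_single_of_mem t ht]
  · simp [hxt]
  · exact fun r hr hrt => Set.indicator_of_notMem (fun hxr => hrt (hx r hr t ht hxr hxt)) _

/-- A piecewise Nédélec field with matching tangential components has a constant weak curl. -/
lemma isWeakCurl_of_nedDof_eq (hP : IsSimplePolygon p P) (hT : IsTriangulation p P T)
    {v : Plane → Plane} (hvl : LocallyIntegrableOn v (interior P))
    {a : Finset (Fin (n + 3)) → Plane} {b : ℝ}
    (hv : ∀ t ∈ T, ∀ᵐ x ∂(volume.restrict (cell p t)), v x = a t + b • !₂[x 1, -x 0])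
    {X : Fin (n + 3) → Fin (n + 3) → ℝ}
    (hX : ∀ t ∈ T, ∀ i ∈ t, ∀ j ∈ t, nedDof (a t) b (p i) (p j) = X i j) :
    IsWeakCurl (interior P) v fun _ => -2 * b := by
  refine ⟨hvl, (locallyIntegrable_const _).locallyIntegrableOn _, fun φ hφ => ?_⟩
  have h0 : ∀ x ∉ interior P, φ x = 0 := fun x hx => by
    by_contra h
    exact hx (hφ.2.2 (subset_tsupport _ h))
  obtain ⟨ε, -, hε⟩ := hT.exists_orientation hP
  -- Interior edges cancel because the tangential components match; on boundary edges the test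
  -- function vanishes.
  have hc : ∑ t ∈ T, circulation p t (fun i j => nedDof (a t) b (p i) (p j)
      * segMean φ (p i) (p j)) = 0 := by
    rw [Finset.sum_congr rfl fun t ht => circulation_congr (p := p) (t := t)
      (Y := fun i j => X i j * segMean φ (p i) (p j)) fun i hi j hj => by rw [hX t ht i hi j hj],
      hT.sum_circulation hP hε]
    simp [segMean_swap φ (p _) (p (_ + 1)), hP.segMean_eq_zero hφ.2.2]
  rw [hT.integral_piecewise_ned hv hφ, Finset.sum_sub_distrib, hc, sub_zero, ← Finset.mul_sum,
    ← hT.integral_eq_sum (integrableOn_of_continuous hP.isCompact.isBounded hφ.1.continuous),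
    integral_const_mul, ← setIntegral_eq_of_subset_of_forall_sdiff_eq_zero
      hP.isCompact.isClosed.measurableSet interior_subset fun x hx => h0 x hx.2]

end IsTriangulation

/-- A function on the cyclic vertices with prescribed differences that sum to zero. -/
lemma exists_potential (Y : Fin (n + 3) → ℝ) (hY : ∑ i, Y i = 0) :
    ∃ φ : Fin (n + 3) → ℝ, ∀ i, φ (i + 1) - φ i = Y i := by
  refine ⟨fun j => ∑ k ∈ Finset.range j.1, Y (Fin.ofNat (n + 3) k), fun i => ?_⟩
  have hof : ∀ i : Fin (n + 3), Fin.ofNat (n + 3) i.1 = i := fun i => by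
    ext; simp
  by_cases hi : i.1 + 1 < n + 3
  · have h1 : (i + 1).1 = i.1 + 1 := by
      rw [Fin.val_add, Fin.val_one, Nat.mod_eq_of_lt hi]
    simp only [h1, Finset.sum_range_succ, hof]
    ring
  -- At the last vertex the index wraps around to 0, and the required difference is minus the sum of
  -- all the others: this is where the vanishing total sum enters.
  · have h2 : i.1 + 1 = n + 3 := by omega
    have h1 : (i + 1).1 = 0 := by
      rw [Fin.val_add, Fin.val_one, h2, Nat.mod_self]
    have h3 : ∑ k ∈ Finset.range (i.1 + 1), Y (Fin.ofNat (n + 3) k) = 0 := by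
      rw [h2, Finset.sum_range, ← hY]
      exact Finset.sum_congr rfl fun j _ => by rw [hof]
    rw [Finset.sum_range_succ, hof] at h3
    simp only [h1, Finset.range_zero, Finset.sum_empty]
    linarith

namespace IsTriangulation

/-- The interpolant with prescribed degrees of freedom on the boundary. -/
lemma exists_interpolant (hP : IsSimplePolygon p P) (hT : IsTriangulation p P T)
    {U : Fin (n + 3) → Fin (n + 3) → ℝ} (hU : ∀ a b, U b a = - U a b) {c : Plane → ℝ}
    (hc : IntegrableOn c P) (hUc : ∀ t ∈ T, circulation p t U = ∫ x in cell p t, c x) :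
    ∃ (κ : ℝ) (a : Finset (Fin (n + 3)) → Plane) (X : Fin (n + 3) → Fin (n + 3) → ℝ)
      (v : Plane → Plane), κ * volume.real P = ∫ x in P, c x ∧
      (∀ a b, X b a = - X a b) ∧ (∀ i, X i (i + 1) = U i (i + 1)) ∧
      (∀ t ∈ T, circulation p t X = κ * volume.real (cell p t)) ∧
      (∀ t ∈ T, ∀ i ∈ t, ∀ j ∈ t, nedDof (a t) (-κ / 2) (p i) (p j) = X i j) ∧
      (∀ t ∈ T, ∀ᵐ x ∂(volume.restrict (cell p t)), v x = a t + (-κ / 2) • !₂[x 1, -x 0]) ∧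
      MemLp v 2 (volume.restrict (interior P)) ∧ IsWeakCurl (interior P) v fun _ => κ := by
  have hV := hP.volume_real_pos
  obtain ⟨ε, hε1, hε⟩ := hT.exists_orientation hP
  set κ := (∫ x in P, c x) / volume.real P with hκ
  have hκV : κ * volume.real P = ∫ x in P, c x := div_mul_cancel₀ _ hV.ne'
  set b := -κ / 2 with hb
  -- With b = -κ/2 the rotation field has curl κ. The total circulation of U over the triangles is
  -- the integral of c, that is κ|P|, which the rotation field also has. The boundary sum of the
  -- difference is therefore zero.
  have hY : ∑ i, (U i (i + 1) - nedDof 0 b (p i) (p (i + 1))) = 0 := by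
    have h1 : ∑ t ∈ T, circulation p t (fun i j => U i j + -1 * nedDof 0 b (p i) (p j)) = 0 := by
      simp only [circulation_add_smul]
      rw [Finset.sum_add_distrib, ← Finset.mul_sum,
        Finset.sum_congr rfl fun t ht => hT.circulation_nedDof ht 0 b, ← Finset.mul_sum,
        hT.sum_volume_real hP, Finset.sum_congr rfl hUc, ← hT.integral_eq_sum hc, ← hκV, hb]
      ring
    rw [hT.sum_circulation hP hε] at h1
    have hε0 : ε ≠ 0 := by rintro rfl; norm_num at hε1
    have h2 := (mul_eq_zero.1 h1).resolve_left (by simpa using hε0)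
    have h3 : ∀ i, U i (i + 1) + -1 * nedDof 0 b (p i) (p (i + 1))
        - (U (i + 1) i + -1 * nedDof 0 b (p (i + 1)) (p i))
        = 2 * (U i (i + 1) - nedDof 0 b (p i) (p (i + 1))) := fun i => by
      rw [hU i (i + 1), nedDof_swap 0 b (p i)]; ring
    simp only [h3, ← Finset.mul_sum] at h2
    linarith
  -- Since every vertex of the triangulation is a vertex of the polygon, the boundary data alone
  -- give a value at every vertex, and thereby a value on every interior edge.
  obtain ⟨φ, hφ⟩ := exists_potential _ hY
  have hcφ : ∀ t ∈ T, circulation p t (fun i j => φ j - φ i) = 0 := fun t ht => by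
    obtain ⟨i, j, k, hij, hik, hjk, htt⟩ := Finset.card_eq_three.1 (hT.card_eq t ht)
    rw [circulation_eq htt hij hik hjk fun a b => by ring]
    ring
  choose! a ha using fun t ht => hT.exists_nedDof_eq (t := t) ht (X := fun i j => φ j - φ i)
    (fun a b => by ring) (hcφ t ht)
  set X : Fin (n + 3) → Fin (n + 3) → ℝ := fun i j => φ j - φ i + 1 * nedDof 0 b (p i) (p j)
    with hX
  set v : Plane → Plane := fun x =>
    !₂[pieceConst p T a 0 x + b * x 1, pieceConst p T a 1 x + -b * x 0] with hv
  have hdof : ∀ t ∈ T, ∀ i ∈ t, ∀ j ∈ t, nedDof (a t) b (p i) (p j) = X i j :=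
    fun t ht i hi j hj => by
      simp only [hX, ← ha t ht i hi j hj]
      simp [nedDof]
  have hvae : ∀ t ∈ T, ∀ᵐ x ∂(volume.restrict (cell p t)), v x = a t + b • !₂[x 1, -x 0] := by
    intro t ht
    filter_upwards [hT.pieceConst_ae_eq a ht] with x hx
    ext l
    fin_cases l <;> simp [hv, hx]
  have hvm : MemLp v 2 (volume.restrict (interior P)) := by
    have hbd := hP.isCompact.isBounded.subset (interior_subset (s := P))
    have m : ∀ l, MemLp (pieceConst p T a l) 2 (volume.restrict (interior P)) := fun l =>
      (memLp_pieceConst a l).restrict _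
    have m1 : ∀ (l : Fin 2) (r : ℝ), MemLp (fun x : Plane => r * x l) 2
        (volume.restrict (interior P)) := fun l r =>
      memLp_two_of_continuous hbd (by fun_prop)
    refine memLp_plane fun l => ?_
    fin_cases l
    · exact (m 0).add (m1 1 b)
    · exact (m 1).add (m1 0 (-b))
  have hloc : LocallyIntegrableOn v (interior P) :=
    (locallyIntegrableOn_of_locallyIntegrable_restrict (hvm.locallyIntegrable (by norm_num)))
  refine ⟨κ, a, X, v, hκV, fun i j => ?_, fun i => ?_, fun t ht => ?_, hdof, hvae, hvm, ?_⟩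
  · simp only [hX, nedDof_swap 0 b (p i)]; ring
  · simp only [hX, hφ]; ring
  · simp only [hX, circulation_add_smul]
    rw [hcφ t ht, hT.circulation_nedDof ht 0 b, hb]
    ring
  · have := hT.isWeakCurl_of_nedDof_eq hP hloc hvae hdof
    rwa [show -2 * b = κ by rw [hb]; ring] at this

end IsTriangulation

/-! ### The interpolation error -/

/-- The sine is concave on [0, π], hence on [π/3, β] at least its minimum at the end points. The
maximum in β covers θ < π/3, where the range of α is empty. -/
lemma exists_le_sin {θ : ℝ} (hθ : θ < Real.pi) :
    ∃ s : ℝ, 0 < s ∧ ∀ α, Real.pi / 3 ≤ α → α ≤ θ → s ≤ Real.sin α := by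
  have hpi := Real.pi_pos
  set β := max θ (Real.pi / 3) with hβ
  have hβ1 : β < Real.pi := max_lt hθ (by linarith)
  have hβ0 : Real.pi / 3 ≤ β := le_max_right _ _
  refine ⟨min (Real.sin (Real.pi / 3)) (Real.sin β),
    lt_min (Real.sin_pos_of_pos_of_lt_pi (by linarith) (by linarith))
      (Real.sin_pos_of_pos_of_lt_pi (by linarith) hβ1), fun α h1 h2 => ?_⟩
  have hα : α ∈ segment ℝ (Real.pi / 3) β := by
    rw [segment_eq_Icc hβ0]
    exact ⟨h1, h2.trans (le_max_left _ _)⟩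
  exact strictConcaveOn_sin_Icc.concaveOn.min_le_of_mem_segment ⟨by linarith, by linarith⟩
    ⟨by linarith, hβ1.le⟩ hα

lemma sin_angle_sq_mul (x y : Plane) :
    Real.sin (InnerProductGeometry.angle x y) ^ 2 * (‖x‖ ^ 2 * ‖y‖ ^ 2)
      = (x 0 * y 1 - x 1 * y 0) ^ 2 := by
  have h := InnerProductGeometry.sin_angle_mul_norm_mul_norm x y
  have h1 : inner ℝ x x * inner ℝ y y - inner ℝ x y * inner ℝ x y
      = (x 0 * y 1 - x 1 * y 0) ^ 2 := by
    simp only [inner_plane]; ring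
  rw [h1, Real.sqrt_sq_eq_abs] at h
  rw [← mul_pow, ← mul_pow, h, sq_abs]

/-- Every triangle has a vertex at which its angle is neither small nor close to `π`. -/
lemma IsTriangulation.exists_good_vertex (hT : IsTriangulation p P T) {θ s : ℝ}
    (hθ : MaxAngleCondition p T θ) (hs : ∀ α, Real.pi / 3 ≤ α → α ≤ θ → s ≤ Real.sin α)
    (hs0 : 0 < s) {t} (ht : t ∈ T) :
    ∃ i ∈ t, ∃ j ∈ t, ∃ k ∈ t, i ≠ j ∧ k ≠ j ∧
      s ^ 2 * (‖p i - p j‖ ^ 2 * ‖p k - p j‖ ^ 2) ≤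
        ((p i - p j) 0 * (p k - p j) 1 - (p i - p j) 1 * (p k - p j) 0) ^ 2 := by
  have key : ∀ i ∈ t, ∀ j ∈ t, ∀ k ∈ t, i ≠ j → j ≠ k → i ≠ k →
      Real.pi / 3 ≤ EuclideanGeometry.angle (p i) (p j) (p k) →
      s ^ 2 * (‖p i - p j‖ ^ 2 * ‖p k - p j‖ ^ 2) ≤
        ((p i - p j) 0 * (p k - p j) 1 - (p i - p j) 1 * (p k - p j) 0) ^ 2 := by
    intro i hi j hj k hk hij hjk hik h
    rw [← sin_angle_sq_mul]
    have h1 := hs _ h (hθ t ht i hi j hj k hk hij hjk hik)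
    have h2 : Real.sin (EuclideanGeometry.angle (p i) (p j) (p k))
      = Real.sin (InnerProductGeometry.angle (p i - p j) (p k - p j)) := rfl
    rw [← h2]
    gcongr
  obtain ⟨i, j, k, hij, hik, hjk, htt⟩ := Finset.card_eq_three.1 (hT.card_eq t ht)
  have hi : i ∈ t := by simp [htt]
  have hj : j ∈ t := by simp [htt]
  have hk : k ∈ t := by simp [htt]
  have ho := hT.orient_ne_zero ht hi hj hk hij hik hjk
  have hne1 : p j ≠ p i := fun h => ho (by rw [h]; simp [orient])
  have hne2 : p k ≠ p i := fun h => ho (by rw [h]; simp [orient])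
  -- The angles add up to π, so one of them is at least π/3. The small angles of a thin triangle
  -- play no role.
  have hsum := EuclideanGeometry.angle_add_angle_add_angle_eq_pi (p k) hne1
  by_cases h1 : Real.pi / 3 ≤ EuclideanGeometry.angle (p i) (p j) (p k)
  · exact ⟨i, hi, j, hj, k, hk, hij, hjk.symm, key i hi j hj k hk hij hjk hik h1⟩
  by_cases h2 : Real.pi / 3 ≤ EuclideanGeometry.angle (p j) (p k) (p i)
  · exact ⟨j, hj, k, hk, i, hi, hjk, hik, key j hj k hk i hi hjk hik.symm hij.symm h2⟩
  · refine ⟨k, hk, i, hi, j, hj, hik.symm, hij.symm, key k hk i hi j hj hik.symm hij hjk.symm ?_⟩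
    linarith

/-- For vectors in the plane, det(e₁, e₂)² ‖r‖² = ‖(r·e₁) e₂ - (r·e₂) e₁‖². Two components in
directions with a determinant bounded below recover the whole vector, and the lengths of e₁ and e₂
cancel. -/
lemma sq_mul_integral_norm_sq_le {K : Set Plane} {r : Plane → Plane} {e₁ e₂ : Plane}
    (hr : MemLp r 2 (volume.restrict K)) (h₁ : e₁ ≠ 0) (h₂ : e₂ ≠ 0) {s B : ℝ}
    (hs : s ^ 2 * (‖e₁‖ ^ 2 * ‖e₂‖ ^ 2) ≤ (e₁ 0 * e₂ 1 - e₁ 1 * e₂ 0) ^ 2)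
    (b₁ : ∫ x in K, inner ℝ (r x) e₁ ^ 2 ≤ ‖e₁‖ ^ 2 * B)
    (b₂ : ∫ x in K, inner ℝ (r x) e₂ ^ 2 ≤ ‖e₂‖ ^ 2 * B) :
    s ^ 2 * ∫ x in K, ‖r x‖ ^ 2 ≤ 4 * B := by
  have hi : ∀ e : Plane, Integrable (fun x => inner ℝ (r x) e ^ 2) (volume.restrict K) :=
    fun e => (hr.inner_const e).integrable_sq
  have hn : Integrable (fun x => ‖r x‖ ^ 2) (volume.restrict K) := hr.norm.integrable_sq
  have p1 : 0 < ‖e₁‖ ^ 2 := by positivity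
  have p2 : 0 < ‖e₂‖ ^ 2 := by positivity
  have key : s ^ 2 * (‖e₁‖ ^ 2 * ‖e₂‖ ^ 2) * ∫ x in K, ‖r x‖ ^ 2
      ≤ 2 * ‖e₂‖ ^ 2 * (∫ x in K, inner ℝ (r x) e₁ ^ 2)
        + 2 * ‖e₁‖ ^ 2 * ∫ x in K, inner ℝ (r x) e₂ ^ 2 := by
    rw [← integral_const_mul, ← integral_const_mul, ← integral_const_mul,
      ← integral_add ((hi e₁).const_mul _) ((hi e₂).const_mul _)]
    refine integral_mono (hn.const_mul _) (((hi e₁).const_mul _).add ((hi e₂).const_mul _))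
      fun x => ?_
    refine (mul_le_mul_of_nonneg_right hs (sq_nonneg _)).trans ?_
    have e : (e₁ 0 * e₂ 1 - e₁ 1 * e₂ 0) ^ 2 * ‖r x‖ ^ 2
        = ‖inner ℝ (r x) e₁ • e₂ - inner ℝ (r x) e₂ • e₁‖ ^ 2 := by
      simp only [norm_sq_plane, inner_plane, PiLp.sub_apply, PiLp.smul_apply, smul_eq_mul]
      ring
    rw [e]
    have h := norm_sub_le (inner ℝ (r x) e₁ • e₂) (inner ℝ (r x) e₂ • e₁)
    rw [norm_smul, norm_smul] at h
    have h' := pow_le_pow_left₀ (norm_nonneg _) h 2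
    refine h'.trans ?_
    simp only [Real.norm_eq_abs]
    have s1 := sq_abs (inner ℝ (r x) e₁)
    have s2 := sq_abs (inner ℝ (r x) e₂)
    rw [← s1, ← s2]
    nlinarith [sq_nonneg (|inner ℝ (r x) e₁| * ‖e₂‖ - |inner ℝ (r x) e₂| * ‖e₁‖)]
  have q1 := mul_le_mul_of_nonneg_left b₁ (by positivity : 0 ≤ 2 * ‖e₂‖ ^ 2)
  have q2 := mul_le_mul_of_nonneg_left b₂ (by positivity : 0 ≤ 2 * ‖e₁‖ ^ 2)
  have q : (‖e₁‖ ^ 2 * ‖e₂‖ ^ 2) * (s ^ 2 * ∫ x in K, ‖r x‖ ^ 2)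
      ≤ (‖e₁‖ ^ 2 * ‖e₂‖ ^ 2) * (4 * B) := by linarith
  exact le_of_mul_le_mul_left q (by positivity)

lemma volume_real_le_sq_diam {A : Set Plane} (hb : Bornology.IsBounded A) (hne : A.Nonempty) :
    volume.real A ≤ 4 * Metric.diam A ^ 2 := by
  obtain ⟨x, hx⟩ := hne
  have hsub : A ⊆ Metric.closedBall x (Metric.diam A) := fun y hy =>
    Metric.dist_le_diam_of_mem hb hy hx
  have h1 : volume.real A ≤ volume.real (Metric.closedBall x (Metric.diam A)) :=
    measureReal_mono hsub (Metric.isBounded_closedBall.measure_lt_top).ne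
  refine h1.trans ?_
  rw [Measure.real, EuclideanSpace.volume_closedBall_fin_two, ENNReal.toReal_mul,
    ENNReal.toReal_pow, ENNReal.toReal_ofReal Metric.diam_nonneg,
    ENNReal.toReal_ofReal Real.pi_pos.le]
  have := Real.pi_le_four
  nlinarith [sq_nonneg (Metric.diam A)]

/-- Expansion around the mean. It shows that κ is the best constant, gives κ²|P| ≤ ∫c² for a = 0,
and yields Cauchy-Schwarz when applied to |f|. -/
lemma integral_sub_mean_sq {A : Set Plane} (hA : volume A ≠ ⊤) {c : Plane → ℝ}
    (hc : MemLp c 2 (volume.restrict A)) {κ : ℝ} (hκ : κ * volume.real A = ∫ x in A, c x) (a : ℝ) :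
    ∫ x in A, (c x - a) ^ 2 = (∫ x in A, (c x - κ) ^ 2) + (κ - a) ^ 2 * volume.real A := by
  have : IsFiniteMeasure (volume.restrict A) := ⟨by simpa using hA.lt_top⟩
  have h1 := hc.integrable_sq
  have h2 := hc.integrable (by norm_num)
  have key : ∀ a : ℝ, ∫ x in A, (c x - a) ^ 2
      = (∫ x in A, c x ^ 2) - 2 * a * (∫ x in A, c x) + a ^ 2 * volume.real A := by
    intro a
    have e : ∀ x, (c x - a) ^ 2 = c x ^ 2 - 2 * a * c x + a ^ 2 := fun x => by ring
    simp only [e]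
    have h3 : Integrable (fun x => c x ^ 2 - 2 * a * c x) (volume.restrict A) :=
      h1.sub (h2.const_mul _)
    rw [integral_add h3 (integrable_const _),
      integral_sub h1 (h2.const_mul _), integral_const_mul, integral_const]
    simp
    ring
  rw [key, key, ← hκ]
  ring

lemma sq_integral_abs_le {A : Set Plane} (hA : volume A ≠ ⊤) {f : Plane → ℝ}
    (hf : MemLp f 2 (volume.restrict A)) :
    (∫ x in A, |f x|) ^ 2 ≤ volume.real A * ∫ x in A, f x ^ 2 := by
  have : IsFiniteMeasure (volume.restrict A) := ⟨by simpa using hA.lt_top⟩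
  rcases eq_or_ne (volume.real A) 0 with h0 | h0
  · have hz : volume A = 0 := by
      simpa [Measure.real, ENNReal.toReal_eq_zero_iff, hA] using h0
    simp [Measure.restrict_eq_zero.2 hz, h0]
  have hpos : 0 < volume.real A := lt_of_le_of_ne measureReal_nonneg h0.symm
  have hm : MemLp (fun x => |f x|) 2 (volume.restrict A) := hf.norm
  set κ := (∫ x in A, |f x|) / volume.real A
  have hκ : κ * volume.real A = ∫ x in A, |f x| := div_mul_cancel₀ _ h0
  have h := integral_sub_mean_sq hA hm hκ 0
  simp only [sub_zero, sq_abs] at h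
  have hn : 0 ≤ ∫ x in A, (|f x| - κ) ^ 2 := integral_nonneg fun x => sq_nonneg _
  rw [h, ← hκ]
  nlinarith [mul_nonneg hpos.le hn]

namespace IsTriangulation

/-- The error of the interpolant in the tangential direction of an edge. -/
lemma integral_inner_sub_sq_le (hT : IsTriangulation p P T) {t} (ht : t ∈ T)
    {u v : Plane → Plane} {a : Plane} {b h d m : ℝ}
    (hu : MemLp u 2 (volume.restrict (cell p t)))
    (hh : ∀ x ∈ P, ∀ y ∈ P, ‖x - y‖ ≤ h)
    (hv : ∀ᵐ x ∂(volume.restrict (cell p t)), v x = a + b • !₂[x 1, -x 0])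
    {i j : Fin (n + 3)} (hi : i ∈ t) (hd : nedDof a b (p i) (p j) = m + d) :
    ∫ x in cell p t, inner ℝ (u x - v x) (p j - p i) ^ 2
      ≤ 3 * ((∫ x in cell p t, (inner ℝ (u x) (p j - p i) - m) ^ 2)
        + (d ^ 2 + b ^ 2 * h ^ 2 * ‖p j - p i‖ ^ 2) * volume.real (cell p t)) := by
  have : IsFiniteMeasure (volume.restrict (cell p t)) :=
    ⟨by simpa using (isCompact_cell t).measure_lt_top⟩
  set e := p j - p i with he
  have i1 : Integrable (fun x => (inner ℝ (u x) e - m) ^ 2) (volume.restrict (cell p t)) :=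
    ((hu.inner_const e).sub (memLp_const m)).integrable_sq
  have i2 : Integrable (fun _ : Plane => d ^ 2 + b ^ 2 * h ^ 2 * ‖e‖ ^ 2)
      (volume.restrict (cell p t)) := integrable_const _
  have i3 : ∫ x in cell p t, 3 * ((inner ℝ (u x) e - m) ^ 2
      + (d ^ 2 + b ^ 2 * h ^ 2 * ‖e‖ ^ 2)) = 3 * ((∫ x in cell p t, (inner ℝ (u x) e - m) ^ 2)
        + (d ^ 2 + b ^ 2 * h ^ 2 * ‖e‖ ^ 2) * volume.real (cell p t)) := by
    rw [integral_const_mul, integral_add i1 i2, integral_const]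
    simp [mul_comm]
  rw [← i3]
  refine integral_mono_of_nonneg (Eventually.of_forall fun x => sq_nonneg _)
    ((i1.add i2).const_mul 3) ?_
  filter_upwards [hv, ae_restrict_mem (measurableSet_cell t)] with x hx hxt
  have hn : ‖x - p i‖ ≤ h :=
    hh x (hT.cell_subset ht hxt) (p i) (hT.cell_subset ht (vertex_mem_cell hi))
  -- The error along e has three parts: the deviation of u·e from its edge integral, the discrepancy
  -- d of the degrees of freedom, and the rotation of v about p i, which is at most |b| h ‖e‖.
  -- Squaring three terms gives the factor 3.
  have e1 : inner ℝ (u x - v x) e = (inner ℝ (u x) e - m) - d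
      - b * ((x - p i) 1 * e 0 - (x - p i) 0 * e 1) := by
    rw [hx]
    simp only [nedDof] at hd
    simp only [inner_plane, he, PiLp.sub_apply, PiLp.add_apply, PiLp.smul_apply, smul_eq_mul,
      Matrix.cons_val_zero, Matrix.cons_val_one]
    linear_combination -hd
  have e2 : ((x - p i) 1 * e 0 - (x - p i) 0 * e 1) ^ 2 ≤ h ^ 2 * ‖e‖ ^ 2 := by
    have h1 : ‖x - p i‖ ^ 2 ≤ h ^ 2 := pow_le_pow_left₀ (norm_nonneg _) hn 2
    refine le_trans ?_ (mul_le_mul_of_nonneg_right h1 (sq_nonneg _))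
    rw [norm_sq_plane, norm_sq_plane]
    nlinarith [sq_nonneg ((x - p i) 1 * e 1 + (x - p i) 0 * e 0)]
  rw [e1]
  set A := inner ℝ (u x) e - m
  set R := (x - p i) 1 * e 0 - (x - p i) 0 * e 1
  have e3 : (b * R) ^ 2 ≤ b ^ 2 * h ^ 2 * ‖e‖ ^ 2 := by
    rw [mul_pow, mul_assoc]
    exact mul_le_mul_of_nonneg_left e2 (sq_nonneg b)
  nlinarith [sq_nonneg (A + d), sq_nonneg (A + b * R), sq_nonneg (d - b * R)]

/-- The `L²` error of the interpolant. -/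
lemma integral_error_sq_le (hP : IsSimplePolygon p P) (hT : IsTriangulation p P T) {θ s lam : ℝ}
    (hθ : MaxAngleCondition p T θ) (hs : ∀ α, Real.pi / 3 ≤ α → α ≤ θ → s ≤ Real.sin α)
    (hs0 : 0 < s) (hlam : 0 < lam) (hE : NoShortInteriorEdge p P T lam)
    {u v : Plane → Plane} {G c : Plane → ℝ} (hu : MemLp u 2 (volume.restrict P))
    (hv : MemLp v 2 (volume.restrict P)) (hG : IntegrableOn G P)
    (hc : MemLp c 2 (volume.restrict P)) {U X : Fin (n + 3) → Fin (n + 3) → ℝ}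
    (hU : ∀ a b, U b a = - U a b) (hX : ∀ a b, X b a = - X a b)
    (hXU : ∀ i, X i (i + 1) = U i (i + 1))
    (hUc : ∀ t ∈ T, circulation p t U = ∫ x in cell p t, c x) {κ : ℝ}
    (hκ : κ * volume.real P = ∫ x in P, c x)
    (hXc : ∀ t ∈ T, circulation p t X = κ * volume.real (cell p t))
    (hUe : ∀ t ∈ T, ∀ i ∈ t, ∀ j ∈ t, i ≠ j →
      ∫ x in cell p t, (inner ℝ (u x) (p j - p i) - U i j) ^ 2
        ≤ 21 * Metric.diam P ^ 2 * (‖p j - p i‖ ^ 2 * ∫ x in cell p t, G x))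
    {a : Finset (Fin (n + 3)) → Plane}
    (ha : ∀ t ∈ T, ∀ i ∈ t, ∀ j ∈ t, nedDof (a t) (-κ / 2) (p i) (p j) = X i j)
    (hva : ∀ t ∈ T, ∀ᵐ x ∂(volume.restrict (cell p t)), v x = a t + (-κ / 2) • !₂[x 1, -x 0]) :
    ∫ x in P, ‖u x - v x‖ ^ 2 ≤ 12 / s ^ 2 * Metric.diam P ^ 2 *
      (21 * (∫ x in P, G x) + (16 / lam ^ 2 + 1 / 4) * ∫ x in P, c x ^ 2) := by
  set h := Metric.diam P with hh
  have hV := hP.volume_real_pos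
  have hfin : volume P ≠ ⊤ := hP.isCompact.measure_lt_top.ne
  have hVh : volume.real P ≤ 4 * h ^ 2 :=
    volume_real_le_sq_diam hP.isCompact.isBounded (hP.interior_nonempty.mono interior_subset)
  have hh0 : 0 < h ^ 2 := by linarith
  have hh1 : h ≠ 0 := fun h0 => by rw [h0] at hh0; norm_num at hh0
  have hhd : ∀ x ∈ P, ∀ y ∈ P, ‖x - y‖ ≤ h := fun x hx y hy => by
    rw [← dist_eq_norm]
    exact Metric.dist_le_diam_of_mem hP.isCompact.isBounded hx hy
  have : IsFiniteMeasure (volume.restrict P) := ⟨by simpa using hfin.lt_top⟩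
  set S := ∫ x in P, c x ^ 2 with hS
  have hS0 : 0 ≤ S := integral_nonneg fun x => sq_nonneg _
  have hmean := integral_sub_mean_sq hfin hc hκ 0
  simp only [sub_zero] at hmean
  have hq0 : 0 ≤ ∫ x in P, (c x - κ) ^ 2 := integral_nonneg fun x => sq_nonneg _
  have hκ2 : 0 ≤ κ ^ 2 * volume.real P := by positivity
  -- The discrepancy of the interpolant on the edges. It vanishes on the boundary, and its
  -- circulation around t is -∫(c - κ) over t, so it is controlled by curl u alone.
  set d : Fin (n + 3) → Fin (n + 3) → ℝ := fun i j => X i j + -1 * U i j with hd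
  have hd0 : ∀ i, d i (i + 1) = 0 := fun i => by simp only [hd, hXU]; ring
  have hdc : ∀ t ∈ T, |circulation p t d| ≤ ∫ x in cell p t, |c x - κ| := fun t ht => by
    have hsub := hT.cell_subset ht
    have hi : IntegrableOn c (cell p t) := (hc.integrable (by norm_num)).mono_measure
      (Measure.restrict_mono hsub le_rfl)
    have : IsFiniteMeasure (volume.restrict (cell p t)) :=
      ⟨by simpa using (isCompact_cell t).measure_lt_top⟩
    have e : circulation p t d = - ∫ x in cell p t, (c x - κ) := by
      rw [integral_sub hi (integrable_const κ), integral_const, hd, circulation_add_smul, hXc t ht,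
        hUc t ht]
      simp
      ring
    rw [e, abs_neg]
    exact abs_integral_le_integral_abs
  have hcκ : MemLp (fun x => c x - κ) 2 (volume.restrict P) := hc.sub (memLp_const κ)
  have hdM : ∀ t ∈ T, ∀ i ∈ t, ∀ j ∈ t, d i j ^ 2 ≤ volume.real P * S := by
    intro t ht i hi j hj
    have h1 : |d i j| ≤ ∫ x in P, |c x - κ| := by
      rw [hT.integral_eq_sum (f := fun x => |c x - κ|) (hcκ.integrable (by norm_num)).norm]
      refine (hT.abs_le_sum_circulation hP
        (fun Y hY hY0 hYc t ht i hi j hj => hT.cochain_eq_zero hP hY hY0 hYc ht hi hj)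
        (fun a b => ?_) hd0 ht hi hj).trans (Finset.sum_le_sum hdc)
      simp only [hd, hX a b, hU a b]; ring
    have h2 := sq_integral_abs_le hfin hcκ
    have h3 : d i j ^ 2 ≤ (∫ x in P, |c x - κ|) ^ 2 := by
      rw [← sq_abs (d i j)]
      exact pow_le_pow_left₀ (abs_nonneg _) h1 2
    refine (h3.trans h2).trans (mul_le_mul_of_nonneg_left ?_ hV.le)
    linarith
  -- The uniform bound d² ≤ |P| S has to be turned into a bound by ‖e‖². On interior edges ‖e‖ ≥ λh
  -- gives this with the constant M; boundary edges may be arbitrarily short, but there d = 0.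
  set M := volume.real P * S / (lam ^ 2 * h ^ 2) with hM
  have hM0 : 0 ≤ M := by positivity
  have hde : ∀ t ∈ T, ∀ i ∈ t, ∀ j ∈ t, i ≠ j → d i j ^ 2 ≤ M * ‖p j - p i‖ ^ 2 := by
    intro t ht i hi j hj hij
    rcases eq_or_ne j (i + 1) with rfl | g1
    · rw [hd0, zero_pow two_ne_zero]; positivity
    rcases eq_or_ne i (j + 1) with rfl | g2
    · have : d (j + 1) j = 0 := by
        simp only [hd, hX j (j + 1), hU j (j + 1), hXU]; ring
      rw [this, zero_pow two_ne_zero]; positivity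
    have h1 := hE t ht i hi j hj hij g1 g2
    rw [dist_comm, dist_eq_norm] at h1
    have h2 : lam ^ 2 * h ^ 2 ≤ ‖p j - p i‖ ^ 2 := by
      rw [← mul_pow]
      exact pow_le_pow_left₀ (by positivity) h1 2
    refine (hdM t ht i hi j hj).trans ?_
    calc volume.real P * S = M * (lam ^ 2 * h ^ 2) := by rw [hM]; field_simp
      _ ≤ _ := mul_le_mul_of_nonneg_left h2 hM0
  have hr : MemLp (fun x => u x - v x) 2 (volume.restrict P) := hu.sub hv
  set B : Finset (Fin (n + 3)) → ℝ := fun t => 3 * (21 * h ^ 2 * (∫ x in cell p t, G x)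
    + (M + (-κ / 2) ^ 2 * h ^ 2) * volume.real (cell p t)) with hB
  have hcell : ∀ t ∈ T, ∀ i ∈ t, ∀ j ∈ t, i ≠ j →
      ∫ x in cell p t, inner ℝ (u x - v x) (p j - p i) ^ 2 ≤ ‖p j - p i‖ ^ 2 * B t := by
    intro t ht i hi j hj hij
    have hsub := Measure.restrict_mono (hT.cell_subset ht) (le_refl (volume : Measure Plane))
    have h1 := hT.integral_inner_sub_sq_le ht (hu.mono_measure hsub) hhd (hva t ht) hi (j := j)
      (m := U i j) (d := d i j) (by rw [ha t ht i hi j hj]; simp only [hd]; ring)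
    have h2 := hUe t ht i hi j hj hij
    have h3 := mul_le_mul_of_nonneg_right (hde t ht i hi j hj hij)
      (measureReal_nonneg (μ := volume) (s := cell p t))
    simp only [hB]
    linarith
  have hmain : ∀ t ∈ T, s ^ 2 * ∫ x in cell p t, ‖u x - v x‖ ^ 2 ≤ 4 * B t := by
    intro t ht
    have hsub := Measure.restrict_mono (hT.cell_subset ht) (le_refl (volume : Measure Plane))
    obtain ⟨i, hi, j, hj, k, hk, hij, hkj, hg⟩ := hT.exists_good_vertex hθ hs hs0 ht
    have hne : ∀ {i j : Fin (n + 3)}, i ≠ j → p i - p j ≠ 0 := fun hij hz =>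
      hij (hP.injective (sub_eq_zero.1 hz))
    exact sq_mul_integral_norm_sq_le (hr.mono_measure hsub) (hne hij) (hne hkj) hg
      (hcell t ht j hj i hi hij.symm) (hcell t ht j hj k hk hkj.symm)
  have hsum : s ^ 2 * ∫ x in P, ‖u x - v x‖ ^ 2 ≤ 4 * ∑ t ∈ T, B t := by
    rw [hT.integral_eq_sum (f := fun x => ‖u x - v x‖ ^ 2) hr.norm.integrable_sq, Finset.mul_sum,
      Finset.mul_sum]
    exact Finset.sum_le_sum hmain
  have hBs : ∑ t ∈ T, B t = 3 * (21 * h ^ 2 * (∫ x in P, G x)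
      + (M + (-κ / 2) ^ 2 * h ^ 2) * volume.real P) := by
    simp only [hB]
    rw [← Finset.mul_sum, Finset.sum_add_distrib, ← Finset.mul_sum, ← Finset.mul_sum,
      hT.sum_volume_real hP, hT.integral_eq_sum hG]
  -- The bound |P| ≤ 4h² is used twice, once in M and once for the measure of P, which leaves
  -- 16h²/λ².
  have hMP : M * volume.real P ≤ 16 / lam ^ 2 * h ^ 2 * S := by
    have h1 : volume.real P * volume.real P ≤ (4 * h ^ 2) * (4 * h ^ 2) :=
      mul_le_mul hVh hVh hV.le (by positivity)
    calc M * volume.real P = volume.real P * volume.real P * (S / (lam ^ 2 * h ^ 2)) := by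
          rw [hM]; ring
      _ ≤ (4 * h ^ 2) * (4 * h ^ 2) * (S / (lam ^ 2 * h ^ 2)) :=
          mul_le_mul_of_nonneg_right h1 (by positivity)
      _ = _ := by field_simp; ring
  -- The term 1/4 comes from the coefficient b = -κ/2 of the rotation, with κ²|P| ≤ S.
  have hκP : (-κ / 2) ^ 2 * h ^ 2 * volume.real P ≤ 1 / 4 * h ^ 2 * S := by
    have : κ ^ 2 * volume.real P ≤ S := by linarith
    nlinarith [mul_le_mul_of_nonneg_left this hh0.le]
  have hfinal : s ^ 2 * ∫ x in P, ‖u x - v x‖ ^ 2 ≤ 12 * h ^ 2 *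
      (21 * (∫ x in P, G x) + (16 / lam ^ 2 + 1 / 4) * S) := by
    rw [hBs] at hsum
    linarith
  have hs2 : 0 < s ^ 2 := by positivity
  calc ∫ x in P, ‖u x - v x‖ ^ 2 = (s ^ 2 * ∫ x in P, ‖u x - v x‖ ^ 2) / s ^ 2 := by
        field_simp
    _ ≤ (12 * h ^ 2 * (21 * (∫ x in P, G x) + (16 / lam ^ 2 + 1 / 4) * S)) / s ^ 2 := by
        gcongr
    _ = _ := by ring

end IsTriangulation

/-! ### Uniqueness of the interpolant -/

namespace IsTriangulation

lemma volume_real_cell_pos (hT : IsTriangulation p P T) {t} (ht : t ∈ T) :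
    0 < volume.real (cell p t) := by
  obtain ⟨i, j, k, hij, hik, hjk, htt⟩ := Finset.card_eq_three.1 (hT.card_eq t ht)
  have ho := hT.orient_ne_zero ht (i := i) (j := j) (k := k) (by simp [htt]) (by simp [htt])
    (by simp [htt]) hij hik hjk
  rw [htt, cell_triple, volume_real_triangle ho]
  have := abs_pos.2 ho
  positivity

/-- The weak curl of a Nédélec field on a triangle. -/
lemma curl_ned_eq (hT : IsTriangulation p P T) {t} (ht : t ∈ T) {v : Plane → Plane} {a : Plane}
    {b κ : ℝ} (hv : ∀ᵐ x ∂(volume.restrict (cell p t)), v x = a + b • !₂[x 1, -x 0])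
    (hκ : IsWeakCurl (interior P) v fun _ => κ) : κ = -2 * b := by
  have hsub : interior (cell p t) ⊆ interior P := interior_mono (hT.cell_subset ht)
  rw [← restrict_interior_cell] at hv
  set w : Plane → Plane := fun x => !₂[b * x 1 + a 0, -b * x 0 + a 1] with hw
  have hwc : Continuous w := by
    refine (PiLp.continuous_toLp 2 (fun _ : Fin 2 => ℝ)).comp (continuous_pi fun l => ?_)
    fin_cases l
    · exact (contDiff_affine (n := 0) 1 b (a 0)).continuous
    · exact (contDiff_affine (n := 0) 0 (-b) (a 1)).continuous
  have hvw : v =ᵐ[volume.restrict (interior (cell p t))] w := by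
    filter_upwards [hv] with x hx
    rw [hx]
    ext l
    fin_cases l <;> simp [hw, add_comm]
  have h0 : IsWeakPartial (interior (cell p t)) 1 (fun x => w x 0) _ :=
    isWeakPartial_of_contDiff (contDiff_affine 1 b (a 0))
  have h1 : IsWeakPartial (interior (cell p t)) 0 (fun x => w x 1) _ :=
    isWeakPartial_of_contDiff (contDiff_affine 0 (-b) (a 1))
  have hc := isWeakCurl_of_isWeakPartial (hwc.locallyIntegrable.locallyIntegrableOn _) h0 h1
  have hae := IsWeakCurl.ae_eq isOpen_interior hvw (hκ.mono hsub) hc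
  have hne : (ae (volume.restrict (interior (cell p t)))).NeBot := by
    rw [restrict_interior_cell, ae_neBot, Ne, Measure.restrict_eq_zero]
    intro h
    have := hT.volume_real_cell_pos ht
    rw [Measure.real, h] at this
    simp at this
  obtain ⟨x, hx⟩ := hae.exists
  have d1 : pderiv 0 (fun x => w x 1) x = -b := by
    have := pderiv_affine 0 0 (-b) (a 1) x
    rwa [if_pos rfl] at this
  have d0 : pderiv 1 (fun x => w x 0) x = b := by
    have := pderiv_affine 1 1 b (a 0) x
    rwa [if_pos rfl] at this
  simp only [d0, d1] at hx
  linarith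

lemma circulation_eq_of_support {t : Finset (Fin (n + 3))} (htc : t.card = 3) {i j : Fin (n + 3)}
    (hi : i ∈ t) (hj : j ∈ t) (hij : i ≠ j) {Y : Fin (n + 3) → Fin (n + 3) → ℝ}
    (hY : ∀ a b, Y b a = - Y a b)
    (h0 : ∀ k ∈ t, k ≠ i → k ≠ j → ∀ l ∈ t, Y k l = 0) :
    circulation p t Y = edgeSign p t i j * Y i j := by
  obtain ⟨k, hki, hkj, htt⟩ := exists_third htc hi hj hij
  have hk : k ∈ t := by simp [htt]
  rw [circulation_eq htt hij hki.symm hkj.symm hY, edgeSign_eq htt hij hki.symm hkj.symm,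
    hY k j, h0 k hk hki hkj j hj, h0 k hk hki hkj i hi]
  ring

/-- No other edge of the triangulation contains the midpoint of an edge. -/
lemma eq_of_midpoint_mem_segment (hT : IsTriangulation p P T) {t q} (ht : t ∈ T) (hq : q ∈ T)
    {i j k l : Fin (n + 3)} (hi : i ∈ t) (hj : j ∈ t) (hij : i ≠ j) (hk : k ∈ q) (hl : l ∈ q)
    (h : p i + (1 / 2 : ℝ) • (p j - p i) ∈ segment ℝ (p k) (p l)) :
    (i = k ∨ i = l) ∧ (j = k ∨ j = l) := by
  have hseg : segment ℝ (p k) (p l) ⊆ cell p q :=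
    (convex_convexHull ℝ _).segment_subset (vertex_mem_cell hk) (vertex_mem_cell hl)
  obtain ⟨hiq, hjq⟩ := hT.edge_mem hq ht hi hj hij (by norm_num) (by norm_num) (hseg h)
  rw [segment_eq_image_lineMap] at h
  obtain ⟨r, -, hr⟩ := h
  rw [AffineMap.lineMap_apply, vsub_eq_sub, vadd_eq_add, add_comm] at hr
  -- The midpoint lies on the line through p k and p l, so the signed areas of p i and p j over this
  -- line are opposite. Among the vertices of q only the third one has a nonzero signed area, so
  -- both areas vanish and both points are end points of the edge.
  have horient : orient (p k) (p l) (p i) + orient (p k) (p l) (p j) = 0 := by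
    have h1 := orient_lineMap (p k) (p l) (p i) (p j) (1 / 2)
    have h2 := orient_lineMap (p k) (p l) (p k) (p l) r
    rw [← hr, h2] at h1
    have e1 : orient (p k) (p l) (p k) = 0 := by simp [orient]
    have e2 : orient (p k) (p l) (p l) = 0 := by simp [orient]; ring
    rw [e1, e2] at h1
    linarith
  have e1 : orient (p k) (p l) (p k) = 0 := by simp [orient]
  have e2 : orient (p k) (p l) (p l) = 0 := by simp [orient]; ring
  -- Degenerate pairs have to be excluded too: `segMean` over a pair k = l is a point value, and no
  -- vertex is the midpoint of an edge.
  rcases eq_or_ne k l with rfl | hkl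
  · exfalso
    have h3 : p i + (1 / 2 : ℝ) • (p j - p i) = p k := by
      rw [← hr]; simp
    have hkt : k ∈ t := by
      refine hT.vertex_mem k t ht ?_
      rw [← h3]
      exact lineMap_mem_cell hi hj ⟨by norm_num, by norm_num⟩
    obtain ⟨m, hm, hmi, hmj, hc, ho⟩ := hT.exists_cell_eq ht hi hj hij
    have o1 := orient_lineMap (p i) (p j) (p i) (p j) (1 / 2)
    have e3 : orient (p i) (p j) (p i) = 0 := by simp [orient]
    have e4 : orient (p i) (p j) (p j) = 0 := by simp [orient]; ring
    rw [h3, e3, e4] at o1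
    have hki : k = i ∨ k = j := by
      by_contra hcon
      push Not at hcon
      exact hT.orient_ne_zero ht hi hj hkt hij hcon.1.symm hcon.2.symm (by linarith)
    have hpij : p i ≠ p j := fun hpe => by
      apply hT.orient_ne_zero ht hi hj hm hij hmi.symm hmj.symm
      rw [hpe]; simp [orient]
    rcases hki with rfl | rfl
    · apply hpij
      have : (1 / 2 : ℝ) • (p j - p k) = 0 := by simpa using h3
      rw [smul_eq_zero, sub_eq_zero] at this
      exact (this.resolve_left (by norm_num)).symm
    · apply hpij
      have : (1 / 2 : ℝ) • (p k - p i) = p k - p i := eq_sub_of_add_eq' h3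
      have h5 : (1 / 2 : ℝ) • (p k - p i) = 0 := by
        have h6 : p k - p i = (1 / 2 : ℝ) • (p k - p i) + (1 / 2 : ℝ) • (p k - p i) := by
          rw [← add_smul]; norm_num
        rw [this] at h6
        rw [this]
        simpa using h6
      rw [smul_eq_zero, sub_eq_zero] at h5
      exact (h5.resolve_left (by norm_num)).symm
  · have key : ∀ {x y : Fin (n + 3)}, x ∈ q → y ∈ q → x ≠ y →
        orient (p k) (p l) (p x) + orient (p k) (p l) (p y) = 0 → x = k ∨ x = l := by
      intro x y hx hy hxy hsum
      by_contra hcon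
      push Not at hcon
      have hx0 := hT.orient_ne_zero hq hk hl hx hkl hcon.1.symm hcon.2.symm
      obtain ⟨m, hmk, hml, hqq⟩ := exists_third (hT.card_eq q hq) hk hl hkl
      have hxm : x = m := by
        rw [hqq] at hx; simp at hx; tauto
      have hym : y = k ∨ y = l := by
        rw [hqq] at hy; simp at hy
        rcases hy with hy | hy | hy
        · exact Or.inl hy
        · exact Or.inr hy
        · exact absurd (hxm.trans hy.symm) hxy
      rcases hym with rfl | rfl
      · rw [e1] at hsum; exact hx0 (by linarith)
      · rw [e2] at hsum; exact hx0 (by linarith)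
    exact ⟨key hiq hjq hij horient, key hjq hiq hij.symm (by linarith)⟩

lemma segMean_eq_zero_of_disjoint {φ : Plane → ℝ} {x y : Plane}
    (h : ∀ z ∈ segment ℝ x y, φ z = 0) : segMean φ x y = 0 := by
  unfold segMean
  rw [intervalIntegral.integral_congr (g := fun _ => (0 : ℝ)) fun s hs => ?_]
  · simp
  · rw [Set.uIcc_of_le zero_le_one] at hs
    refine h _ ?_
    rw [segment_eq_image_lineMap]
    exact ⟨s, hs, by rw [AffineMap.lineMap_apply, vsub_eq_sub, vadd_eq_add, add_comm]⟩

lemma segMean_pos {φ : Plane → ℝ} (hφ : Continuous φ) (h0 : ∀ z, 0 ≤ φ z) {x y : Plane}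
    (h : 0 < φ (x + (1 / 2 : ℝ) • (y - x))) : 0 < segMean φ x y := by
  unfold segMean
  have hc : Continuous fun s : ℝ => φ (x + s • (y - x)) := by fun_prop
  exact intervalIntegral.integral_pos zero_lt_one hc.continuousOn (fun s _ => h0 _)
    ⟨1 / 2, ⟨by norm_num, by norm_num⟩, h⟩

/-- A test function that sees only one edge of the triangulation. -/
lemma exists_edge_bump (hP : IsSimplePolygon p P) (hT : IsTriangulation p P T) {t} (ht : t ∈ T)
    {i j : Fin (n + 3)} (hi : i ∈ t) (hj : j ∈ t) (hij : i ≠ j) (g1 : j ≠ i + 1) (g2 : i ≠ j + 1) :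
    ∃ φ, IsTestFunction (interior P) φ ∧ 0 < segMean φ (p i) (p j) ∧
      ∀ q ∈ T, ∀ k ∈ q, ∀ l ∈ q, segMean φ (p k) (p l) ≠ 0 →
        (i = k ∨ i = l) ∧ (j = k ∨ j = l) := by
  set M := p i + (1 / 2 : ℝ) • (p j - p i) with hM
  have hMP : ∀ᶠ x in 𝓝 M, x ∈ interior P := isOpen_interior.mem_nhds
    (hT.interior_edge_subset hP ht hi hj hij g1 g2 (by norm_num) (by norm_num))
  -- The finitely many segments are closed, so near M only those that contain M are met.
  have hseg : ∀ᶠ x in 𝓝 M, ∀ k l : Fin (n + 3), x ∈ segment ℝ (p k) (p l) →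
      M ∈ segment ℝ (p k) (p l) := by
    refine eventually_all.2 fun k => eventually_all.2 fun l => ?_
    by_cases hm : M ∈ segment ℝ (p k) (p l)
    · exact Eventually.of_forall fun _ _ => hm
    · have hcl : IsClosed (segment ℝ (p k) (p l)) := by
        rw [← convexHull_pair]
        exact (Set.Finite.isCompact_convexHull (s := {p k, p l}) ℝ (Set.toFinite _)).isClosed
      filter_upwards [hcl.isOpen_compl.mem_nhds hm] with x hx hx'
      exact absurd hx' hx
  obtain ⟨δ, hδ, hball⟩ := Metric.eventually_nhds_iff.1 (hMP.and hseg)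
  let f : ContDiffBump M := ⟨δ / 4, δ / 2, by positivity, by linarith⟩
  have hts : ∀ x ∈ tsupport f, dist x M < δ := fun x hx => by
    rw [f.tsupport_eq, Metric.mem_closedBall] at hx
    have hx' : dist x M ≤ δ / 2 := hx
    linarith
  refine ⟨f, ⟨f.contDiff, f.hasCompactSupport, fun x hx => (hball (hts x hx)).1⟩,
    segMean_pos f.continuous (fun z => f.nonneg) ?_, fun q hq k hk l hl hne => ?_⟩
  · exact f.pos_of_mem_ball (Metric.mem_ball_self f.rOut_pos)
  · refine hT.eq_of_midpoint_mem_segment ht hq hi hj hij hk hl ?_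
    by_contra hm
    refine hne (segMean_eq_zero_of_disjoint fun z hz => ?_)
    by_contra hz0
    exact hm ((hball (hts z (subset_tsupport _ hz0))).2 k l hz)

/-- A piecewise Nédélec field with a constant weak curl has matching tangential components. -/
lemma nedDof_eq_of_isWeakCurl (hP : IsSimplePolygon p P) (hT : IsTriangulation p P T)
    {v : Plane → Plane} {a : Finset (Fin (n + 3)) → Plane} {b κ : ℝ} (hb : κ = -2 * b)
    (hv : ∀ t ∈ T, ∀ᵐ x ∂(volume.restrict (cell p t)), v x = a t + b • !₂[x 1, -x 0])
    (hκ : IsWeakCurl (interior P) v fun _ => κ) {t} (ht : t ∈ T)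
    {i j : Fin (n + 3)} (hi : i ∈ t) (hj : j ∈ t) (hij : i ≠ j) (g1 : j ≠ i + 1) (g2 : i ≠ j + 1)
    {q} (hq : q ∈ T) (hiq : i ∈ q) (hjq : j ∈ q) :
    nedDof (a q) b (p i) (p j) = nedDof (a t) b (p i) (p j) := by
  obtain ⟨s, hs, hst, his, hjs, hsign, hall⟩ := hT.exists_neighbor hP ht hi hj hij g1 g2
  rcases hall q hq hiq hjq with rfl | rfl
  · rfl
  obtain ⟨φ, hφ, hpos, honly⟩ := hT.exists_edge_bump hP ht hi hj hij g1 g2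
  have h0 : ∀ x ∉ interior P, φ x = 0 := fun x hx => by
    by_contra h
    exact hx (hφ.2.2 (subset_tsupport _ h))
  have h1 := hκ.2.2 φ hφ
  rw [hT.integral_piecewise_ned (b := fun _ => b) hv hφ, Finset.sum_sub_distrib, ← Finset.mul_sum,
    ← hT.integral_eq_sum (integrableOn_of_continuous hP.isCompact.isBounded hφ.1.continuous),
    integral_const_mul, ← setIntegral_eq_of_subset_of_forall_sdiff_eq_zero
      hP.isCompact.isClosed.measurableSet interior_subset fun x hx => h0 x hx.2, ← hb] at h1
  -- What remains of the weak curl identity is the sum of the jumps of the tangential component,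
  -- weighted by the edge means of φ. This φ sees only the edge (i, j), with a positive mean, so the
  -- jump there is zero.
  have h2 : ∑ r ∈ T, circulation p r (fun k l => nedDof (a r) b (p k) (p l)
      * segMean φ (p k) (p l)) = 0 := by linarith
  have hanti : ∀ r, ∀ k l : Fin (n + 3), nedDof (a r) b (p l) (p k) * segMean φ (p l) (p k)
      = - (nedDof (a r) b (p k) (p l) * segMean φ (p k) (p l)) := fun r k l => by
    rw [nedDof_swap, segMean_swap]; ring
  have hcirc : ∀ r ∈ T, i ∈ r → j ∈ r → circulation p r (fun k l => nedDof (a r) b (p k) (p l)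
      * segMean φ (p k) (p l))
      = edgeSign p r i j * (nedDof (a r) b (p i) (p j) * segMean φ (p i) (p j)) := by
    intro r hr hir hjr
    refine circulation_eq_of_support (hT.card_eq r hr) hir hjr hij (hanti r)
      fun k hk hki hkj l hl => ?_
    by_contra hne
    have := honly r hr k hk l hl (right_ne_zero_of_mul hne)
    rcases this.1 with h | h
    · exact hki h.symm
    · rcases this.2 with h' | h'
      · exact hkj h'.symm
      · exact hij (h.trans h'.symm)
  rw [Finset.sum_eq_add_of_mem t q ht hs hst.symm fun r hr hne => ?_, hcirc t ht hi hj,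
    hcirc q hs his hjs, hsign] at h2
  · have h3 : (edgeSign p t i j * segMean φ (p i) (p j)) *
        (nedDof (a t) b (p i) (p j) - nedDof (a q) b (p i) (p j)) = 0 := by linarith
    have h4 := hT.edgeSign_mul_self ht hi hj hij
    have h5 : edgeSign p t i j ≠ 0 := fun h => by rw [h] at h4; norm_num at h4
    have := (mul_eq_zero.1 h3).resolve_left (mul_ne_zero h5 hpos.ne')
    linarith
  · rw [circulation_congr (Y := fun _ _ => 0) fun k hk l hl => ?_]
    · simp [circulation]
    · by_contra hk0
      have := honly r hr k hk l hl (right_ne_zero_of_mul hk0)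
      have hir : i ∈ r := by rcases this.1 with h | h <;> rw [h] <;> assumption
      have hjr : j ∈ r := by rcases this.2 with h | h <;> rw [h] <;> assumption
      rcases hall r hr hir hjr with h | h
      · exact hne.1 h
      · exact hne.2 h

/-- A piecewise Nédélec field with constant weak curl and vanishing degrees of freedom on the
boundary vanishes. -/
lemma ned_eq_zero (hP : IsSimplePolygon p P) (hT : IsTriangulation p P T)
    {v : Plane → Plane} {a : Finset (Fin (n + 3)) → Plane} {b : Finset (Fin (n + 3)) → ℝ} {κ : ℝ}
    (hv : ∀ t ∈ T, ∀ᵐ x ∂(volume.restrict (cell p t)), v x = a t + b t • !₂[x 1, -x 0])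
    (hκ : IsWeakCurl (interior P) v fun _ => κ)
    (h0 : ∀ t ∈ T, ∀ i ∈ t, i + 1 ∈ t → nedDof (a t) (b t) (p i) (p (i + 1)) = 0) {t}
    (ht : t ∈ T) : a t = 0 ∧ b t = 0 := by
  classical
  have hb : ∀ t ∈ T, b t = -κ / 2 := fun t ht => by linarith [hT.curl_ned_eq ht (hv t ht) hκ]
  set β := -κ / 2 with hβ
  have hv' : ∀ t ∈ T, ∀ᵐ x ∂(volume.restrict (cell p t)), v x = a t + β • !₂[x 1, -x 0] :=
    fun t ht => by rw [← hb t ht]; exact hv t ht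
  have h0' : ∀ t ∈ T, ∀ i ∈ t, i + 1 ∈ t → nedDof (a t) β (p i) (p (i + 1)) = 0 :=
    fun t ht i hi hi' => by rw [← hb t ht]; exact h0 t ht i hi hi'
  -- The cochain of v, read from an arbitrary triangle at each edge. All triangles give the same
  -- value: zero on boundary edges by `h0'`, and across interior edges by `nedDof_eq_of_isWeakCurl`.
  set X : Fin (n + 3) → Fin (n + 3) → ℝ := fun i j =>
    if h : ∃ t ∈ T, i ∈ t ∧ j ∈ t then nedDof (a h.choose) β (p i) (p j) else 0 with hX
  have hXt : ∀ t ∈ T, ∀ i ∈ t, ∀ j ∈ t, X i j = nedDof (a t) β (p i) (p j) := by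
    intro t ht i hi j hj
    have hex : ∃ t ∈ T, i ∈ t ∧ j ∈ t := ⟨t, ht, hi, hj⟩
    simp only [hX, dif_pos hex]
    obtain ⟨hq, hiq, hjq⟩ := hex.choose_spec
    generalize hex.choose = q at hq hiq hjq
    rcases eq_or_ne i j with rfl | hij
    · simp [nedDof, mul_comm]
    rcases eq_or_ne j (i + 1) with rfl | g1
    · rw [h0' q hq i hiq hjq, h0' t ht i hi hj]
    rcases eq_or_ne i (j + 1) with rfl | g2
    · rw [nedDof_swap, nedDof_swap (a t), h0' q hq j hjq hiq, h0' t ht j hj hi]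
    · exact hT.nedDof_eq_of_isWeakCurl hP (by rw [hβ]; ring) hv' hκ ht hi hj hij g1 g2 hq hiq hjq
  have hanti : ∀ i j, X j i = - X i j := by
    intro i j
    by_cases hex : ∃ t ∈ T, i ∈ t ∧ j ∈ t
    · obtain ⟨t, ht, hi, hj⟩ := hex
      rw [hXt t ht i hi j hj, hXt t ht j hj i hi, nedDof_swap]
    · have hex' : ¬ ∃ t ∈ T, j ∈ t ∧ i ∈ t := fun ⟨t, ht, hj, hi⟩ => hex ⟨t, ht, hi, hj⟩
      simp only [hX, dif_neg hex, dif_neg hex', neg_zero]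
  have hX0 : ∀ i, X i (i + 1) = 0 := fun i => by
    obtain ⟨t, ht, hi, hi'⟩ := hT.exists_boundary_triangle hP i
    rw [hXt t ht i hi _ hi', h0' t ht i hi hi']
  have hXc : ∀ t ∈ T, circulation p t X = κ * volume.real (cell p t) := fun t ht => by
    rw [circulation_congr (hXt t ht), hT.circulation_nedDof ht (a t) β, hβ]
    ring
  obtain ⟨ε, -, hε⟩ := hT.exists_orientation hP
  -- The circulations add up to κ|P|, and they add up to the boundary values, which are zero.
  have hκ0 : κ = 0 := by
    have h1 := hT.sum_circulation hP hε X
    rw [Finset.sum_congr rfl hXc, ← Finset.mul_sum, hT.sum_volume_real hP] at h1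
    simp only [hanti _ (_ + 1), hX0, neg_zero, sub_zero, Finset.sum_const_zero, mul_zero] at h1
    exact (mul_eq_zero.1 h1).resolve_right hP.volume_real_pos.ne'
  have hβ0 : β = 0 := by rw [hβ, hκ0]; simp
  refine ⟨?_, by rw [hb t ht, hβ0]⟩
  have hz : ∀ i ∈ t, ∀ j ∈ t, nedDof (a t) β (p i) (p j) = 0 := fun i hi j hj => by
    rw [← hXt t ht i hi j hj]
    exact hT.cochain_eq_zero hP hanti hX0 (fun t ht => by rw [hXc t ht, hκ0, zero_mul]) ht hi hj
  obtain ⟨i, j, k, hij, hik, hjk, htt⟩ := Finset.card_eq_three.1 (hT.card_eq t ht)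
  have hi : i ∈ t := by simp [htt]
  have hj : j ∈ t := by simp [htt]
  have hk : k ∈ t := by simp [htt]
  have ho := hT.orient_ne_zero ht hi hj hk hij hik hjk
  have e1 := hz i hi j hj
  have e2 := hz i hi k hk
  simp only [nedDof, hβ0, zero_mul, add_zero] at e1 e2
  ext l
  refine (mul_eq_zero.1 (?_ : orient (p i) (p j) (p k) * a t l = 0)).resolve_left ho
  fin_cases l
  · simp only [orient, Fin.zero_eta]
    linear_combination (p k 1 - p i 1) * e1 - (p j 1 - p i 1) * e2
  · simp only [orient, Fin.mk_one]
    linear_combination (p j 0 - p i 0) * e2 - (p k 0 - p i 0) * e1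

end IsTriangulation

/-! ### The edge interpolation -/

lemma IsSimplePolygon.restrict_interior (hP : IsSimplePolygon p P) :
    volume.restrict (interior P) = volume.restrict P := by
  refine Measure.restrict_congr_set (interior_ae_eq_of_null_frontier ?_)
  rw [hP.frontier_eq]
  refine measure_iUnion_null fun i => measure_mono_null ?_ (volume_segment (p i) (p (i + 1)))
  intro x hx
  obtain ⟨r, hr, rfl⟩ := (mem_edgeSet_iff p i x).1 hx
  rw [segment_eq_image_lineMap]
  exact ⟨r, hr, by rw [AffineMap.lineMap_apply, vsub_eq_sub, vadd_eq_add, add_comm]⟩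

/-- Two fields that are piecewise of Nédélec type with the same boundary degrees of freedom
coincide. -/
lemma IsTriangulation.ae_eq_of_nedDof_eq (hP : IsSimplePolygon p P) (hT : IsTriangulation p P T)
    {v w : Plane → Plane} {a a' : Finset (Fin (n + 3)) → Plane} {b b' : Finset (Fin (n + 3)) → ℝ}
    {κ κ' : ℝ}
    (hv : ∀ t ∈ T, ∀ᵐ x ∂(volume.restrict (cell p t)), v x = a t + b t • !₂[x 1, -x 0])
    (hw : ∀ t ∈ T, ∀ᵐ x ∂(volume.restrict (cell p t)), w x = a' t + b' t • !₂[x 1, -x 0])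
    (hκ : IsWeakCurl (interior P) v fun _ => κ) (hκ' : IsWeakCurl (interior P) w fun _ => κ')
    (h : ∀ t ∈ T, ∀ i ∈ t, i + 1 ∈ t →
      nedDof (a' t) (b' t) (p i) (p (i + 1)) = nedDof (a t) (b t) (p i) (p (i + 1))) :
    w =ᵐ[volume.restrict P] v := by
  have hz : ∀ t ∈ T, a' t - a t = 0 ∧ b' t - b t = 0 := fun t ht =>
    hT.ned_eq_zero hP (v := fun x => w x - v x) (a := fun t => a' t - a t)
      (b := fun t => b' t - b t) (fun t ht => by
        filter_upwards [hv t ht, hw t ht] with x h1 h2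
        rw [h1, h2]
        module) (hκ'.sub hκ) (fun t ht i hi hi' => by
        have := h t ht i hi hi'
        simp only [nedDof, PiLp.sub_apply] at this ⊢
        linear_combination this) ht
  rw [← hT.iUnion_eq]
  refine (ae_restrict_biUnion_finset_iff _ _ _).2 fun t ht => ?_
  filter_upwards [hv t ht, hw t ht] with x h1 h2
  rw [h1, h2, sub_eq_zero.1 (hz t ht).1, sub_eq_zero.1 (hz t ht).2]

end EdgeVEM

/-! ### The main theorem -/

theorem lemma5p2 (θ : ℝ) (hθ : θ < Real.pi) (lam : ℝ) (hlam : 0 < lam) :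
    ∃ C : ℝ, 0 < C ∧
      ∀ (n : ℕ) (p : Polygon Plane (n + 3)) (P : Set Plane) (T : Finset (Finset (Fin (n + 3)))),
        IsSimplePolygon p P → IsTriangulation p P T →
        MaxAngleCondition p T θ → NoShortInteriorEdge p P T lam →
        ∀ u : Plane → Plane, MemH1Curl (interior (convexHull ℝ P)) u →
          ∃ v : Plane → Plane, IsEdgeInterpolation p P T u v ∧
            (∀ w : Plane → Plane, IsEdgeInterpolation p P T u w →
              w =ᵐ[volume.restrict P] v) ∧
            hCurlNorm (interior P) (fun x => u x - v x) ≤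
              C * Metric.diam P * h1CurlNorm (interior (convexHull ℝ P)) u := by
  obtain ⟨s, hs0, hs⟩ := exists_le_sin hθ
  set A : ℝ := 12 / s ^ 2 with hA
  set K : ℝ := 16 / lam ^ 2 + 1 / 4 with hK
  have hA0 : 0 < A := by positivity
  have hK0 : 0 < K := by positivity
  -- The squares of the errors add: A(21 + K) comes from the L² error of the field and 8 from the
  -- curl error.
  refine ⟨√(A * (21 + K) + 8), by positivity, ?_⟩
  intro n p P T hP hT hang hE u hu
  set D := interior (convexHull ℝ P) with hDdef
  have hD : IsOpen D := isOpen_interior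
  have hPD : interior P ⊆ D := interior_mono (subset_convexHull ℝ P)
  have hDne : D.Nonempty := hP.interior_nonempty.mono hPD
  have hDc : Convex ℝ D := (convex_convexHull ℝ P).interior
  have hPb := hP.isCompact.isBounded
  have hDb : Bornology.IsBounded D := (isBounded_convexHull.2 hPb).subset interior_subset
  have hDdiam : ∀ x ∈ D, ∀ y ∈ D, ‖x - y‖ ≤ Metric.diam P := fun x hx y hy => by
    rw [← dist_eq_norm, ← convexHull_diam]
    exact Metric.dist_le_diam_of_mem (isBounded_convexHull.2 hPb) (interior_subset hx)
      (interior_subset hy)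
  have hPdiam : ∀ x ∈ P, ∀ y ∈ P, ‖x - y‖ ≤ Metric.diam P := fun x hx y hy => by
    rw [← dist_eq_norm]
    exact Metric.dist_le_diam_of_mem hPb hx hy
  have hPi := hP.restrict_interior
  have hμ : volume.restrict P ≤ volume.restrict D := by
    rw [← hPi]
    exact Measure.restrict_mono hPD le_rfl
  obtain ⟨hu1, c₀, hc₀, hc₀H⟩ := hu
  set G : Fin 2 → Fin 2 → Plane → ℝ := fun j i => weakPartial D i fun x => u x j with hG
  have huG : ∀ j, HasH1 D (fun x => u x j) (G j) := fun j => (hu1 j).hasH1 hD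
  have huLp : MemLp u 2 (volume.restrict D) := memLp_plane fun j => (huG j).memLp
  have huloc : LocallyIntegrableOn u D := hc₀.1
  -- This representative of the curl is the one that Green's formula relates to the circulations of
  -- U; the given c₀ and `weakCurl` agree with it almost everywhere.
  set c : Plane → ℝ := fun x => G 1 0 x - G 0 1 x with hc
  have hcurl : IsWeakCurl D u c :=
    isWeakCurl_of_isWeakPartial huloc ((huG 0).isWeakPartial 1) ((huG 1).isWeakPartial 0)
  have hcc₀ : c₀ =ᵐ[volume.restrict D] c := hc₀.ae_eq hD EventuallyEq.rfl hcurl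
  obtain ⟨g, hg⟩ : ∃ g, HasH1 D c g := ⟨_, (hc₀H.hasH1 hD).congr hcc₀ fun _ => EventuallyEq.rfl⟩
  have hwc : HasH1 D (weakCurl D u) g :=
    hg.congr (weakCurl_ae_eq hD hcurl).symm fun _ => EventuallyEq.rfl
  have hcP : MemLp c 2 (volume.restrict P) := hg.memLp.mono_measure hμ
  have : IsFiniteMeasure (volume.restrict P) := ⟨by simpa using hP.isCompact.measure_lt_top⟩
  obtain ⟨U, hU, hUc, hUe⟩ := hT.exists_tangential_dofs hD hDc hDne hPD hPdiam huG
  obtain ⟨κ, a, X, v, hκ, hX, hXU, hXc, ha, hva, hvm, hvc⟩ :=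
    hT.exists_interpolant hP hU (hcP.integrable (by norm_num)) hUc
  refine ⟨v, ⟨⟨⟨hvm, _, hvc, memLp_two_of_continuous (hPb.subset interior_subset)
    continuous_const⟩, fun t ht => ⟨a t, -κ / 2, hva t ht⟩, κ, hvc⟩, fun i t ht hi hi' => ?_⟩,
    fun w hw => ?_, ?_⟩
  · have hne := (fin_succ_ne i).symm
    refine ⟨U i (i + 1), ((hUe t ht i hi _ hi' hne).1 _).2 rfl,
      (hT.isTangentialIntegral_ned ht hi hi' hne (hva t ht) _).2 ?_⟩
    rw [ha t ht i hi _ hi', hXU]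
  · obtain ⟨⟨-, hwt, κ', hwκ⟩, hwd⟩ := hw
    choose! a' b' hab using hwt
    refine hT.ae_eq_of_nedDof_eq hP hva hab hvc hwκ fun t ht i hi hi' => ?_
    have hne := (fin_succ_ne i).symm
    obtain ⟨m, hm1, hm2⟩ := hwd i t ht hi hi'
    rw [← (hT.isTangentialIntegral_ned ht hi hi' hne (hab t ht) m).1 hm2,
      ((hUe t ht i hi _ hi' hne).1 m).1 hm1, ha t ht i hi _ hi', hXU]
  · set h := Metric.diam P with hh
    have hGi : ∀ j i, Integrable (fun x => G j i x ^ 2) (volume.restrict D) := fun j i =>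
      ((huG j).partial_memLp i).integrable_sq
    have hG2 : Integrable (fun x => G 0 0 x ^ 2 + G 0 1 x ^ 2) (volume.restrict D) :=
      (hGi 0 0).add (hGi 0 1)
    have hG3 : Integrable (fun x => G 0 0 x ^ 2 + G 0 1 x ^ 2 + G 1 0 x ^ 2)
        (volume.restrict D) := hG2.add (hGi 1 0)
    have hGs : Integrable (fun x => G 0 0 x ^ 2 + G 0 1 x ^ 2 + G 1 0 x ^ 2 + G 1 1 x ^ 2)
        (volume.restrict D) := hG3.add (hGi 1 1)
    have hvP : MemLp v 2 (volume.restrict P) := by rwa [hPi] at hvm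
    have huP : MemLp u 2 (volume.restrict P) := huLp.mono_measure hμ
    have err := hT.integral_error_sq_le hP hang hs hs0 hlam hE huP hvP
      (hGs.mono_measure hμ) hcP hU hX hXU hUc hκ hXc
      (fun t ht i hi j hj hij => (hUe t ht i hi j hj hij).2) ha hva
    rw [← hA, ← hK, ← hh] at err
    have hfin : volume P ≠ ⊤ := hP.isCompact.measure_lt_top.ne
    -- The mean κ is the best constant on P, so the left side is a lower bound for every constant,
    -- and the Poincaré inequality on the convex set D applies although P need not be convex.
    have herrc : ∫ x in P, (c x - κ) ^ 2 ≤ 8 * h ^ 2 * ∫ x in D, (g 0 x ^ 2 + g 1 x ^ 2) := by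
      refine hg.integral_sub_sq_le hD hDc hDne hDdiam hDb hPD fun r => ?_
      rw [hPi, integral_sub_mean_sq hfin hcP hκ r]
      have : 0 ≤ (κ - r) ^ 2 * volume.real P := by positivity
      linarith
    have hIG : ∫ x in P, (G 0 0 x ^ 2 + G 0 1 x ^ 2 + G 1 0 x ^ 2 + G 1 1 x ^ 2)
        ≤ (∫ x in D, G 0 0 x ^ 2) + (∫ x in D, G 0 1 x ^ 2) + (∫ x in D, G 1 0 x ^ 2)
          + ∫ x in D, G 1 1 x ^ 2 := by
      rw [← integral_add (hGi 0 0) (hGi 0 1), ← integral_add hG2 (hGi 1 0),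
        ← integral_add hG3 (hGi 1 1)]
      exact integral_mono_measure hμ (Eventually.of_forall fun x => by positivity) hGs
    have hIc : ∫ x in P, c x ^ 2 ≤ ∫ x in D, weakCurl D u x ^ 2 := by
      have e : ∫ x in D, weakCurl D u x ^ 2 = ∫ x in D, c x ^ 2 := by
        refine integral_congr_ae ?_
        filter_upwards [weakCurl_ae_eq hD hcurl] with x hx
        rw [hx]
      rw [e]
      exact integral_mono_measure hμ (Eventually.of_forall fun x => sq_nonneg _)
        hg.memLp.integrable_sq
    have hleft : ∫ x in interior P, ‖u x - v x‖ ^ 2 + weakCurl (interior P) (fun x => u x - v x) x ^ 2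
        = (∫ x in P, ‖u x - v x‖ ^ 2) + ∫ x in P, (c x - κ) ^ 2 := by
      have h1 : MemLp (fun x => u x - v x) 2 (volume.restrict P) := huP.sub hvP
      have h2 : MemLp (fun x => c x - κ) 2 (volume.restrict P) := hcP.sub (memLp_const κ)
      rw [← integral_add h1.norm.integrable_sq h2.integrable_sq, ← hPi]
      refine integral_congr_ae ?_
      filter_upwards [weakCurl_ae_eq isOpen_interior ((hcurl.mono hPD).sub hvc)] with x hx
      rw [hx]
    set N := ∑ j, h1NormSq D (fun x => u x j) + h1NormSq D (weakCurl D u) with hN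
    have hNe : N = (∫ x in D, u x 0 ^ 2) + ((∫ x in D, G 0 0 x ^ 2) + ∫ x in D, G 0 1 x ^ 2)
        + ((∫ x in D, u x 1 ^ 2) + ((∫ x in D, G 1 0 x ^ 2) + ∫ x in D, G 1 1 x ^ 2))
        + ((∫ x in D, weakCurl D u x ^ 2) + ((∫ x in D, g 0 x ^ 2) + ∫ x in D, g 1 x ^ 2)) := by
      rw [hN, Fin.sum_univ_two, (huG 0).h1NormSq_eq hD, (huG 1).h1NormSq_eq hD,
        hwc.h1NormSq_eq hD]
    have n0 : ∀ f : Plane → ℝ, 0 ≤ ∫ x in D, f x ^ 2 := fun f => integral_nonneg fun x => sq_nonneg _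
    rw [integral_add (hg.partial_memLp 0).integrable_sq (hg.partial_memLp 1).integrable_sq]
      at herrc
    set IG := ∫ x in P, (G 0 0 x ^ 2 + G 0 1 x ^ 2 + G 1 0 x ^ 2 + G 1 1 x ^ 2)
    set Ic := ∫ x in P, c x ^ 2
    have hIG0 : 0 ≤ IG := integral_nonneg fun x => by positivity
    have hIc0 : 0 ≤ Ic := integral_nonneg fun x => sq_nonneg _
    set Ig := (∫ x in D, g 0 x ^ 2) + ∫ x in D, g 1 x ^ 2
    have hIg0 : 0 ≤ Ig := add_nonneg (n0 _) (n0 _)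
    have hNge : IG + Ic + Ig ≤ N := by
      rw [hNe]
      have m0 := n0 fun x => u x 0
      have m1 := n0 fun x => u x 1
      simp only at m0 m1
      linarith
    have hN0 : 0 ≤ N := by linarith
    have hbound : (∫ x in P, ‖u x - v x‖ ^ 2) + ∫ x in P, (c x - κ) ^ 2
        ≤ (A * (21 + K) + 8) * h ^ 2 * N := by
      have e1 : 21 * IG + K * Ic ≤ (21 + K) * N := by
        nlinarith [mul_nonneg hK0.le hIG0, mul_nonneg hK0.le hIg0,
          mul_le_mul_of_nonneg_left hNge hK0.le]
      have e2 := mul_le_mul_of_nonneg_left e1 (by positivity : 0 ≤ A * h ^ 2)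
      have e3 : 8 * h ^ 2 * Ig ≤ 8 * h ^ 2 * N :=
        mul_le_mul_of_nonneg_left (by linarith) (by positivity)
      linarith
    rw [hCurlNorm, h1CurlNorm, hleft]
    refine Real.sqrt_le_iff.2 ⟨by have := Metric.diam_nonneg (s := P); positivity, hbound.trans_eq ?_⟩
    rw [mul_pow, mul_pow, Real.sq_sqrt (by positivity), Real.sq_sqrt hN0]
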